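/- **Setting.** Let $1\le d\le 3$, $m=d+2$. Conservation variables are $u=(\rho,\rho V_j,\rho E)\in\mathbb R^m$. The gas is calorically perfect with specific heats $c_p>c_v>0$, $\gamma=c_p/c_v$, Prandtl number $Pr>0$, pressure $p=(\gamma-1)(\rho E-\rho\|V\|^2/2)$ and temperature $T=p/(\rho(c_p-c_v))$. The physical states are $X_u=\{\rho>0,\ p>0\}$. The inviscid flux is $F(u)=(\rho V_j,\ \rho V_iV_j+\delta_{ij}p,\ V_j(\rho E+p))$. The viscous flux is $G(u,\nabla u)=-(0,\ \tau_{ij},\ V_i\tau_{ij}-f_j)$ with $$\tau_{ij}=\mu\Big(\partial_jV_i+\partial_iV_j-\tfrac23(\nabla\!\cdot\! V)\delta_{ij}\Big)+\beta(\nabla\!\cdot\! V)\delta_{ij},\qquad f_j=-\frac{c_p\mu}{Pr}\,\partial_jT,$$ where the viscosities $\mu,\beta\ge 0$ are constants or continuous functions of the state in $X_u$. Let $s=\log(p/\rho^\gamma)-s_0$, let $H=-\rho s$ be the generalized entropy, let $v(u)=\partial H/\partial u$ be the entropy variables, $X_v=v(X_u)$ (a half-space), and $u(v)$ the inverse mapping.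 Write $F(v)=F(u(v))$, $\tilde A_0=\partial u/\partial v$, $G(v,q)=G(u(v),\tilde A_0(v)\,q)$, $A_n=(\partial F/\partial u)\cdot n$, and $|\tilde A_n|_{\tilde A_0}=|A_n|\tilde A_0$, where $|R\Lambda R^{-1}|=R|\Lambda|R^{-1}$. **Scheme.** Let $\mathcal T_h$ be a non-curved mesh with periodic boundaries: its elements and faces are images of a reference polytope $K_{ref}$, resp. $F_{ref}$, under nonsingular affine maps, the elements have disjoint interiors, and each face is shared by exactly two element sides with opposite outward unit normals $n$ (boundary faces are identified in pairs by translations). Let $k\ge 0$. Let $\mathcal Q_h^k,\mathcal V_h^k$ be the spaces of $\mathbb R^{m\times d}$- and $\mathbb R^m$-valued functions that are polynomials of degree $\le k$ on each element, and let $\mathcal M_h^k$ be a linear space of $\mathbb R^m$-valued functions on the skeleton that are polynomials of degree $\le k$ on each face, containing all such functions that are continuous on the skeleton of the periodic domain. A solution on $[0,t_f]$ consists of $q_h(t)\in\mathcal Q_h^k$, $v_h(t)\in\mathcal V_h^k$, $\widehat v_h(t)\in\mathcal M_h^k$, with $v_h$ continuous in time on $[0,t_f]$ and differentiable on $(0,t_f)$,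 such that for all $t\in(0,t_f)$ and all $(r,w,\eta)\in\mathcal Q_h^k\times\mathcal V_h^k\times\mathcal M_h^k$ $$(q_h,r)_{\mathcal T_h}+(v_h,\nabla\cdot r)_{\mathcal T_h}-\langle\widehat v_h,r\cdot n\rangle_{\partial\mathcal T_h}=0,$$ $$\Big(\frac{\partial u(v_h)}{\partial t},w\Big)_{\mathcal T_h}-\big(F(v_h)+G(v_h,q_h),\nabla w\big)_{\mathcal T_h}+\langle\widehat f_h+\widehat g_h,w\rangle_{\partial\mathcal T_h}=0,$$ $$\langle\widehat f_h+\widehat g_h,\eta\rangle_{\partial\mathcal T_h}=0,$$ and $(v_h|_{t=0}-v(u_0),w)_{\mathcal T_h}=0$ for all $w\in\mathcal V_h^k$. Here $$\widehat f_h=\tfrac12\big(F(\widehat v_h)+F(v_h)\big)\cdot n+\tfrac12\,\sigma(\widehat v_h,v_h;n)\,(v_h-\widehat v_h),$$ and $\widehat g_h$ is the projection viscous numerical flux $\widehat g_h=\big(\Pi_{\mathcal Q_h^k}[G(v_h,q_h)]\big)\cdot n$, with $\Pi_{\mathcal Q_h^k}$ the $L^2$-projection onto $\mathcal Q_h^k$.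 The face integrals are assumed to exist, and the numerical solution is assumed to be physical: $v_h$ (on the closed elements) and $\widehat v_h$ (on the faces) take values in $X_v$. **Stabilization.** Let $\tilde v(\theta;v_1,v_2)=v_1+\theta(v_2-v_1)$, $\theta\in[0,1]$. The matrix $\sigma$ is one of (i) the mean-value matrix $\sigma_{MV}(v_1,v_2;n)=\int_0^1(1-\theta)\Big(|\tilde A_n(\tilde v(\theta;v_1,v_2))|_{\tilde A_0}+|\tilde A_n(\tilde v(\theta;v_2,v_1))|_{\tilde A_0}\Big)d\theta$; (ii) the symmetric variable matrix $\sigma_S(v_1,v_2;n)=|\tilde A_n(v_*)|_{\tilde A_0}$; (iii) the symmetric Lax–Friedrichs matrix $\sigma_{SLF}(v_1,v_2;n)=\lambda_{max}(v_*)\,\tilde A_0(v_*)$, with $\lambda_{max}$ the largest absolute value of an eigenvalue of $A_n$; where in (ii) and (iii) $v_*=v_*(v_1,v_2;n)\in X_v$ satisfies, for all $v_1,v_2\in X_v$ and $\|n\|=1$, $$(v_2-v_1)^t|\tilde A_n(v_*)|_{\tilde A_0}(v_2-v_1)\ \ge\ \sup_{\theta\in[0,1]}(v_2-v_1)^t|\tilde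 A_n(\tilde v(\theta;v_1,v_2))|_{\tilde A_0}(v_2-v_1).$$ **Claim.** Then the scheme is entropy stable: the total generalized entropy is non-increasing in time on $[0,t_f]$, with $$\frac{d}{dt}\int_{\mathcal T_h}H(u(v_h(t)))\le 0\quad\text{for } t\in(0,t_f),$$ and, for all $t\in[0,t_f]$ and with $v_{h,0}=v_h|_{t=0}$, $$\int_{\mathcal T_h}H(u^*(v_{h,0}))\le\int_{\mathcal T_h}H(u(v_h(t)))\le\int_{\mathcal T_h}H(u(v_{h,0})),\qquad u^*(v_h)=\frac1{\mu_L(\Omega)}\int_{\mathcal T_h}u(v_h),$$ where $\Omega$ is the domain partitioned by $\mathcal T_h$ and $\mu_L$ is Lebesgue measure. -/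

import Mathlib

open MeasureTheory

noncomputable section

namespace HDGNS

/-! ### Compressible flow of a calorically perfect gas -/

/-- Indices of the `d + 2` conservation variables `(ρ, ρ V_1, …, ρ V_d, ρ E)`. -/
abbrev Idx (d : ℕ) := Unit ⊕ Fin d ⊕ Unit

/-- State vectors with `m = d + 2` components. -/
abbrev State (d : ℕ) := Idx d → ℝ

/-- Physical space. -/
abbrev Pt (d : ℕ) := EuclideanSpace ℝ (Fin d)

/-- The index of the density. -/
abbrev iRho {d : ℕ} : Idx d := Sum.inl ()

/-- The index of the `j`-th momentum component. -/
abbrev iMom {d : ℕ} (j : Fin d) : Idx d := Sum.inr (Sum.inl j)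

/-- The index of the total energy. -/
abbrev iEn {d : ℕ} : Idx d := Sum.inr (Sum.inr ())

/-- The state (or flux column) with the given density, momentum and energy components. -/
def mkState {d : ℕ} (a : ℝ) (b : Fin d → ℝ) (c : ℝ) : State d :=
  Sum.elim (fun _ => a) (Sum.elim b (fun _ => c))

/-- Constants of a calorically perfect gas: specific heats at constant pressure and volume
(so that `γ = cp / cv > 1`), Prandtl number, and baseline entropy level. -/
structure Gas where
  cp : ℝ
  cv : ℝ
  Pr : ℝ
  s0 : ℝ
  cv_pos : 0 < cv
  cv_lt_cp : cv < cp
  Pr_pos : 0 < Pr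

variable {d : ℕ}

/-- The ratio of specific heats. -/
def Gas.gam (g : Gas) : ℝ := g.cp / g.cv

/-- Velocity `V`. -/
def vel (u : State d) (j : Fin d) : ℝ := u (iMom j) / u iRho

/-- Pressure `p = (γ - 1) (ρ E - ρ ‖V‖² / 2)`. -/
def pressure (g : Gas) (u : State d) : ℝ :=
  (g.gam - 1) * (u iEn - u iRho * (∑ j, vel u j ^ 2) / 2)

/-- Temperature, from the ideal gas law `p = ρ (cp - cv) T`. -/
def temperature (g : Gas) (u : State d) : ℝ := pressure g u / (u iRho * (g.cp - g.cv))

/-- The set `X_u` of physical states: positive density and pressure. -/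
def physU (g : Gas) (d : ℕ) : Set (State d) := {u | 0 < u iRho ∧ 0 < pressure g u}

/-- The `j`-th column of the inviscid flux `F(u)`. -/
def inviscidFlux (g : Gas) (u : State d) (j : Fin d) : State d :=
  mkState (u (iMom j))
    (fun i => u (iMom i) * vel u j + if i = j then pressure g u else 0)
    (vel u j * (u iEn + pressure g u))

/-- The inviscid flux `F(u) · n` in the direction `n`. -/
def inviscidFluxN (g : Gas) (n : Pt d) (u : State d) : State d :=
  fun i => ∑ j, inviscidFlux g u j i * n j

/-- Thermodynamic entropy `s = log (p / ρ ^ γ) - s₀`. -/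
def thermoEntropy (g : Gas) (u : State d) : ℝ :=
  Real.log (pressure g u / u iRho ^ g.gam) - g.s0

/-- The generalized entropy function `H = - ρ s`. -/
def entropyH (g : Gas) (u : State d) : ℝ := -(u iRho * thermoEntropy g u)

/-- The entropy variables `v(u)`. -/
def entrOfCons (g : Gas) (u : State d) : State d :=
  (g.gam - 1) • mkState
    (-(thermoEntropy g u) / (g.gam - 1) + (g.gam + 1) / (g.gam - 1) - u iEn / pressure g u)
    (fun j => u iRho * vel u j / pressure g u)
    (-(u iRho / pressure g u))

/-- The set `X_v = v(X_u)` of physical states in entropy variables. -/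
def physV (g : Gas) (d : ℕ) : Set (State d) := entrOfCons g '' physU g d

/-- Density as a function of the entropy variables. -/
def rhoOfEntr (g : Gas) (v : State d) : ℝ :=
  ((g.gam - 1) / (-v iEn) *
    Real.exp (-(g.gam - v iRho - (∑ j, v (iMom j) ^ 2) / (2 * (-v iEn)) + g.s0)))
    ^ (1 / (g.gam - 1))

/-- The inverse mapping `u(v)` (see `consOfEntr_entrOfCons`). -/
def consOfEntr (g : Gas) (v : State d) : State d :=
  mkState (rhoOfEntr g v)
    (fun j => rhoOfEntr g v * (v (iMom j) / (-v iEn)))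
    (rhoOfEntr g v / (-v iEn)
      + rhoOfEntr g v * (∑ j, (v (iMom j) / (-v iEn)) ^ 2) / 2)

/-- `u(v)` inverts `v(u)` on the physical states. -/
theorem consOfEntr_entrOfCons (g : Gas) (u : State d) (hu : u ∈ physU g d) :
    consOfEntr g (entrOfCons g u) = u := by
  obtain ⟨hr, hp⟩ := hu
  have hG : 0 < g.gam - 1 := by
    have h : 1 < g.gam := (one_lt_div g.cv_pos).2 g.cv_lt_cp
    linarith
  have hE : u iEn = pressure g u / (g.gam - 1) + u iRho * (∑ j, vel u j ^ 2) / 2 := by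
    unfold pressure
    field_simp
    ring
  have hs : thermoEntropy g u + g.s0 = Real.log (pressure g u / u iRho ^ g.gam) := by
    unfold thermoEntropy
    ring
  have hm : ∀ j, vel u j * u iRho = u (iMom j) := fun j => by
    unfold vel
    field_simp
  generalize hP : pressure g u = p at *
  generalize hS : thermoEntropy g u = s at *
  set r := u iRho with hrdef
  set G := g.gam - 1 with hGdef
  have e1 : entrOfCons g u iEn = -(G * (r / p)) := by
    simp [entrOfCons, mkState, hP, ← hGdef]
    exact Or.inl rfl
  have e2 : ∀ j, entrOfCons g u (iMom j) = G * (r * vel u j / p) := fun j => by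
    simp [entrOfCons, mkState, hP, ← hGdef]
    exact Or.inl rfl
  have e3 : entrOfCons g u iRho = -s + (g.gam + 1) - G * (u iEn / p) := by
    simp only [entrOfCons, mkState, Pi.smul_apply, Sum.elim_inl, smul_eq_mul, hP, hS, ← hGdef]
    field_simp
  have e4 : ∀ j, entrOfCons g u (iMom j) / (-entrOfCons g u iEn) = vel u j := fun j => by
    rw [e1, e2]
    field_simp
  have e5 : (∑ j, entrOfCons g u (iMom j) ^ 2) / (2 * (-entrOfCons g u iEn))
      = G * r / (2 * p) * ∑ j, vel u j ^ 2 := by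
    rw [e1, Finset.sum_div, Finset.mul_sum]
    refine Finset.sum_congr rfl fun j _ => ?_
    rw [e2]
    field_simp
  have hgam : g.gam = G + 1 := by rw [hGdef]; ring
  have e6 : g.gam - entrOfCons g u iRho
      - (∑ j, entrOfCons g u (iMom j) ^ 2) / (2 * (-entrOfCons g u iEn)) + g.s0
      = Real.log (p / r ^ g.gam) := by
    rw [e5, e3, ← hs, hE]
    field_simp
    ring
  have hrg : 0 < r ^ g.gam := Real.rpow_pos_of_pos hr _
  have hrho : rhoOfEntr g (entrOfCons g u) = r := by
    unfold rhoOfEntr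
    rw [e6, Real.exp_neg, Real.exp_log (div_pos hp hrg), e1, ← hGdef]
    have : G / - -(G * (r / p)) * (p / r ^ g.gam)⁻¹ = r ^ G := by
      rw [hgam, Real.rpow_add hr, Real.rpow_one]
      have := Real.rpow_pos_of_pos hr G
      field_simp
    rw [this, ← Real.rpow_mul hr.le, mul_one_div_cancel hG.ne', Real.rpow_one]
  funext i
  rcases i with i | i | i
  · exact hrho
  · change rhoOfEntr g (entrOfCons g u) * _ = u (iMom i)
    rw [hrho, e4, ← hm]
    ring
  · change rhoOfEntr g (entrOfCons g u) / _ + rhoOfEntr g (entrOfCons g u) * _ / 2 = u iEn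
    simp only [hrho, e4]
    rw [e1, hE]
    field_simp

/-- The Jacobian matrix of a map between state spaces. -/
def jac (f : State d → State d) (x : State d) : Matrix (Idx d) (Idx d) ℝ :=
  Matrix.of fun i l => fderiv ℝ f x (Pi.single l 1) i

/-- `Ã₀(v) = ∂u/∂v`. -/
def metricA0 (g : Gas) (v : State d) : Matrix (Idx d) (Idx d) ℝ := jac (consOfEntr g) v

/-- `A_n = (∂F/∂u) · n`, evaluated at `u(v)`. -/
def jacAn (g : Gas) (n : Pt d) (v : State d) : Matrix (Idx d) (Idx d) ℝ :=
  jac (inviscidFluxN g n) (consOfEntr g v)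

open Classical in
/-- The absolute value `R |Λ| R⁻¹` of a matrix `R Λ R⁻¹` that is diagonalizable over `ℝ`
(and `0` for all other matrices). It does not depend on the diagonalization. -/
def matAbs {ι : Type} [Fintype ι] [DecidableEq ι] (A : Matrix ι ι ℝ) : Matrix ι ι ℝ :=
  if h : ∃ R : Matrix ι ι ℝ × (ι → ℝ), IsUnit R.1.det ∧ A = R.1 * Matrix.diagonal R.2 * R.1⁻¹
  then h.choose.1 * Matrix.diagonal (fun i => |h.choose.2 i|) * h.choose.1⁻¹
  else 0

/-- The generalized absolute value `|Ã_n|_{Ã₀} = |A_n| Ã₀`. -/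
def absAn (g : Gas) (n : Pt d) (v : State d) : Matrix (Idx d) (Idx d) ℝ :=
  matAbs (jacAn g n v) * metricA0 g v

/-- The largest absolute value of an eigenvalue of `A_n`. -/
def lamMax (g : Gas) (n : Pt d) (v : State d) : ℝ :=
  sSup {r | ∃ l : ℝ, Module.End.HasEigenvalue (Matrix.toLin' (jacAn g n v)) l ∧ r = |l|}

/-- The quadratic form `zᵗ A z`. -/
def quadForm (A : Matrix (Idx d) (Idx d) ℝ) (z : State d) : ℝ := z ⬝ᵥ A.mulVec z

/-! ### Viscous fluxes -/

/-- Derivatives `∂V_i/∂x_j`, given `u` and the array `D l k = ∂u_l/∂x_k`. -/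
def gradVel (u : State d) (D : Idx d → Fin d → ℝ) (i j : Fin d) : ℝ :=
  fderiv ℝ (fun u' : State d => vel u' i) u (fun l => D l j)

/-- Derivatives `∂T/∂x_j`, given `u` and the array `D l k = ∂u_l/∂x_k`. -/
def gradTemp (g : Gas) (u : State d) (D : Idx d → Fin d → ℝ) (j : Fin d) : ℝ :=
  fderiv ℝ (temperature g) u (fun l => D l j)

/-- The viscous stress tensor. The shear viscosity `mu` and the bulk viscosity `beta` may
depend on the local state. -/
def stress (mu beta : State d → ℝ) (u : State d) (D : Idx d → Fin d → ℝ) (i j : Fin d) : ℝ :=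
  mu u * (gradVel u D i j + gradVel u D j i
      - if i = j then 2 / 3 * ∑ k, gradVel u D k k else 0)
    + if i = j then beta u * ∑ k, gradVel u D k k else 0

/-- The heat flux `f_j = - κ ∂T/∂x_j`, with `κ = cp μ / Pr`. -/
def heatFlux (g : Gas) (mu : State d → ℝ) (u : State d) (D : Idx d → Fin d → ℝ) (j : Fin d) : ℝ :=
  -(g.cp * mu u / g.Pr * gradTemp g u D j)

/-- The `j`-th column of the viscous flux `G(u, ∇u)`. -/
def viscousFluxU (g : Gas) (mu beta : State d → ℝ) (u : State d) (D : Idx d → Fin d → ℝ)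
    (j : Fin d) : State d :=
  -mkState 0 (fun i => stress mu beta u D i j)
    (∑ i, vel u i * stress mu beta u D i j - heatFlux g mu u D j)

/-- The viscous flux `G_ij(v, q)` in entropy variables: `q` stands for `∇v`, and `∇u` is
`(∂u/∂v) q`. -/
def viscousFlux (g : Gas) (mu beta : State d → ℝ) (v : State d) (q : Idx d → Fin d → ℝ)
    (i : Idx d) (j : Fin d) : ℝ :=
  viscousFluxU g mu beta (consOfEntr g v) (fun l k => ∑ s, metricA0 g v l s * q s k) j i

/-! ### Stabilization matrices -/

/-- The path `θ ↦ ṽ(θ; v₁, v₂)` from `v₁` to `v₂`: the straight segment. -/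
def path (v1 v2 : State d) (θ : ℝ) : State d := v1 + θ • (v2 - v1)

/-- A stabilization matrix `σ(v₁, v₂; n)`. -/
abbrev Stab (d : ℕ) := State d → State d → Pt d → Matrix (Idx d) (Idx d) ℝ

/-- The mean-value stabilization matrix. -/
def sigmaMV (g : Gas) : Stab d := fun v1 v2 n => Matrix.of fun i l =>
  ∫ θ in (0 : ℝ)..1, (1 - θ) * (absAn g n (path v1 v2 θ) i l + absAn g n (path v2 v1 θ) i l)

/-- The symmetric variable stabilization matrix of the intermediate state `vs`. -/
def sigmaS (g : Gas) (vs : State d → State d → Pt d → State d) : Stab d :=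
  fun v1 v2 n => absAn g n (vs v1 v2 n)

/-- The symmetric Lax-Friedrichs stabilization matrix of the intermediate state `vs`. -/
def sigmaSLF (g : Gas) (vs : State d → State d → Pt d → State d) : Stab d :=
  fun v1 v2 n => lamMax g n (vs v1 v2 n) • metricA0 g (vs v1 v2 n)

/-- The condition on the intermediate state `v_*`: it is a physical state, and its quadratic form
in the direction `v₂ - v₁` is at least the supremum of the forms along the path. -/
def IntermediateState (g : Gas) (vs : State d → State d → Pt d → State d) : Prop :=
  ∀ v1 ∈ physV g d, ∀ v2 ∈ physV g d, ∀ n : Pt d, ‖n‖ = 1 →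
    vs v1 v2 n ∈ physV g d ∧
    ∀ θ ∈ Set.Icc (0 : ℝ) 1,
      quadForm (absAn g n (path v1 v2 θ)) (v2 - v1) ≤ quadForm (absAn g n (vs v1 v2 n)) (v2 - v1)

/-! ### Non-curved meshes with periodic boundaries -/

/-- A non-curved (`p = 1`) mesh with periodic boundaries. The elements and the faces are images
of a reference element and a reference face (polytopes) under nonsingular affine maps.
Each face `F` separates two sides `true` and `false`. For an interior face, `shift F = 0`;
otherwise `F` is one of two boundary faces that are identified with each other by periodicity,
and `F + shift F` is the other one. No face is left without a neighbour. Hanging nodes are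
allowed. -/
structure PeriodicMesh (d : ℕ) where
  Elem : Type
  Face : Type
  [fintypeElem : Fintype Elem]
  [fintypeFace : Fintype Face]
  /-- the reference element -/
  refElem : Set (Pt d)
  /-- the reference face -/
  refFace : Set (Pt (d - 1))
  refElem_polytope : ∃ s : Finset (Pt d), refElem = convexHull ℝ (s : Set (Pt d))
  refElem_interior : (interior refElem).Nonempty
  refFace_polytope : ∃ s : Finset (Pt (d - 1)), refFace = convexHull ℝ (s : Set (Pt (d - 1)))
  refFace_interior : (interior refFace).Nonempty
  /-- the parametric mapping of an element -/
  psi : Elem → (Pt d ≃ᵃ[ℝ] Pt d)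
  /-- the parametric mapping of a face -/
  phi : Face → (Pt (d - 1) →ᵃ[ℝ] Pt d)
  phi_injective : ∀ F, Function.Injective (phi F)
  elem_disjoint : ∀ K K', K ≠ K' →
    Disjoint (interior (psi K '' refElem)) (interior (psi K' '' refElem))
  /-- the element on either side of a face -/
  side : Face → Bool → Elem
  shift : Face → Pt d
  /-- the unit normal of a face that points out of the element on the side `true` -/
  normal : Face → Pt d
  /-- a face is the common part of the boundaries of its two elements -/
  face_eq : ∀ F, phi F '' refFace =
    {x | x ∈ frontier (psi (side F true) '' refElem) ∧
      x + shift F ∈ frontier (psi (side F false) '' refElem)}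
  /-- only faces on the boundary of the domain are identified with a different face -/
  shift_boundary : ∀ F, shift F ≠ 0 → ∀ x ∈ phi F '' refFace,
    x ∈ frontier (interior (⋃ K, psi K '' refElem)) ∧
      x + shift F ∈ frontier (interior (⋃ K, psi K '' refElem))
  normal_norm : ∀ F, ‖normal F‖ = 1
  normal_true : ∀ F, ∀ x ∈ phi F '' refFace, ∀ y ∈ psi (side F true) '' refElem,
    inner ℝ (normal F) (y - x) ≤ 0
  normal_false : ∀ F, ∀ x ∈ phi F '' refFace, ∀ y ∈ psi (side F false) '' refElem,
    0 ≤ inner ℝ (normal F) (y - (x + shift F))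
  /-- the boundary of each element is made up of sides of faces … -/
  frontier_cover : ∀ K, ∀ x ∈ frontier (psi K '' refElem), ∃ F s, side F s = K ∧
    x - (if s then 0 else shift F) ∈ phi F '' refFace
  /-- … which overlap in sets of vanishing `(d - 1)`-dimensional measure only -/
  face_overlap : ∀ F s F' s', side F s = side F' s' → (F, s) ≠ (F', s') →
    μHE[d - 1] {x : Pt d | x - (if s then 0 else shift F) ∈ phi F '' refFace ∧
      x - (if s' then 0 else shift F') ∈ phi F' '' refFace} = 0

attribute [instance] PeriodicMesh.fintypeElem PeriodicMesh.fintypeFace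

namespace PeriodicMesh

variable (M : PeriodicMesh d)

/-- The (closed) element `K`. -/
def elemSet (K : M.Elem) : Set (Pt d) := M.psi K '' M.refElem

/-- The (closed) face `F`. -/
def faceSet (F : M.Face) : Set (Pt d) := M.phi F '' M.refFace

/-- The domain that is partitioned by the mesh. -/
def domain : Set (Pt d) := interior (⋃ K, M.elemSet K)

/-- The translation that takes the face `F` to its position in the boundary of the element on the
side `s`. -/
def offset (F : M.Face) (s : Bool) : Pt d := if s then 0 else M.shift F

/-- The outward unit normal of the element on the side `s` of `F`. -/
def outNormal (F : M.Face) (s : Bool) : Pt d := if s then M.normal F else -M.normal F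

/-- Two points are the same point of the periodic domain. -/
def SamePoint : Pt d → Pt d → Prop :=
  Relation.EqvGen fun x y => ∃ F, x ∈ M.faceSet F ∧ y = x + M.shift F

/-- The trace on the side `s` of the face `F` of a function that is defined element by element. -/
def trace {α : Type} (w : M.Elem → Pt d → α) (F : M.Face) (s : Bool) (x : Pt d) : α :=
  w (M.side F s) (x + M.offset F s)

/-- The integral over `𝒯_h`. -/
def intElem (f : M.Elem → Pt d → ℝ) : ℝ := ∑ K, ∫ x in M.elemSet K, f K x

/-- The integral over `∂𝒯_h`, in which each face is counted once for each of its two sides. -/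
def intBdry (f : M.Face → Bool → Pt d → ℝ) : ℝ :=
  ∑ F, ∑ s, ∫ x in M.faceSet F, f F s x ∂μHE[d - 1]

end PeriodicMesh

/-- Polynomial functions of degree at most `k`. -/
def IsPoly {n : ℕ} (k : ℕ) (f : Pt n → ℝ) : Prop :=
  ∃ P : MvPolynomial (Fin n) ℝ, P.totalDegree ≤ k ∧ ∀ x, f x = MvPolynomial.eval (fun i => x i) P

/-- `ℝ^m`-valued functions on the elements. -/
abbrev VField (M : PeriodicMesh d) := M.Elem → Pt d → State d

/-- `ℝ^{m × d}`-valued functions on the elements. -/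
abbrev QField (M : PeriodicMesh d) := M.Elem → Pt d → Idx d → Fin d → ℝ

/-- `ℝ^m`-valued functions on the mesh skeleton. -/
abbrev TraceField (M : PeriodicMesh d) := M.Face → Pt d → State d

/-- The space `𝒱_h^k`. Polynomials on an element are identified with polynomials on `ℝ^d`. -/
def spaceV (M : PeriodicMesh d) (k : ℕ) : Set (VField M) :=
  {w | ∀ K i, IsPoly k fun ξ => w K (M.psi K ξ) i}

/-- The space `𝒬_h^k`. -/
def spaceQ (M : PeriodicMesh d) (k : ℕ) : Set (QField M) :=
  {r | ∀ K i j, IsPoly k fun ξ => r K (M.psi K ξ) i j}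

/-- The space `M̂_h^k` of traces that are polynomial on each face. -/
def spaceMhat (M : PeriodicMesh d) (k : ℕ) : Set (TraceField M) :=
  {mu | ∀ F i, IsPoly k fun ξ => mu F (M.phi F ξ) i}

/-- The space `M̃_h^k` of traces that, in addition, are continuous on the skeleton of the periodic
domain: as each face is closed and carries a continuous function, this means that the functions
agree wherever faces meet. -/
def spaceMtilde (M : PeriodicMesh d) (k : ℕ) : Set (TraceField M) :=
  {mu | mu ∈ spaceMhat M k ∧
    ∀ F, ∀ x ∈ M.faceSet F, ∀ F', ∀ x' ∈ M.faceSet F', M.SamePoint x x' → mu F x = mu F' x'}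

/-! ### The scheme -/

/-- The partial derivative `∂f/∂x_j`. -/
def pderiv (j : Fin d) (f : Pt d → ℝ) (x : Pt d) : ℝ :=
  fderiv ℝ f x (EuclideanSpace.single j 1)

/-- The inviscid numerical flux `f̂(v̂, v)` with normal `n` and stabilization matrix `σ`. -/
def numFlux (g : Gas) (sigma : Stab d) (n : Pt d) (vhat v : State d) : State d :=
  (1 / 2 : ℝ) • (inviscidFluxN g n (consOfEntr g vhat) + inviscidFluxN g n (consOfEntr g v))
    + (1 / 2 : ℝ) • (sigma vhat v n).mulVec (v - vhat)

/-- `P` is the `L²` projection of `G` onto `𝒬_h^k`. -/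
def IsProjQ (M : PeriodicMesh d) (k : ℕ) (G P : QField M) : Prop :=
  P ∈ spaceQ M k ∧ ∀ r ∈ spaceQ M k,
    M.intElem (fun K x => ∑ i, ∑ j, (G K x i j - P K x i j) * r K x i j) = 0

/-- `ghat` is the projection viscous numerical flux of `(v, q)`, on both sides of each face. -/
def IsProjFlux (g : Gas) (mu beta : State d → ℝ) (M : PeriodicMesh d) (k : ℕ)
    (v : VField M) (q : QField M) (ghat : M.Face → Bool → Pt d → State d) : Prop :=
  ∃ P : QField M,
    IsProjQ M k (fun K x => viscousFlux g mu beta (v K x) (q K x)) P ∧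
    ∀ F s, ∀ x ∈ M.faceSet F, ∀ i,
      ghat F s x i = ∑ j, M.trace P F s x i j * M.outNormal F s j

/-- `(q, v, v̂)` solves, on `[0, tf]`, the entropy-variable hybridized DG discretization of the
compressible Navier-Stokes equations on a periodic mesh, with trace space `Mh`, stabilization
matrix `sigma`, viscous numerical flux `ghat`, and initial condition `u0`. -/
structure IsSolution (g : Gas) (mu beta : State d → ℝ) (M : PeriodicMesh d) (k : ℕ)
    (Mh : Set (TraceField M)) (sigma : Stab d) (tf : ℝ) (u0 : Pt d → State d)
    (q : ℝ → QField M) (v : ℝ → VField M) (vhat : ℝ → TraceField M)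
    (ghat : ℝ → M.Face → Bool → Pt d → State d) : Prop where
  v_mem : ∀ t ∈ Set.Icc 0 tf, v t ∈ spaceV M k
  q_mem : ∀ t ∈ Set.Ioo 0 tf, q t ∈ spaceQ M k
  vhat_mem : ∀ t ∈ Set.Ioo 0 tf, vhat t ∈ Mh
  v_continuous : ∀ K, ∀ x ∈ M.elemSet K, ContinuousOn (fun t => v t K x) (Set.Icc 0 tf)
  v_differentiable : ∀ K, ∀ x ∈ M.elemSet K, ∀ t ∈ Set.Ioo 0 tf,
    DifferentiableAt ℝ (fun t => v t K x) t
  /-- the face integrals below exist -/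
  flux_integrable : ∀ t ∈ Set.Ioo 0 tf, ∀ F s, IntegrableOn
    (fun x => numFlux g sigma (M.outNormal F s) (vhat t F x) (M.trace (v t) F s x) + ghat t F s x)
    (M.faceSet F) μHE[d - 1]
  gradient_eq : ∀ t ∈ Set.Ioo 0 tf, ∀ r ∈ spaceQ M k,
    M.intElem (fun K x => ∑ i, ∑ j, q t K x i j * r K x i j)
      + M.intElem (fun K x => ∑ i, v t K x i * ∑ j, pderiv j (fun y => r K y i j) x)
      - M.intBdry (fun F s x =>
          ∑ i, vhat t F x i * ∑ j, M.trace r F s x i j * M.outNormal F s j) = 0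
  conservation_eq : ∀ t ∈ Set.Ioo 0 tf, ∀ w ∈ spaceV M k,
    M.intElem (fun K x => deriv (fun t' => consOfEntr g (v t' K x)) t ⬝ᵥ w K x)
      - M.intElem (fun K x => ∑ i, ∑ j,
          (inviscidFlux g (consOfEntr g (v t K x)) j i
            + viscousFlux g mu beta (v t K x) (q t K x) i j) * pderiv j (fun y => w K y i) x)
      + M.intBdry (fun F s x =>
          (numFlux g sigma (M.outNormal F s) (vhat t F x) (M.trace (v t) F s x) + ghat t F s x)
            ⬝ᵥ M.trace w F s x) = 0
  transmission_eq : ∀ t ∈ Set.Ioo 0 tf, ∀ m ∈ Mh,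
    M.intBdry (fun F s x =>
      (numFlux g sigma (M.outNormal F s) (vhat t F x) (M.trace (v t) F s x) + ghat t F s x)
        ⬝ᵥ m F x) = 0
  u0_phys : ∀ x ∈ M.domain, u0 x ∈ physU g d
  u0_integrable : IntegrableOn (fun x => entrOfCons g (u0 x)) M.domain
  initial_eq : ∀ w ∈ spaceV M k,
    M.intElem (fun K x => (v 0 K x - entrOfCons g (u0 x)) ⬝ᵥ w K x) = 0

/-- The numerical solution is physical: density and pressure are pointwise positive. -/
def IsPhysical (g : Gas) (M : PeriodicMesh d) (tf : ℝ) (v : ℝ → VField M)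
    (vhat : ℝ → TraceField M) : Prop :=
  (∀ t ∈ Set.Icc 0 tf, ∀ K, ∀ x ∈ M.elemSet K, v t K x ∈ physV g d) ∧
  (∀ t ∈ Set.Ioo 0 tf, ∀ F, ∀ x ∈ M.faceSet F, vhat t F x ∈ physV g d)

/-- The total generalized entropy `∫_{𝒯_h} H(u(v))`. -/
def totalEntropy (g : Gas) (M : PeriodicMesh d) (v : VField M) : ℝ :=
  M.intElem fun K x => entropyH g (consOfEntr g (v K x))

/-- The minimum total entropy state `u*(v)`: the mean of `u(v)` over the domain. -/
def minEntropyState (g : Gas) (M : PeriodicMesh d) (v : VField M) : State d :=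
  fun i => (volume M.domain).toReal⁻¹ * M.intElem fun K x => consOfEntr g (v K x) i

/-- Entropy stability: the total generalized entropy is non-increasing in time, and it satisfies
the entropy bounds. -/
structure EntropyStable (g : Gas) (M : PeriodicMesh d) (tf : ℝ) (v : ℝ → VField M) : Prop where
  decay : ∀ t ∈ Set.Ioo 0 tf, ∃ D ≤ 0, HasDerivAt (fun t' => totalEntropy g M (v t')) D t
  antitone : AntitoneOn (fun t => totalEntropy g M (v t)) (Set.Icc 0 tf)
  lower : ∀ t ∈ Set.Icc 0 tf,
    M.intElem (fun _ _ => entropyH g (minEntropyState g M (v 0))) ≤ totalEntropy g M (v t)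
  upper : ∀ t ∈ Set.Icc 0 tf, totalEntropy g M (v t) ≤ totalEntropy g M (v 0)

end HDGNS

end

open MeasureTheory

noncomputable section

namespace HDGNS

variable {d : ℕ}

/-! ### Thermodynamics in entropy variables -/

/-! Test the conservation equation with `v_h` and the transmission equation with `v̂_h`. Because
`∂H/∂u = v` (`fderiv_entropyH_consOfEntr`), the time term becomes the derivative of the total
entropy, and `dH/dt = (F, ∇v) - ⟨f̂, v - v̂⟩ + (G, ∇v) - ⟨ĝ, v - v̂⟩`. The inviscid and the viscous
halves are each nonpositive.

Inviscid half. The potential `ψ_n = (γ - 1) ρ V_n` satisfies `∂ψ_n/∂v = F · n`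
(`hasDerivAt_fluxPotential`), so `F : ∇v` is a divergence and `(F, ∇v) = ⟨ψ_n(v)⟩`
(`inviscid_identity`). The trace `v̂` is single-valued and `ψ_n` is odd in `n`, so `⟨ψ_n(v̂)⟩ = 0`.
What remains is a pointwise bound on each side of each face, `ψ_n(v) - ψ_n(v̂) ≤ f̂ · (v - v̂)`
(`potential_diff_le_numFlux`). The error of the trapezoidal rule for `ψ_n` along the segment is `∫
(1/2 - θ) zᵗ Ã_n z dθ` with `z = v - v̂`. It is at most half the integral of `zᵗ |Ã_n| z`, which
each admissible `σ` dominates. This uses that the entropy variables symmetrize the system: `Ã₀` is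
symmetric positive definite and `A_n Ã₀` is symmetric.

Viscous half. The projection `ΠG` is an admissible test function in the gradient equation, and both
`∇v_h` and `q_h` lie in the space projected onto. Integration by parts therefore collapses the
viscous terms to `(G, q)` (`viscous_identity`). Pointwise, `G : q` is minus the sum of a viscous
stress power and a heat conduction square; it is nonpositive since `d ≤ 3` (`sum_stress_nonneg`,
`viscous_dissipation`).

Lower bound. Constant test functions show that the integral of `u` is conserved
(`intElem_consOfEntr_eq`). The entropy is convex, being the Legendre transform of the convex
function `(γ - 1) ρ` of `v` (`entropyH_tangent`), and Jensen's inequality at the mean state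
concludes.

Two analytic tools support this. The divergence theorem on a polytope
(`IsFacetFamily.integral_fderiv`) comes from cutting it into cones over its facets. Regularity in
time of the integrals (`IsRegularField`) comes from interpolation at finitely many points, which
separates the time and space variables. -/

theorem Gas.gam_sub_one_pos (g : Gas) : 0 < g.gam - 1 := by
  have h : 1 < g.gam := (one_lt_div g.cv_pos).2 g.cv_lt_cp
  linarith

theorem dotProduct_mkState (y : State d) (a : ℝ) (b : Fin d → ℝ) (c : ℝ) :
    y ⬝ᵥ mkState a b c = y iRho * a + ∑ j, y (iMom j) * b j + y iEn * c := by
  simp [dotProduct, mkState, Fintype.sum_sum_type, add_assoc]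

/-- The velocity in terms of the entropy variables. -/
def velE (v : State d) (j : Fin d) : ℝ := v (iMom j) / (-v iEn)

/-- The pressure in terms of the entropy variables. -/
def presE (g : Gas) (v : State d) : ℝ := (g.gam - 1) * rhoOfEntr g v / (-v iEn)

/-- The derivative of the velocity in the direction `z`. -/
def dVel (v z : State d) (j : Fin d) : ℝ := (z (iMom j) + velE v j * z iEn) / (-v iEn)

/-- `γ - 1` times the logarithmic derivative of the density in the direction `z`. -/
def dLogRho (v z : State d) : ℝ :=
  z iRho + ∑ j, velE v j * z (iMom j) + z iEn / (-v iEn) + (∑ j, velE v j ^ 2) / 2 * z iEn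

theorem rhoOfEntr_base_pos (g : Gas) {v : State d} (hv : v iEn < 0) :
    0 < (g.gam - 1) / (-v iEn) *
      Real.exp (-(g.gam - v iRho - (∑ j, v (iMom j) ^ 2) / (2 * (-v iEn)) + g.s0)) :=
  mul_pos (div_pos g.gam_sub_one_pos (neg_pos.2 hv)) (Real.exp_pos _)

theorem rhoOfEntr_pos (g : Gas) {v : State d} (hv : v iEn < 0) : 0 < rhoOfEntr g v :=
  Real.rpow_pos_of_pos (rhoOfEntr_base_pos g hv) _

theorem consOfEntr_rho (g : Gas) (v : State d) : consOfEntr g v iRho = rhoOfEntr g v := rfl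

theorem consOfEntr_mom (g : Gas) (v : State d) (j : Fin d) :
    consOfEntr g v (iMom j) = rhoOfEntr g v * velE v j := rfl

theorem consOfEntr_en (g : Gas) (v : State d) :
    consOfEntr g v iEn = rhoOfEntr g v / (-v iEn) + rhoOfEntr g v * (∑ j, velE v j ^ 2) / 2 := rfl

theorem vel_consOfEntr (g : Gas) {v : State d} (hv : v iEn < 0) (j : Fin d) :
    vel (consOfEntr g v) j = velE v j := by
  unfold vel
  rw [consOfEntr_mom, consOfEntr_rho, mul_div_cancel_left₀ _ (rhoOfEntr_pos g hv).ne']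

theorem pressure_consOfEntr (g : Gas) {v : State d} (hv : v iEn < 0) :
    pressure g (consOfEntr g v) = presE g v := by
  unfold pressure presE
  simp only [vel_consOfEntr g hv]
  rw [consOfEntr_en, consOfEntr_rho]
  ring

theorem presE_pos (g : Gas) {v : State d} (hv : v iEn < 0) : 0 < presE g v :=
  div_pos (mul_pos g.gam_sub_one_pos (rhoOfEntr_pos g hv)) (neg_pos.2 hv)

/-- Only the energy component of the entropy variables enters the temperature. The heat flux is
therefore a multiple of `q iEn`, and its contribution to the dissipation is a multiple of a sum of
squares. -/
theorem temperature_consOfEntr (g : Gas) {v : State d} (hv : v iEn < 0) :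
    temperature g (consOfEntr g v) = 1 / (g.cv * (-v iEn)) := by
  unfold temperature
  rw [pressure_consOfEntr g hv, consOfEntr_rho, presE]
  have h1 := (rhoOfEntr_pos g hv).ne'
  have h2 : -v iEn ≠ 0 := (neg_pos.2 hv).ne'
  have h9 : v iEn ≠ 0 := hv.ne
  have h3 := g.cv_pos.ne'
  have h4 : g.cp - g.cv ≠ 0 := (sub_pos.2 g.cv_lt_cp).ne'
  have h5 : g.gam - 1 = (g.cp - g.cv) / g.cv := by
    unfold Gas.gam
    field_simp
  rw [h5]
  field_simp

theorem consOfEntr_mem_physU (g : Gas) {v : State d} (hv : v iEn < 0) :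
    consOfEntr g v ∈ physU g d :=
  ⟨rhoOfEntr_pos g hv, by rw [pressure_consOfEntr g hv]; exact presE_pos g hv⟩

theorem log_rhoOfEntr (g : Gas) {v : State d} (hv : v iEn < 0) :
    (g.gam - 1) * Real.log (rhoOfEntr g v) = Real.log (g.gam - 1) - Real.log (-v iEn)
      - (g.gam - v iRho - (∑ j, v (iMom j) ^ 2) / (2 * (-v iEn)) + g.s0) := by
  have h1 := g.gam_sub_one_pos
  have h2 : 0 < -v iEn := neg_pos.2 hv
  unfold rhoOfEntr
  rw [Real.log_rpow (rhoOfEntr_base_pos g hv), Real.log_mul (div_pos h1 h2).ne'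
    (Real.exp_pos _).ne', Real.log_div h1.ne' h2.ne', Real.log_exp]
  field_simp
  ring

theorem thermoEntropy_consOfEntr (g : Gas) {v : State d} (hv : v iEn < 0) :
    thermoEntropy g (consOfEntr g v)
      = g.gam - v iRho - (∑ j, v (iMom j) ^ 2) / (2 * (-v iEn)) := by
  have h1 := g.gam_sub_one_pos
  have h2 : 0 < -v iEn := neg_pos.2 hv
  have h3 := rhoOfEntr_pos g hv
  have h4 := log_rhoOfEntr g hv
  unfold thermoEntropy
  rw [pressure_consOfEntr g hv, consOfEntr_rho, Real.log_div (presE_pos g hv).ne'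
    (Real.rpow_pos_of_pos h3 _).ne', Real.log_rpow h3, presE,
    Real.log_div (mul_pos h1 h3).ne' h2.ne', Real.log_mul h1.ne' h3.ne']
  linarith

theorem sum_mom_sq (v : State d) (hv : v iEn < 0) :
    (∑ j, v (iMom j) ^ 2) / (2 * (-v iEn)) = (-v iEn) * (∑ j, velE v j ^ 2) / 2 := by
  have h2 : -v iEn ≠ 0 := (neg_pos.2 hv).ne'
  have h9 : v iEn ≠ 0 := hv.ne
  have : ∑ j, v (iMom j) ^ 2 = (-v iEn) ^ 2 * ∑ j, velE v j ^ 2 := by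
    rw [Finset.mul_sum]
    refine Finset.sum_congr rfl fun j _ => ?_
    unfold velE
    field_simp
  rw [this]
  field_simp

theorem entrOfCons_consOfEntr (g : Gas) {v : State d} (hv : v iEn < 0) :
    entrOfCons g (consOfEntr g v) = v := by
  have h9 : v iEn ≠ 0 := hv.ne
  have h1 := g.gam_sub_one_pos
  have h2 : 0 < -v iEn := neg_pos.2 hv
  have h3 := rhoOfEntr_pos g hv
  unfold entrOfCons
  rw [thermoEntropy_consOfEntr g hv, pressure_consOfEntr g hv, consOfEntr_rho, sum_mom_sq v hv,
    consOfEntr_en]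
  simp only [vel_consOfEntr g hv]
  funext i
  rcases i with i | i | i
  · simp only [mkState, presE, Pi.smul_apply, Sum.elim_inl, smul_eq_mul]
    field_simp
    ring
  · simp only [mkState, presE, Pi.smul_apply, Sum.elim_inl, Sum.elim_inr, smul_eq_mul, velE]
    field_simp
  · simp only [mkState, presE, Pi.smul_apply, Sum.elim_inr, smul_eq_mul]
    field_simp

/-- The two inverse relations between `entrOfCons` and `consOfEntr` turn the image of `X_u` into an
open half-space. Its convexity keeps straight paths between physical states physical. -/
theorem mem_physV_iff (g : Gas) {v : State d} : v ∈ physV g d ↔ v iEn < 0 := by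
  constructor
  · rintro ⟨u, ⟨hr, hp⟩, rfl⟩
    have h1 := g.gam_sub_one_pos
    change (g.gam - 1) * (-(u iRho / pressure g u)) < 0
    have := div_pos hr hp
    nlinarith
  · intro hv
    exact ⟨_, consOfEntr_mem_physU g hv, entrOfCons_consOfEntr g hv⟩

theorem physV_eq (g : Gas) (d : ℕ) : physV g d = {v | v iEn < 0} :=
  Set.ext fun _ => mem_physV_iff g

theorem isOpen_physV (g : Gas) (d : ℕ) : IsOpen (physV g d) := by
  rw [physV_eq]
  exact isOpen_lt (continuous_apply _) continuous_const

theorem convex_physV (g : Gas) (d : ℕ) : Convex ℝ (physV g d) := by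
  rw [physV_eq]
  exact convex_halfSpace_lt (f := fun v : State d => v iEn) ⟨fun _ _ => rfl, fun _ _ => rfl⟩ 0

/-- Since `dLogRho` is `γ - 1` times the logarithmic derivative of the density, this makes `u(v)`
the gradient of the dual potential `(γ - 1) ρ`. -/
theorem dotProduct_consOfEntr (g : Gas) {v : State d} (y : State d) :
    y ⬝ᵥ consOfEntr g v = rhoOfEntr g v * dLogRho v y := by
  unfold consOfEntr dLogRho
  rw [dotProduct_mkState]
  have : ∑ j, y (iMom j) * (rhoOfEntr g v * (v (iMom j) / -v iEn))
      = rhoOfEntr g v * ∑ j, velE v j * y (iMom j) := by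
    rw [Finset.mul_sum]
    exact Finset.sum_congr rfl fun j _ => by unfold velE; ring
  rw [this]
  unfold velE
  ring

/-- The generalized entropy is the Legendre transform of `(γ - 1) ρ`. -/
theorem entropyH_consOfEntr (g : Gas) {v : State d} (hv : v iEn < 0) :
    entropyH g (consOfEntr g v) = v ⬝ᵥ consOfEntr g v - (g.gam - 1) * rhoOfEntr g v := by
  have h2 : -v iEn ≠ 0 := (neg_pos.2 hv).ne'
  have h9 : v iEn ≠ 0 := hv.ne
  rw [dotProduct_consOfEntr, entropyH, thermoEntropy_consOfEntr g hv, consOfEntr_rho,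
    sum_mom_sq v hv, dLogRho]
  have : ∑ j, velE v j * v (iMom j) = (-v iEn) * ∑ j, velE v j ^ 2 := by
    rw [Finset.mul_sum]
    refine Finset.sum_congr rfl fun j _ => ?_
    unfold velE
    field_simp
  rw [this]
  have e : v iEn / -v iEn = -1 := by rw [div_neg, div_self (by simpa using h2)]
  rw [e]
  ring

/-! ### Derivatives with respect to the entropy variables -/

section deriv

variable {w : ℝ → State d} {w' : State d} {t : ℝ}

/-- Derivatives are taken along an arbitrary differentiable curve, so that the same formulas serve
lines in state space, lines in physical space and evolution in time. -/
theorem hasDerivAt_velE (hw : HasDerivAt w w' t) (hv : w t iEn < 0) (j : Fin d) :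
    HasDerivAt (fun s => velE (w s) j) (dVel (w t) w' j) t := by
  have hc := hasDerivAt_pi.1 hw
  have h2 : -w t iEn ≠ 0 := (neg_pos.2 hv).ne'
  have h9 : w t iEn ≠ 0 := hv.ne
  refine ((hc (iMom j)).div (hc iEn).neg h2).congr_deriv ?_
  unfold dVel velE
  simp only [Pi.neg_apply]
  field_simp
  ring

theorem hasDerivAt_rhoOfEntr (g : Gas) (hw : HasDerivAt w w' t) (hv : w t iEn < 0) :
    HasDerivAt (fun s => rhoOfEntr g (w s))
      (rhoOfEntr g (w t) * dLogRho (w t) w' / (g.gam - 1)) t := by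
  have hc := hasDerivAt_pi.1 hw
  have h1 := g.gam_sub_one_pos
  have h2 : -w t iEn ≠ 0 := (neg_pos.2 hv).ne'
  have h9 : w t iEn ≠ 0 := hv.ne
  have hB := rhoOfEntr_base_pos g hv
  have hsum : HasDerivAt (fun s => ∑ j, w s (iMom j) ^ 2)
      (∑ j, 2 * (w t (iMom j) * w' (iMom j))) t := by
    refine HasDerivAt.fun_sum fun j _ => ?_
    refine ((hc (iMom j)).fun_pow 2).congr_deriv ?_
    push_cast
    ring
  have hq := hsum.fun_div ((hc iEn).fun_neg.const_mul 2) (mul_ne_zero two_ne_zero h2)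
  have hE := ((((hc iRho).const_sub g.gam).fun_sub hq).add_const g.s0).fun_neg.exp
  have hA := ((hasDerivAt_const t (g.gam - 1)).fun_div (hc iEn).fun_neg h2).fun_mul hE
  refine (hA.rpow_const (p := 1 / (g.gam - 1)) (Or.inl hB.ne')).congr_deriv ?_
  -- Writing `B ^ (p - 1) = B ^ p / B` for the base `B` of the density formula restores the density
  -- as a factor; what is left is the logarithmic derivative of `B`.
  rw [Real.rpow_sub_one hB.ne']
  change _ * (rhoOfEntr g (w t) / _) = _
  generalize rhoOfEntr g (w t) = r
  unfold dLogRho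
  have e1 : ∑ j, velE (w t) j * w' (iMom j) = (∑ j, w t (iMom j) * w' (iMom j)) / (-w t iEn) := by
    rw [Finset.sum_div]
    exact Finset.sum_congr rfl fun j _ => by unfold velE; ring
  have e2 := sum_mom_sq (w t) hv
  have e3 : (∑ j, velE (w t) j ^ 2) / 2
      = (∑ j, w t (iMom j) ^ 2) / (2 * (-w t iEn)) / (-w t iEn) := by
    rw [e2]
    field_simp
  rw [e1, e3, ← Finset.mul_sum]
  generalize ∑ j, w t (iMom j) * w' (iMom j) = S
  generalize ∑ j, w t (iMom j) ^ 2 = Q at *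
  have hX := (Real.exp_pos (-(g.gam - w t iRho - Q / (2 * -w t iEn) + g.s0))).ne'
  generalize Real.exp (-(g.gam - w t iRho - Q / (2 * -w t iEn) + g.s0)) = X at *
  generalize -w t iEn = T at *
  field_simp
  ring

/-- The derivative of `u(v)` in the direction `z`. -/
def dCons (g : Gas) (v z : State d) : State d :=
  mkState (rhoOfEntr g v * dLogRho v z / (g.gam - 1))
    (fun j => rhoOfEntr g v * dLogRho v z / (g.gam - 1) * velE v j + rhoOfEntr g v * dVel v z j)
    (rhoOfEntr g v * dLogRho v z / (g.gam - 1) / (-v iEn) + rhoOfEntr g v * z iEn / (-v iEn) ^ 2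
      + rhoOfEntr g v * dLogRho v z / (g.gam - 1) * (∑ j, velE v j ^ 2) / 2
      + rhoOfEntr g v * ∑ j, velE v j * dVel v z j)

theorem hasDerivAt_sum_velE_sq (hw : HasDerivAt w w' t) (hv : w t iEn < 0) :
    HasDerivAt (fun s => ∑ j, velE (w s) j ^ 2) (2 * ∑ j, velE (w t) j * dVel (w t) w' j) t := by
  rw [Finset.mul_sum]
  refine HasDerivAt.fun_sum fun j _ => ?_
  refine ((hasDerivAt_velE hw hv j).fun_pow 2).congr_deriv ?_
  push_cast
  ring

theorem hasDerivAt_consOfEntr (g : Gas) (hw : HasDerivAt w w' t) (hv : w t iEn < 0) :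
    HasDerivAt (fun s => consOfEntr g (w s)) (dCons g (w t) w') t := by
  have hc := hasDerivAt_pi.1 hw
  have h2 : -w t iEn ≠ 0 := (neg_pos.2 hv).ne'
  have h9 : w t iEn ≠ 0 := hv.ne
  have hr := hasDerivAt_rhoOfEntr g hw hv
  refine hasDerivAt_pi.2 fun i => ?_
  rcases i with i | i | i
  · exact hr
  · exact hr.fun_mul (hasDerivAt_velE hw hv i)
  · refine ((hr.fun_div (hc iEn).fun_neg h2).fun_add
      ((hr.fun_mul (hasDerivAt_sum_velE_sq hw hv)).div_const 2)).congr_deriv ?_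
    simp only [dCons, mkState, Sum.elim_inr]
    field_simp
    ring

theorem hasDerivAt_presE (g : Gas) (hw : HasDerivAt w w' t) (hv : w t iEn < 0) :
    HasDerivAt (fun s => presE g (w s)) (rhoOfEntr g (w t) * dLogRho (w t) w' / (-w t iEn)
      + presE g (w t) * w' iEn / (-w t iEn)) t := by
  have hc := hasDerivAt_pi.1 hw
  have h1 := g.gam_sub_one_pos
  have h2 : -w t iEn ≠ 0 := (neg_pos.2 hv).ne'
  have h9 : w t iEn ≠ 0 := hv.ne
  refine (((hasDerivAt_rhoOfEntr g hw hv).const_mul (g.gam - 1)).fun_div (hc iEn).fun_neg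
    h2).congr_deriv ?_
  unfold presE
  field_simp
  ring

end deriv

/-! ### The inviscid flux, its potential, and the quadratic forms of the two Jacobians. -/

theorem inviscidFluxN_consOfEntr (g : Gas) (n : Pt d) {v : State d} (hv : v iEn < 0) :
    inviscidFluxN g n (consOfEntr g v) = (∑ j, velE v j * n j) • consOfEntr g v
      + presE g v • mkState 0 (fun i => n i) (∑ j, velE v j * n j) := by
  funext i
  simp only [inviscidFluxN, inviscidFlux, vel_consOfEntr g hv, pressure_consOfEntr g hv,
    Pi.add_apply, Pi.smul_apply, smul_eq_mul]
  rcases i with i | i | i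
  · simp only [mkState, Sum.elim_inl, consOfEntr_mom, mul_zero, add_zero]
    rw [Finset.sum_mul]
    refine Finset.sum_congr rfl fun j _ => ?_
    change rhoOfEntr g v * velE v j * n j = velE v j * n j * rhoOfEntr g v
    ring
  · simp only [mkState, Sum.elim_inl, Sum.elim_inr, add_mul, Finset.sum_add_distrib, ite_mul,
      zero_mul, Finset.sum_ite_eq, Finset.mem_univ, if_true, Finset.sum_mul]
    congr 1
    exact Finset.sum_congr rfl fun j _ => by ring
  · simp only [mkState, Sum.elim_inr]
    rw [← mul_comm (∑ j, velE v j * n j) (presE g v), ← mul_add, Finset.sum_mul]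
    exact Finset.sum_congr rfl fun j _ => by ring

/-- The derivative of `F(u(v)) · n` in the direction `z`. -/
def dFlux (g : Gas) (n : Pt d) (v z : State d) : State d :=
  (∑ j, dVel v z j * n j) • consOfEntr g v + (∑ j, velE v j * n j) • dCons g v z
    + (rhoOfEntr g v * dLogRho v z / (-v iEn) + presE g v * z iEn / (-v iEn)) •
      mkState 0 (fun i => n i) (∑ j, velE v j * n j)
    + presE g v • mkState 0 (fun _ => 0) (∑ j, dVel v z j * n j)

theorem hasDerivAt_inviscidFluxN (g : Gas) (n : Pt d) {w : ℝ → State d} {w' : State d} {t : ℝ}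
    (hw : HasDerivAt w w' t) (hv : w t iEn < 0) :
    HasDerivAt (fun s => inviscidFluxN g n (consOfEntr g (w s))) (dFlux g n (w t) w') t := by
  have hc := hasDerivAt_pi.1 hw
  have hev : ∀ᶠ s in nhds t, w s iEn < 0 :=
    (hc iEn).continuousAt.eventually_lt continuousAt_const hv
  have hVn : HasDerivAt (fun s => ∑ j, velE (w s) j * n j) (∑ j, dVel (w t) w' j * n j) t :=
    HasDerivAt.fun_sum fun j _ => (hasDerivAt_velE hw hv j).mul_const _
  have hM : HasDerivAt (fun s => mkState (d := d) 0 (fun i => n i) (∑ j, velE (w s) j * n j))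
      (mkState 0 (fun _ => 0) (∑ j, dVel (w t) w' j * n j)) t := by
    refine hasDerivAt_pi.2 fun i => ?_
    rcases i with i | i | i
    · exact hasDerivAt_const _ _
    · exact hasDerivAt_const _ _
    · exact hVn
  refine HasDerivAt.congr_of_eventuallyEq ?_ (hev.mono fun s hs => inviscidFluxN_consOfEntr g n hs)
  refine ((hVn.fun_smul (hasDerivAt_consOfEntr g hw hv)).fun_add
    ((hasDerivAt_presE g hw hv).fun_smul hM)).congr_deriv ?_
  unfold dFlux
  abel

/-- The entropy flux potential in the direction `n`. -/
def fluxPotential (g : Gas) (n : Pt d) (v : State d) : ℝ :=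
  (g.gam - 1) * rhoOfEntr g v * ∑ j, velE v j * n j

/-- Differentiating `(γ - 1) ρ` gives the convective part `V_n u` of the flux. Differentiating
`V_n`, with `(γ - 1) ρ = p (-v iEn)`, gives the pressure part. This gradient identity is the source
of both the volume identity and the estimate on faces. -/
theorem hasDerivAt_fluxPotential (g : Gas) (n : Pt d) {w : ℝ → State d} {w' : State d} {t : ℝ}
    (hw : HasDerivAt w w' t) (hv : w t iEn < 0) :
    HasDerivAt (fun s => fluxPotential g n (w s))
      (w' ⬝ᵥ inviscidFluxN g n (consOfEntr g (w t))) t := by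
  have hVn : HasDerivAt (fun s => ∑ j, velE (w s) j * n j) (∑ j, dVel (w t) w' j * n j) t :=
    HasDerivAt.fun_sum fun j _ => (hasDerivAt_velE hw hv j).mul_const _
  have h1 := g.gam_sub_one_pos
  have h2 : -w t iEn ≠ 0 := (neg_pos.2 hv).ne'
  have h9 : w t iEn ≠ 0 := hv.ne
  refine (((hasDerivAt_rhoOfEntr g hw hv).const_mul (g.gam - 1)).fun_mul hVn).congr_deriv ?_
  rw [inviscidFluxN_consOfEntr g n hv, dotProduct_add, dotProduct_smul, dotProduct_smul,
    dotProduct_consOfEntr, dotProduct_mkState]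
  have e : ∑ j, dVel (w t) w' j * n j
      = (∑ j, w' (iMom j) * n j + w' iEn * ∑ j, velE (w t) j * n j) / (-w t iEn) := by
    rw [Finset.mul_sum, ← Finset.sum_add_distrib, Finset.sum_div]
    exact Finset.sum_congr rfl fun j _ => by unfold dVel; ring
  rw [e]
  unfold presE
  simp only [smul_eq_mul]
  field_simp
  ring

/-- The linear forms `dLogRho`, `dVel` and `z iEn` diagonalize the Hessian of the dual potential,
with positive weights. Symmetry and positivity of `Ã₀` can be read off. -/
theorem dotProduct_dCons (g : Gas) {v : State d} (hv : v iEn < 0) (y z : State d) :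
    y ⬝ᵥ dCons g v z = rhoOfEntr g v / (g.gam - 1) * (dLogRho v y * dLogRho v z)
      + rhoOfEntr g v * (-v iEn) * ∑ j, dVel v y j * dVel v z j
      + rhoOfEntr g v / (-v iEn) ^ 2 * (y iEn * z iEn) := by
  have h1 := g.gam_sub_one_pos
  have h2 : -v iEn ≠ 0 := (neg_pos.2 hv).ne'
  have h9 : v iEn ≠ 0 := hv.ne
  unfold dCons
  rw [dotProduct_mkState]
  have e1 : ∑ j, y (iMom j) * (rhoOfEntr g v * dLogRho v z / (g.gam - 1) * velE v j
      + rhoOfEntr g v * dVel v z j) = rhoOfEntr g v * dLogRho v z / (g.gam - 1)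
        * (∑ j, velE v j * y (iMom j)) + rhoOfEntr g v * ∑ j, y (iMom j) * dVel v z j := by
    rw [Finset.mul_sum, Finset.mul_sum, ← Finset.sum_add_distrib]
    exact Finset.sum_congr rfl fun j _ => by ring
  have e2 : (-v iEn) * ∑ j, dVel v y j * dVel v z j
      = ∑ j, y (iMom j) * dVel v z j + y iEn * ∑ j, velE v j * dVel v z j := by
    rw [Finset.mul_sum, Finset.mul_sum, ← Finset.sum_add_distrib]
    refine Finset.sum_congr rfl fun j _ => ?_
    conv_lhs => rw [dVel]
    field_simp
  have e3 : ∑ j, velE v j * y (iMom j) = dLogRho v y - y iRho - y iEn / (-v iEn)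
      - (∑ j, velE v j ^ 2) / 2 * y iEn := by
    unfold dLogRho; ring
  rw [mul_assoc (rhoOfEntr g v) (-v iEn), e1, e2, e3]
  field_simp
  ring

theorem dotProduct_dCons_comm (g : Gas) {v : State d} (hv : v iEn < 0) (y z : State d) :
    y ⬝ᵥ dCons g v z = z ⬝ᵥ dCons g v y := by
  rw [dotProduct_dCons g hv, dotProduct_dCons g hv, mul_comm (dLogRho v y), mul_comm (y iEn)]
  simp only [mul_comm (dVel v y _)]

theorem dotProduct_dCons_nonneg (g : Gas) {v : State d} (hv : v iEn < 0) (z : State d) :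
    0 ≤ z ⬝ᵥ dCons g v z := by
  rw [dotProduct_dCons g hv]
  have h1 := g.gam_sub_one_pos
  have h2 : 0 < -v iEn := neg_pos.2 hv
  have h3 := rhoOfEntr_pos g hv
  have h4 : 0 ≤ ∑ j, dVel v z j * dVel v z j := Finset.sum_nonneg fun j _ => mul_self_nonneg _
  have h5 := mul_self_nonneg (dLogRho v z)
  have h6 := mul_self_nonneg (z iEn)
  positivity

theorem dotProduct_dCons_pos (g : Gas) {v : State d} (hv : v iEn < 0) {z : State d} (hz : z ≠ 0) :
    0 < z ⬝ᵥ dCons g v z := by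
  refine lt_of_le_of_ne (dotProduct_dCons_nonneg g hv z) fun h0 => hz ?_
  rw [dotProduct_dCons g hv] at h0
  have h1 := g.gam_sub_one_pos
  have h2 : 0 < -v iEn := neg_pos.2 hv
  have h3 := rhoOfEntr_pos g hv
  have h4 : 0 ≤ ∑ j, dVel v z j * dVel v z j := Finset.sum_nonneg fun j _ => mul_self_nonneg _
  have h5 := mul_self_nonneg (dLogRho v z)
  have h6 := mul_self_nonneg (z iEn)
  have k1 : 0 ≤ rhoOfEntr g v / (g.gam - 1) * (dLogRho v z * dLogRho v z) := by positivity
  have k2 : 0 ≤ rhoOfEntr g v * (-v iEn) * ∑ j, dVel v z j * dVel v z j := by positivity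
  have k3 : 0 ≤ rhoOfEntr g v / (-v iEn) ^ 2 * (z iEn * z iEn) := by positivity
  -- The three families of linear forms are triangular: the energy component vanishes first, then
  -- `dVel` reduces to the momentum components, then `dLogRho` to the density component.
  have m3 : z iEn = 0 := by
    have : rhoOfEntr g v / (-v iEn) ^ 2 * (z iEn * z iEn) = 0 := by linarith
    rcases mul_eq_zero.1 this with h | h
    · exact absurd h (by positivity)
    · exact mul_self_eq_zero.1 h
  have m2 : ∀ j, z (iMom j) = 0 := by
    have : rhoOfEntr g v * (-v iEn) * ∑ j, dVel v z j * dVel v z j = 0 := by linarith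
    rcases mul_eq_zero.1 this with h | h
    · exact absurd h (by positivity)
    · intro j
      have := (Finset.sum_eq_zero_iff_of_nonneg fun j _ => mul_self_nonneg _).1 h j
        (Finset.mem_univ j)
      have := mul_self_eq_zero.1 this
      rw [dVel, m3, mul_zero, add_zero] at this
      exact (div_eq_zero_iff.1 this).resolve_right h2.ne'
  have m1 : z iRho = 0 := by
    have : rhoOfEntr g v / (g.gam - 1) * (dLogRho v z * dLogRho v z) = 0 := by linarith
    rcases mul_eq_zero.1 this with h | h
    · exact absurd h (by positivity)
    · have := mul_self_eq_zero.1 h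
      simpa [dLogRho, m3, m2] using this
  funext i
  rcases i with i | i | i
  · exact m1
  · exact m2 i
  · exact m3

/-- The form is the Hessian of `fluxPotential`, hence symmetric. The formula `key` exhibits this
without second derivatives, by writing the form as an expression invariant under exchange of `y` and
`z`. -/
theorem dotProduct_dFlux_comm (g : Gas) (n : Pt d) {v : State d} (hv : v iEn < 0) (y z : State d) :
    y ⬝ᵥ dFlux g n v z = z ⬝ᵥ dFlux g n v y := by
  have h1 := g.gam_sub_one_pos
  have h2 : -v iEn ≠ 0 := (neg_pos.2 hv).ne'
  have h9 : v iEn ≠ 0 := hv.ne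
  have key : ∀ y z : State d, y ⬝ᵥ dFlux g n v z = (∑ j, velE v j * n j) * (y ⬝ᵥ dCons g v z)
      + rhoOfEntr g v * (dLogRho v y * ∑ j, dVel v z j * n j + dLogRho v z * ∑ j, dVel v y j * n j)
      + presE g v * (y iEn * ∑ j, dVel v z j * n j + z iEn * ∑ j, dVel v y j * n j) := by
    intro y z
    unfold dFlux
    simp only [dotProduct_add, dotProduct_smul, dotProduct_mkState, dotProduct_consOfEntr,
      smul_eq_mul]
    have e : ∑ j, y (iMom j) * n j
        = (-v iEn) * (∑ j, dVel v y j * n j) - y iEn * ∑ j, velE v j * n j := by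
      rw [Finset.mul_sum, Finset.mul_sum, ← Finset.sum_sub_distrib]
      refine Finset.sum_congr rfl fun j _ => ?_
      unfold dVel
      field_simp
      ring
    rw [e]
    simp only [mul_zero, Finset.sum_const_zero]
    field_simp
    ring
  rw [key, key, dotProduct_dCons_comm g hv]
  ring

/-! ### Smoothness in the entropy variables -/

theorem contDiffAt_velE {v : State d} (hv : v iEn < 0) (j : Fin d) :
    ContDiffAt ℝ 1 (fun v : State d => velE v j) v :=
  (contDiff_apply _ _ _).contDiffAt.div (contDiff_apply _ _ _).contDiffAt.neg (neg_pos.2 hv).ne'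

theorem contDiffAt_rhoOfEntr (g : Gas) {v : State d} (hv : v iEn < 0) :
    ContDiffAt ℝ 1 (rhoOfEntr (d := d) g) v := by
  have hc : ∀ i, ContDiffAt ℝ 1 (fun v : State d => v i) v :=
    fun i => (contDiff_apply _ _ _).contDiffAt
  have h2 : -v iEn ≠ 0 := (neg_pos.2 hv).ne'
  have hq : ContDiffAt ℝ 1 (fun v : State d => ∑ j, v (iMom j) ^ 2) v :=
    ContDiffAt.sum fun j _ => (hc _).pow 2
  refine ContDiffAt.rpow_const_of_ne ?_ (rhoOfEntr_base_pos g hv).ne'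
  exact (contDiffAt_const.div (hc _).neg h2).mul
    (((contDiffAt_const.sub (hc _)).sub (hq.div (contDiffAt_const.mul (hc _).neg)
      (mul_ne_zero two_ne_zero h2))).add contDiffAt_const).neg.exp

theorem contDiffAt_consOfEntr (g : Gas) {v : State d} (hv : v iEn < 0) :
    ContDiffAt ℝ 1 (consOfEntr (d := d) g) v := by
  have h2 : -v iEn ≠ 0 := (neg_pos.2 hv).ne'
  have hr := contDiffAt_rhoOfEntr g hv
  have hV := contDiffAt_velE hv
  refine contDiffAt_pi.2 fun i => ?_
  rcases i with i | i | i
  · exact hr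
  · exact hr.mul (hV i)
  · exact (hr.div (contDiff_apply _ _ _).contDiffAt.neg h2).add
      ((hr.mul (ContDiffAt.sum fun j _ => (hV j).pow 2)).div_const 2)

theorem contDiffAt_fluxPotential (g : Gas) (n : Pt d) {v : State d} (hv : v iEn < 0) :
    ContDiffAt ℝ 1 (fluxPotential g n) v :=
  (contDiffAt_const.mul (contDiffAt_rhoOfEntr g hv)).mul
    (ContDiffAt.sum fun j _ => (contDiffAt_velE hv j).mul contDiffAt_const)

theorem continuousOn_consOfEntr (g : Gas) : ContinuousOn (consOfEntr (d := d) g) (physV g d) :=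
  fun _ hv => (contDiffAt_consOfEntr g ((mem_physV_iff g).1 hv)).continuousAt.continuousWithinAt

theorem continuousOn_rhoOfEntr (g : Gas) : ContinuousOn (rhoOfEntr (d := d) g) (physV g d) :=
  fun _ hv => (contDiffAt_rhoOfEntr g ((mem_physV_iff g).1 hv)).continuousAt.continuousWithinAt

theorem continuousOn_velE (g : Gas) (j : Fin d) :
    ContinuousOn (fun v : State d => velE v j) (physV g d) :=
  fun _ hv => (contDiffAt_velE ((mem_physV_iff g).1 hv) j).continuousAt.continuousWithinAt

theorem continuousOn_fluxPotential (g : Gas) (n : Pt d) :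
    ContinuousOn (fluxPotential g n) (physV g d) :=
  fun _ hv =>
    (contDiffAt_fluxPotential g n ((mem_physV_iff g).1 hv)).continuousAt.continuousWithinAt

theorem continuousOn_presE (g : Gas) : ContinuousOn (presE (d := d) g) (physV g d) :=
  (continuousOn_const.mul (continuousOn_rhoOfEntr g)).div (continuous_apply _).neg.continuousOn
    fun _ hv => (neg_pos.2 ((mem_physV_iff g).1 hv)).ne'

theorem continuousOn_entropyH (g : Gas) :
    ContinuousOn (fun v : State d => entropyH g (consOfEntr g v)) (physV g d) := by
  have h : ContinuousOn (fun v : State d => v ⬝ᵥ consOfEntr g v - (g.gam - 1) * rhoOfEntr g v)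
      (physV g d) := by
    refine ContinuousOn.sub ?_ (continuousOn_const.mul (continuousOn_rhoOfEntr g))
    exact continuousOn_finsetSum _ fun i _ => (continuous_apply i).continuousOn.mul
      (continuousOn_pi.1 (continuousOn_consOfEntr g) i)
  exact h.congr fun v hv => entropyH_consOfEntr g ((mem_physV_iff g).1 hv)

theorem continuousOn_inviscidFlux (g : Gas) (j : Fin d) (i : Idx d) :
    ContinuousOn (fun v : State d => inviscidFlux g (consOfEntr g v) j i) (physV g d) := by
  have hu := fun i => continuousOn_pi.1 (continuousOn_consOfEntr (d := d) g) i
  have hp := continuousOn_presE (d := d) g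
  have hV := continuousOn_velE (d := d) g
  have h : ContinuousOn (fun v : State d => mkState (consOfEntr g v (iMom j))
      (fun i => consOfEntr g v (iMom i) * velE v j + if i = j then presE g v else 0)
      (velE v j * (consOfEntr g v iEn + presE g v)) i) (physV g d) := by
    rcases i with i | i | i
    · exact hu (iMom j)
    · refine ((hu _).mul (hV j)).add ?_
      split_ifs
      · exact hp
      · exact continuousOn_const
    · exact (hV j).mul ((hu _).add hp)
  refine h.congr fun v hv => ?_
  have hv' := (mem_physV_iff g).1 hv
  simp only [inviscidFlux, vel_consOfEntr g hv', pressure_consOfEntr g hv']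

/-! ### Jacobian matrices -/

theorem jac_mulVec (f : State d → State d) (x z : State d) :
    (jac f x).mulVec z = fderiv ℝ f x z := by
  have hz : z = ∑ l, z l • (Pi.single l 1 : State d) := by
    funext i
    simp [Finset.sum_apply, Pi.single_apply]
  conv_rhs => rw [hz, map_sum]
  funext i
  simp only [Matrix.mulVec, dotProduct, jac, Matrix.of_apply, Finset.sum_apply, map_smul,
    Pi.smul_apply, smul_eq_mul]
  exact Finset.sum_congr rfl fun l _ => mul_comm _ _

theorem hasDerivAt_line (v z : State d) : HasDerivAt (fun t : ℝ => v + t • z) z 0 := by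
  simpa using ((hasDerivAt_id (0 : ℝ)).smul_const z).const_add v

theorem fderiv_consOfEntr (g : Gas) {v : State d} (hv : v iEn < 0) (z : State d) :
    fderiv ℝ (consOfEntr g) v z = dCons g v z := by
  have hd := (contDiffAt_consOfEntr g hv).differentiableAt one_ne_zero
  have hl := hasDerivAt_line v z
  have h0 : v + (0 : ℝ) • z = v := by simp
  have h1 : HasDerivAt (fun t : ℝ => consOfEntr g (v + t • z)) (fderiv ℝ (consOfEntr g) v z) 0 := by
    refine HasFDerivAt.comp_hasDerivAt (l := consOfEntr g) (0 : ℝ) ?_ hl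
    rw [h0]
    exact hd.hasFDerivAt
  have h2 := hasDerivAt_consOfEntr g hl (by rw [h0]; exact hv)
  rw [h0] at h2
  exact h1.unique h2

theorem metricA0_mulVec (g : Gas) {v : State d} (hv : v iEn < 0) (z : State d) :
    (metricA0 g v).mulVec z = dCons g v z := by
  rw [metricA0, jac_mulVec, fderiv_consOfEntr g hv]

theorem contDiffAt_vel {u : State d} (hu : 0 < u iRho) (j : Fin d) :
    ContDiffAt ℝ 1 (fun u : State d => vel u j) u :=
  (contDiff_apply _ _ _).contDiffAt.div (contDiff_apply _ _ _).contDiffAt hu.ne'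

theorem contDiffAt_pressure (g : Gas) {u : State d} (hu : 0 < u iRho) :
    ContDiffAt ℝ 1 (pressure (d := d) g) u := by
  have hc : ∀ i, ContDiffAt ℝ 1 (fun u : State d => u i) u :=
    fun i => (contDiff_apply _ _ _).contDiffAt
  exact contDiffAt_const.mul ((hc _).sub (((hc _).mul (ContDiffAt.sum fun j _ =>
    (contDiffAt_vel hu j).pow 2)).div_const 2))

theorem contDiffAt_inviscidFluxN (g : Gas) (n : Pt d) {u : State d} (hu : 0 < u iRho) :
    ContDiffAt ℝ 1 (inviscidFluxN g n) u := by
  have hc : ∀ i, ContDiffAt ℝ 1 (fun u : State d => u i) u :=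
    fun i => (contDiff_apply _ _ _).contDiffAt
  have hp := contDiffAt_pressure g hu
  have hV := fun j => contDiffAt_vel hu j
  refine contDiffAt_pi.2 fun i => ContDiffAt.sum fun j _ => ContDiffAt.mul ?_ contDiffAt_const
  rcases i with i | i | i
  · exact hc _
  · refine ((hc _).mul (hV j)).add ?_
    split_ifs
    · exact hp
    · exact contDiffAt_const
  · exact (hV j).mul ((hc _).add hp)

theorem differentiableAt_vel {u : State d} (hu : 0 < u iRho) (j : Fin d) :
    DifferentiableAt ℝ (fun u : State d => vel u j) u :=
  (contDiffAt_vel hu j).differentiableAt one_ne_zero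

theorem differentiableAt_temperature (g : Gas) {u : State d} (hu : 0 < u iRho) :
    DifferentiableAt ℝ (temperature (d := d) g) u := by
  have hc : ∀ i, DifferentiableAt ℝ (fun u : State d => u i) u :=
    fun i => differentiableAt_apply _ _
  exact ((contDiffAt_pressure g hu).differentiableAt one_ne_zero).mul
    (((hc iRho).mul_const _).inv (mul_pos hu (sub_pos.2 g.cv_lt_cp)).ne')

theorem differentiableAt_inviscidFluxN (g : Gas) (n : Pt d) {u : State d} (hu : 0 < u iRho) :
    DifferentiableAt ℝ (inviscidFluxN g n) u :=
  (contDiffAt_inviscidFluxN g n hu).differentiableAt one_ne_zero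

theorem continuousAt_jac {f : State d → State d} {x : State d} (hf : ContDiffAt ℝ 1 f x) :
    ContinuousAt (jac f) x := by
  have h : ContinuousAt (fderiv ℝ f) x := (hf.fderiv_right (m := 0) le_rfl).continuousAt
  refine continuousAt_pi.2 fun i => continuousAt_pi.2 fun l => ?_
  exact (continuous_apply i).continuousAt.comp (h.clm_apply continuousAt_const)

theorem continuousOn_metricA0 (g : Gas) : ContinuousOn (metricA0 (d := d) g) (physV g d) :=
  fun _ hv => (continuousAt_jac
    (contDiffAt_consOfEntr g ((mem_physV_iff g).1 hv))).continuousWithinAt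

theorem continuousOn_jacAn (g : Gas) (n : Pt d) : ContinuousOn (jacAn g n) (physV g d) :=
  fun v hv => by
    have hv' := (mem_physV_iff g).1 hv
    have h1 := continuousAt_jac (contDiffAt_inviscidFluxN g n (consOfEntr_mem_physU g hv').1)
    have h2 := (contDiffAt_consOfEntr g hv').continuousAt
    exact (ContinuousAt.comp (f := consOfEntr g) h1 h2).continuousWithinAt

/-- Chain rule: `A_n Ã₀` is the Jacobian of the flux with respect to the entropy variables. Two
derivatives of one function along a line are identified by uniqueness. -/
theorem jacAn_mul_metricA0_mulVec (g : Gas) (n : Pt d) {v : State d} (hv : v iEn < 0)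
    (z : State d) : (jacAn g n v * metricA0 g v).mulVec z = dFlux g n v z := by
  rw [← Matrix.mulVec_mulVec, metricA0_mulVec g hv, jacAn, jac_mulVec]
  have h0 : v + (0 : ℝ) • z = v := by simp
  have hl := hasDerivAt_consOfEntr g (hasDerivAt_line v z) (by rw [h0]; exact hv)
  have h2 := hasDerivAt_inviscidFluxN g n (hasDerivAt_line v z) (by rw [h0]; exact hv)
  rw [h0] at hl h2
  have hd := differentiableAt_inviscidFluxN g n (consOfEntr_mem_physU g hv).1
  have h1 : HasDerivAt (fun t : ℝ => inviscidFluxN g n (consOfEntr g (v + t • z)))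
      (fderiv ℝ (inviscidFluxN g n) (consOfEntr g v) (dCons g v z)) 0 := by
    refine HasFDerivAt.comp_hasDerivAt (l := inviscidFluxN g n) (0 : ℝ) ?_ hl
    rw [h0]
    exact hd.hasFDerivAt
  exact h1.unique h2

/-! ### Symmetrization of the inviscid Jacobian by the entropy variables. -/

theorem isSymm_of_dotProduct_mulVec {ι : Type*} [Fintype ι] [DecidableEq ι] {A : Matrix ι ι ℝ}
    (h : ∀ y z : ι → ℝ, y ⬝ᵥ A.mulVec z = z ⬝ᵥ A.mulVec y) : A.IsSymm := by
  ext i j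
  have := h (Pi.single i 1) (Pi.single j 1)
  simpa using this.symm

theorem isSymm_metricA0 (g : Gas) {v : State d} (hv : v iEn < 0) : (metricA0 g v).IsSymm :=
  isSymm_of_dotProduct_mulVec fun y z => by
    rw [metricA0_mulVec g hv, metricA0_mulVec g hv, dotProduct_dCons_comm g hv]

theorem posDef_metricA0 (g : Gas) {v : State d} (hv : v iEn < 0) : (metricA0 g v).PosDef := by
  refine Matrix.PosDef.of_dotProduct_mulVec_pos ?_ fun x hx => ?_
  · have := isSymm_metricA0 g hv
    rwa [Matrix.IsHermitian, Matrix.conjTranspose_eq_transpose_of_trivial]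
  · rw [metricA0_mulVec g hv]
    simpa using dotProduct_dCons_pos g hv hx

/-- Together with `posDef_metricA0`, this supplies the hypotheses under which `A_n` is
diagonalizable and `matAbs` takes its intended value instead of the default `0`. -/
theorem isSymm_jacAn_mul_metricA0 (g : Gas) (n : Pt d) {v : State d} (hv : v iEn < 0) :
    (jacAn g n v * metricA0 g v).IsSymm :=
  isSymm_of_dotProduct_mulVec fun y z => by
    rw [jacAn_mul_metricA0_mulVec g n hv, jacAn_mul_metricA0_mulVec g n hv,
      dotProduct_dFlux_comm g n hv]

/-! ### Convexity -/

/-- The tangent inequality of the convex entropy. -/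
theorem entropyH_tangent (g : Gas) {v w : State d} (hv : v iEn < 0) (hw : w iEn < 0) :
    entropyH g (consOfEntr g w) + w ⬝ᵥ (consOfEntr g v - consOfEntr g w)
      ≤ entropyH g (consOfEntr g v) := by
  rw [entropyH_consOfEntr g hv, entropyH_consOfEntr g hw, dotProduct_sub]
  have hpath : ∀ t ∈ Set.Icc (0 : ℝ) 1, (v + t • (w - v)) iEn < 0 := fun t ht =>
    (mem_physV_iff g).1 ((convex_physV g d).add_smul_sub_mem ((mem_physV_iff g).2 hv)
      ((mem_physV_iff g).2 hw) ht)
  have hl : ∀ t : ℝ, HasDerivAt (fun s : ℝ => v + s • (w - v)) (w - v) t := fun t => by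
    simpa using ((hasDerivAt_id t).smul_const (w - v)).const_add v
  -- By the Legendre formula the claim reads `(w - v) · u(v) ≤ (γ - 1) (ρ(w) - ρ(v))`, that is `ψ 0
  -- ≤ φ 1 - φ 0`. This is convexity of `φ`: its derivative `ψ` is monotone, and the mean value
  -- theorem gives `φ 1 - φ 0 = ψ c`.
  set φ : ℝ → ℝ := fun t => (g.gam - 1) * rhoOfEntr g (v + t • (w - v)) with hφ
  set ψ : ℝ → ℝ := fun t => (w - v) ⬝ᵥ consOfEntr g (v + t • (w - v)) with hψ
  have hφ' : ∀ t ∈ Set.Icc (0 : ℝ) 1, HasDerivAt φ (ψ t) t := fun t ht => by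
    refine ((hasDerivAt_rhoOfEntr g (hl t) (hpath t ht)).const_mul (g.gam - 1)).congr_deriv ?_
    have := g.gam_sub_one_pos.ne'
    rw [hψ]
    simp only
    rw [dotProduct_consOfEntr]
    field_simp
  have hψ' : ∀ t ∈ Set.Icc (0 : ℝ) 1,
      HasDerivAt ψ ((w - v) ⬝ᵥ dCons g (v + t • (w - v)) (w - v)) t := fun t ht => by
    have hc := hasDerivAt_pi.1 (hasDerivAt_consOfEntr g (hl t) (hpath t ht))
    exact HasDerivAt.fun_sum fun i _ => (hc i).const_mul _
  have hmono : MonotoneOn ψ (Set.Icc 0 1) := by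
    refine monotoneOn_of_deriv_nonneg (convex_Icc 0 1)
      (fun t ht => (hψ' t ht).continuousAt.continuousWithinAt)
      (fun t ht => (hψ' t (interior_subset ht)).differentiableAt.differentiableWithinAt) ?_
    intro t ht
    rw [(hψ' t (interior_subset ht)).deriv]
    exact dotProduct_dCons_nonneg g (hpath t (interior_subset ht)) _
  obtain ⟨c, hc, hceq⟩ := exists_hasDerivAt_eq_slope φ ψ one_pos
    (fun t ht => (hφ' t ht).continuousAt.continuousWithinAt)
    (fun t ht => hφ' t (Set.Ioo_subset_Icc_self ht))
  have h2 := hmono (Set.left_mem_Icc.2 zero_le_one) (Set.Ioo_subset_Icc_self hc) hc.1.le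
  rw [hceq] at h2
  simp only [hφ, hψ, zero_smul, add_zero, one_smul, add_sub_cancel, sub_zero, div_one,
    sub_dotProduct] at h2
  linarith

/-- The mean of physical states is physical: the linear functionals that describe `X_u`. -/
theorem physU_functional_pos (g : Gas) {u : State d} (hu : u ∈ physU g d) (c : Fin d → ℝ) :
    0 < u iEn - ∑ j, c j * u (iMom j) + (∑ j, c j ^ 2) / 2 * u iRho := by
  obtain ⟨hr, hp⟩ := hu
  have h1 := g.gam_sub_one_pos
  unfold pressure at hp
  have hp' := (mul_pos_iff_of_pos_left h1).1 hp
  have hm : ∀ j, u (iMom j) = u iRho * vel u j := fun j => by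
    unfold vel
    field_simp
  -- Completing the square in `c` leaves the internal energy plus a nonnegative term that vanishes
  -- at `c = vel u`.
  have e : u iEn - ∑ j, c j * u (iMom j) + (∑ j, c j ^ 2) / 2 * u iRho
      = (u iEn - u iRho * (∑ j, vel u j ^ 2) / 2) + u iRho / 2 * ∑ j, (vel u j - c j) ^ 2 := by
    have : ∑ j, (vel u j - c j) ^ 2
        = ∑ j, vel u j ^ 2 - 2 * ∑ j, c j * vel u j + ∑ j, c j ^ 2 := by
      rw [Finset.mul_sum, ← Finset.sum_sub_distrib, ← Finset.sum_add_distrib]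
      exact Finset.sum_congr rfl fun j _ => by ring
    rw [this]
    have h3 : ∑ j, c j * u (iMom j) = u iRho * ∑ j, c j * vel u j := by
      rw [Finset.mul_sum]
      exact Finset.sum_congr rfl fun j _ => by rw [hm]; ring
    rw [h3]
    ring
  rw [e]
  have : 0 ≤ ∑ j, (vel u j - c j) ^ 2 := Finset.sum_nonneg fun j _ => sq_nonneg _
  positivity

/-- At the minimizer `c = vel u` the functional equals the internal energy. Thus `X_u` is cut out by
strict linear inequalities, a description that survives averaging. -/
theorem mem_physU_of_functional_pos (g : Gas) {u : State d} (hr : 0 < u iRho)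
    (h : ∀ c : Fin d → ℝ, 0 < u iEn - ∑ j, c j * u (iMom j) + (∑ j, c j ^ 2) / 2 * u iRho) :
    u ∈ physU g d := by
  refine ⟨hr, mul_pos g.gam_sub_one_pos ?_⟩
  have h1 := h (vel u)
  have h3 : ∑ j, vel u j * u (iMom j) = u iRho * ∑ j, vel u j ^ 2 := by
    rw [Finset.mul_sum]
    refine Finset.sum_congr rfl fun j _ => ?_
    unfold vel
    field_simp
  rw [h3] at h1
  linarith

/-! ### Dissipation by the viscous fluxes -/

theorem hasDerivAt_inv_neg_en (g : Gas) (v z : State d) (hv : v iEn < 0) :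
    HasDerivAt (fun t : ℝ => 1 / (g.cv * (-(v + t • z) iEn)))
      (z iEn / (g.cv * (-v iEn) ^ 2)) 0 := by
  have hc := hasDerivAt_pi.1 (hasDerivAt_line v z) iEn
  have h9 : v iEn ≠ 0 := hv.ne
  have h3 := g.cv_pos.ne'
  have h0 : g.cv * -(v + (0 : ℝ) • z) iEn ≠ 0 := by
    simp only [zero_smul, add_zero]
    exact mul_ne_zero h3 (neg_ne_zero.2 h9)
  refine ((hasDerivAt_const (0 : ℝ) (1 : ℝ)).fun_div (hc.fun_neg.const_mul g.cv) h0).congr_deriv ?_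
  simp only [zero_smul, add_zero]
  field_simp
  ring

theorem sum_metricA0 (g : Gas) {v : State d} (hv : v iEn < 0) (q : Idx d → Fin d → ℝ) (j : Fin d) :
    (fun l => ∑ s, metricA0 g v l s * q s j) = fderiv ℝ (consOfEntr g) v (fun s => q s j) := by
  rw [fderiv_consOfEntr g hv, ← metricA0_mulVec g hv]
  rfl

theorem gradVel_consOfEntr (g : Gas) {v : State d} (hv : v iEn < 0) (q : Idx d → Fin d → ℝ)
    (i j : Fin d) :
    gradVel (consOfEntr g v) (fun l k => ∑ s, metricA0 g v l s * q s k) i j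
      = dVel v (fun s => q s j) i := by
  unfold gradVel
  rw [sum_metricA0 g hv]
  set z : State d := fun s => q s j
  have h0 : v + (0 : ℝ) • z = v := by simp
  have hl := hasDerivAt_consOfEntr g (hasDerivAt_line v z) (by rw [h0]; exact hv)
  have h2 := hasDerivAt_velE (hasDerivAt_line v z) (by rw [h0]; exact hv) i
  rw [h0] at hl h2
  have h1 : HasDerivAt (fun t : ℝ => vel (consOfEntr g (v + t • z)) i)
      (fderiv ℝ (fun u' : State d => vel u' i) (consOfEntr g v) (dCons g v z)) 0 := by
    refine HasFDerivAt.comp_hasDerivAt (l := fun u' : State d => vel u' i) (0 : ℝ) ?_ hl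
    rw [h0]
    exact (differentiableAt_vel (consOfEntr_mem_physU g hv).1 i).hasFDerivAt
  rw [fderiv_consOfEntr g hv]
  refine h1.unique (h2.congr_of_eventuallyEq ?_)
  -- The two expressions for the velocity need agree only near the base point, where the half-space
  -- condition persists.
  have hev : ∀ᶠ t in nhds (0 : ℝ), (v + t • z) iEn < 0 :=
    (hasDerivAt_pi.1 (hasDerivAt_line v z) iEn).continuousAt.eventually_lt continuousAt_const
      (by rw [h0]; exact hv)
  exact hev.mono fun t ht => vel_consOfEntr g ht i

theorem gradTemp_consOfEntr (g : Gas) {v : State d} (hv : v iEn < 0) (q : Idx d → Fin d → ℝ)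
    (j : Fin d) :
    gradTemp g (consOfEntr g v) (fun l k => ∑ s, metricA0 g v l s * q s k) j
      = q iEn j / (g.cv * (-v iEn) ^ 2) := by
  unfold gradTemp
  rw [sum_metricA0 g hv]
  set z : State d := fun s => q s j
  have h0 : v + (0 : ℝ) • z = v := by simp
  have hl := hasDerivAt_consOfEntr g (hasDerivAt_line v z) (by rw [h0]; exact hv)
  have h2 := hasDerivAt_inv_neg_en g v z hv
  rw [h0] at hl
  have h1 : HasDerivAt (fun t : ℝ => temperature g (consOfEntr g (v + t • z)))
      (fderiv ℝ (temperature g) (consOfEntr g v) (dCons g v z)) 0 := by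
    refine HasFDerivAt.comp_hasDerivAt (l := temperature g) (0 : ℝ) ?_ hl
    rw [h0]
    exact (differentiableAt_temperature g (consOfEntr_mem_physU g hv).1).hasFDerivAt
  rw [fderiv_consOfEntr g hv]
  refine h1.unique (h2.congr_of_eventuallyEq ?_)
  have hev : ∀ᶠ t in nhds (0 : ℝ), (v + t • z) iEn < 0 :=
    (hasDerivAt_pi.1 (hasDerivAt_line v z) iEn).continuousAt.eventually_lt continuousAt_const
      (by rw [h0]; exact hv)
  exact hev.mono fun t ht => temperature_consOfEntr g ht

/-- The stress tensor in terms of the entropy variables. -/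
def stressE (g : Gas) (mu beta : State d → ℝ) (v : State d) (q : Idx d → Fin d → ℝ)
    (i j : Fin d) : ℝ :=
  mu (consOfEntr g v) * (dVel v (fun s => q s j) i + dVel v (fun s => q s i) j
      - if i = j then 2 / 3 * ∑ k, dVel v (fun s => q s k) k else 0)
    + if i = j then beta (consOfEntr g v) * ∑ k, dVel v (fun s => q s k) k else 0

theorem viscousFlux_eq (g : Gas) (mu beta : State d → ℝ) {v : State d} (hv : v iEn < 0)
    (q : Idx d → Fin d → ℝ) (i : Idx d) (j : Fin d) :
    viscousFlux g mu beta v q i j = -mkState 0 (fun i => stressE g mu beta v q i j)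
      (∑ i, velE v i * stressE g mu beta v q i j
        + g.cp * mu (consOfEntr g v) / g.Pr * (q iEn j / (g.cv * (-v iEn) ^ 2))) i := by
  have hs : ∀ i j, stress mu beta (consOfEntr g v) (fun l k => ∑ s, metricA0 g v l s * q s k) i j
      = stressE g mu beta v q i j := fun i j => by
    unfold stress stressE
    simp only [gradVel_consOfEntr g hv]
  unfold viscousFlux viscousFluxU heatFlux
  simp only [hs, gradTemp_consOfEntr g hv, vel_consOfEntr g hv, Pi.neg_apply, sub_neg_eq_add]

/-- The contraction equals `μ (‖D + Dᵗ‖² / 2 - (2/3) (tr D)²) + β (tr D)²`. Keeping only diagonal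
entries, `‖D + Dᵗ‖² / 2 ≥ 2 ∑ D_ii²`, while Cauchy–Schwarz gives `(tr D)² ≤ d ∑ D_ii²`. The
coefficient `2/3` is exactly what `d ≤ 3` allows. -/
theorem sum_stress_nonneg (hd3 : d ≤ 3) {mu beta : ℝ} (hmu : 0 ≤ mu) (hbeta : 0 ≤ beta)
    (D : Fin d → Fin d → ℝ) :
    0 ≤ ∑ i, ∑ j, (mu * (D i j + D j i - if i = j then 2 / 3 * ∑ k, D k k else 0)
      + if i = j then beta * ∑ k, D k k else 0) * D i j := by
  set T := ∑ k, D k k with hT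
  have e : ∑ i, ∑ j, (mu * (D i j + D j i - if i = j then 2 / 3 * T else 0)
      + if i = j then beta * T else 0) * D i j
      = mu * (∑ i, ∑ j, (D i j + D j i) * D i j - 2 / 3 * T ^ 2) + beta * T ^ 2 := by
    have h1 : ∀ i j, (mu * (D i j + D j i - if i = j then 2 / 3 * T else 0)
        + if i = j then beta * T else 0) * D i j
        = mu * ((D i j + D j i) * D i j) + if i = j then (beta - 2 / 3 * mu) * T * D i j else 0 := by
      intro i j
      split_ifs <;> ring
    simp only [h1, Finset.sum_add_distrib, Finset.sum_ite_eq, Finset.mem_univ, if_true,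
      ← Finset.mul_sum, ← hT]
    ring
  rw [e]
  have h2 : ∑ i, ∑ j, (D i j + D j i) * D i j = (∑ i, ∑ j, (D i j + D j i) ^ 2) / 2 := by
    have h3 : ∑ i, ∑ j, (D i j + D j i) * D j i = ∑ i, ∑ j, (D i j + D j i) * D i j := by
      rw [Finset.sum_comm]
      exact Finset.sum_congr rfl fun i _ => Finset.sum_congr rfl fun j _ => by ring
    have h4 : ∑ i, ∑ j, (D i j + D j i) ^ 2
        = ∑ i, ∑ j, (D i j + D j i) * D i j + ∑ i, ∑ j, (D i j + D j i) * D j i := by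
      rw [← Finset.sum_add_distrib]
      refine Finset.sum_congr rfl fun i _ => ?_
      rw [← Finset.sum_add_distrib]
      exact Finset.sum_congr rfl fun j _ => by ring
    rw [h4, h3]
    ring
  have h5 : 2 * ∑ i, D i i ^ 2 ≤ (∑ i, ∑ j, (D i j + D j i) ^ 2) / 2 := by
    have : ∀ i, 4 * D i i ^ 2 ≤ ∑ j, (D i j + D j i) ^ 2 := fun i => by
      have := Finset.single_le_sum (f := fun j => (D i j + D j i) ^ 2)
        (fun j _ => sq_nonneg _) (Finset.mem_univ i)
      linarith
    have := Finset.sum_le_sum fun i (_ : i ∈ Finset.univ) => this i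
    rw [← Finset.mul_sum] at this
    linarith
  have h6 : T ^ 2 ≤ 3 * ∑ i, D i i ^ 2 := by
    have h7 : T ^ 2 ≤ (d : ℝ) * ∑ i, D i i ^ 2 := by
      have := sq_sum_le_card_mul_sum_sq (s := (Finset.univ : Finset (Fin d))) (f := fun i => D i i)
      simpa using this
    have h8 : (d : ℝ) ≤ 3 := by exact_mod_cast hd3
    have h9 : 0 ≤ ∑ i, D i i ^ 2 := Finset.sum_nonneg fun i _ => sq_nonneg _
    nlinarith
  have h10 : 0 ≤ ∑ i, ∑ j, (D i j + D j i) * D i j - 2 / 3 * T ^ 2 := by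
    rw [h2]
    linarith
  have := mul_nonneg hmu h10
  have := mul_nonneg hbeta (sq_nonneg T)
  linarith

/-- Expressing the momentum rows of `q` through the velocity gradient produces a term `-V_i q_E`. It
cancels the work of the stress in the energy row. What is left is the stress power weighted by `-v
iEn > 0` and the square of `q iEn`, both with a negative sign. -/
theorem viscous_dissipation (hd3 : d ≤ 3) (g : Gas) (mu beta : State d → ℝ)
    (hmu0 : ∀ u ∈ physU g d, 0 ≤ mu u) (hbeta0 : ∀ u ∈ physU g d, 0 ≤ beta u)
    {v : State d} (hv : v iEn < 0) (q : Idx d → Fin d → ℝ) :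
    ∑ i, ∑ j, q i j * viscousFlux g mu beta v q i j ≤ 0 := by
  have hu := consOfEntr_mem_physU g hv
  have h9 : 0 < -v iEn := neg_pos.2 hv
  have hs := sum_stress_nonneg hd3 (hmu0 _ hu) (hbeta0 _ hu) fun i j => dVel v (fun s => q s j) i
  change 0 ≤ ∑ i, ∑ j, stressE g mu beta v q i j * dVel v (fun s => q s j) i at hs
  have e : ∑ i, ∑ j, q i j * viscousFlux g mu beta v q i j
      = -((-v iEn) * (∑ i, ∑ j, stressE g mu beta v q i j * dVel v (fun s => q s j) i)
        + g.cp * mu (consOfEntr g v) / g.Pr / (g.cv * (-v iEn) ^ 2) * ∑ j, q iEn j ^ 2) := by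
    have hq : ∀ i j, q (iMom i) j = (-v iEn) * dVel v (fun s => q s j) i - velE v i * q iEn j := by
      intro i j
      have h8 : v iEn ≠ 0 := hv.ne
      unfold dVel
      field_simp
      ring
    simp only [viscousFlux_eq g mu beta hv]
    rw [Fintype.sum_sum_type, Fintype.sum_sum_type]
    simp only [mkState, Sum.elim_inl, Sum.elim_inr, Finset.univ_unique, Finset.sum_singleton]
    have e1 : ∑ i, ∑ j, q (iMom i) j * -stressE g mu beta v q i j
        = -((-v iEn) * ∑ i, ∑ j, stressE g mu beta v q i j * dVel v (fun s => q s j) i)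
          + ∑ j, q iEn j * ∑ i, velE v i * stressE g mu beta v q i j := by
      have e2 : ∑ j, q iEn j * ∑ i, velE v i * stressE g mu beta v q i j
          = ∑ i, ∑ j, q iEn j * (velE v i * stressE g mu beta v q i j) := by
        rw [Finset.sum_comm]
        exact Finset.sum_congr rfl fun j _ => Finset.mul_sum _ _ _
      rw [e2, Finset.mul_sum, ← Finset.sum_neg_distrib, ← Finset.sum_add_distrib]
      refine Finset.sum_congr rfl fun i _ => ?_
      rw [Finset.mul_sum, ← Finset.sum_neg_distrib, ← Finset.sum_add_distrib]
      exact Finset.sum_congr rfl fun j _ => by rw [hq]; ring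
    change ∑ j, q iRho j * -0 + (∑ i, ∑ j, q (iMom i) j * -stressE g mu beta v q i j
      + ∑ j, q iEn j * -(∑ i, velE v i * stressE g mu beta v q i j
        + g.cp * mu (consOfEntr g v) / g.Pr * (q iEn j / (g.cv * (-v iEn) ^ 2)))) = _
    have e3 : ∑ j, q iEn j * -(∑ i, velE v i * stressE g mu beta v q i j
        + g.cp * mu (consOfEntr g v) / g.Pr * (q iEn j / (g.cv * (-v iEn) ^ 2)))
        = -(∑ j, q iEn j * ∑ i, velE v i * stressE g mu beta v q i j)
          - g.cp * mu (consOfEntr g v) / g.Pr / (g.cv * (-v iEn) ^ 2) * ∑ j, q iEn j ^ 2 := by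
      rw [Finset.mul_sum, ← Finset.sum_neg_distrib, ← Finset.sum_sub_distrib]
      exact Finset.sum_congr rfl fun j _ => by ring
    rw [e1, e3]
    simp only [neg_zero, mul_zero, Finset.sum_const_zero]
    ring
  rw [e]
  have h1 : 0 ≤ g.cp * mu (consOfEntr g v) / g.Pr / (g.cv * (-v iEn) ^ 2) := by
    have := g.cv_pos
    have := g.cv_pos.trans g.cv_lt_cp
    have := g.Pr_pos
    have := hmu0 _ hu
    positivity
  have h2 : 0 ≤ ∑ j, q iEn j ^ 2 := Finset.sum_nonneg fun j _ => sq_nonneg _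
  have h3 := mul_nonneg h1 h2
  have h4 := mul_nonneg h9.le hs
  linarith

theorem continuousOn_viscousFlux (g : Gas) (mu beta : State d → ℝ)
    (hmu : ContinuousOn mu (physU g d)) (hbeta : ContinuousOn beta (physU g d))
    {X : Type*} [TopologicalSpace X] {s : Set X} {v : X → State d} {q : X → Idx d → Fin d → ℝ}
    (hv : ContinuousOn v s) (hvp : ∀ x ∈ s, v x ∈ physV g d)
    (hq : ∀ i j, ContinuousOn (fun x => q x i j) s) (i : Idx d) (j : Fin d) :
    ContinuousOn (fun x => viscousFlux g mu beta (v x) (q x) i j) s := by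
  have hvp' : ∀ x ∈ s, v x iEn < 0 := fun x hx => (mem_physV_iff g).1 (hvp x hx)
  have hu : ContinuousOn (fun x => consOfEntr g (v x)) s := (continuousOn_consOfEntr g).comp hv hvp
  have hup : Set.MapsTo (fun x => consOfEntr g (v x)) s (physU g d) :=
    fun x hx => consOfEntr_mem_physU g (hvp' x hx)
  have hm : ContinuousOn (fun x => mu (consOfEntr g (v x))) s := hmu.comp hu hup
  have hb : ContinuousOn (fun x => beta (consOfEntr g (v x))) s := hbeta.comp hu hup
  have hW : ∀ j, ContinuousOn (fun x => velE (v x) j) s :=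
    fun j => (continuousOn_velE g j).comp hv hvp
  have hE : ContinuousOn (fun x => v x iEn) s := continuousOn_pi.1 hv iEn
  have hD : ∀ i j, ContinuousOn (fun x => dVel (v x) (fun l => q x l j) i) s := fun i j =>
    ((hq _ _).add ((hW i).mul (hq _ _))).div hE.neg fun x hx => (neg_pos.2 (hvp' x hx)).ne'
  have hT : ContinuousOn (fun x => ∑ k, dVel (v x) (fun l => q x l k) k) s :=
    continuousOn_finsetSum _ fun k _ => hD k k
  have hS : ∀ i j, ContinuousOn (fun x => stressE g mu beta (v x) (q x) i j) s := fun i j => by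
    refine (hm.mul (((hD i j).add (hD j i)).sub ?_)).add ?_
    · split_ifs
      · exact continuousOn_const.mul hT
      · exact continuousOn_const
    · split_ifs
      · exact hb.mul hT
      · exact continuousOn_const
  refine ContinuousOn.congr ?_ fun x hx => viscousFlux_eq g mu beta (hvp' x hx) (q x) i j
  refine ContinuousOn.neg ?_
  rcases i with i | i | i
  · exact continuousOn_const
  · exact hS i j
  · refine (continuousOn_finsetSum _ fun i _ => (hW i).mul (hS i j)).add ?_
    refine ((continuousOn_const.mul hm).div_const _).mul ((hq _ _).div
      (continuousOn_const.mul (hE.neg.pow 2)) fun x hx => ?_)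
    have := g.cv_pos
    have := neg_pos.2 (hvp' x hx)
    positivity

/-! ### The absolute value of a symmetrizable matrix -/

section matAbs

open Matrix

variable {ι : Type} [Fintype ι] [DecidableEq ι]

/-- Wherever `T i j` is nonzero the entries `a j` and `b i` coincide, so a function applied to both
diagonals preserves the relation. -/
theorem diagonal_intertwine_abs {T : Matrix ι ι ℝ} {a b : ι → ℝ}
    (h : T * diagonal a = diagonal b * T) :
    T * diagonal (fun i => |a i|) = diagonal (fun i => |b i|) * T := by
  ext i j
  have h1 := congrFun (congrFun h i) j
  rw [mul_diagonal, diagonal_mul] at h1 ⊢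
  rcases eq_or_ne (T i j) 0 with h0 | h0
  · simp [h0]
  · have : a j = b i := mul_left_cancel₀ h0 (by rw [h1, mul_comm])
    rw [this, mul_comm]

/-- The diagonalization inside `matAbs` is chosen arbitrarily. The change of eigenbasis `S⁻¹ R`
intertwines the two diagonals, hence also their absolute values, so the choice is immaterial. -/
theorem matAbs_eq {R : Matrix ι ι ℝ} {l : ι → ℝ} (hR : IsUnit R.det) :
    matAbs (R * diagonal l * R⁻¹) = R * diagonal (fun i => |l i|) * R⁻¹ := by
  have hex : ∃ S : Matrix ι ι ℝ × (ι → ℝ), IsUnit S.1.det ∧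
      R * diagonal l * R⁻¹ = S.1 * diagonal S.2 * S.1⁻¹ := ⟨(R, l), hR, rfl⟩
  rw [matAbs, dif_pos hex]
  obtain ⟨hS, hRS⟩ := hex.choose_spec
  set S := hex.choose.1
  set m := hex.choose.2
  have h1 : (S⁻¹ * R) * diagonal l = diagonal m * (S⁻¹ * R) := by
    calc (S⁻¹ * R) * diagonal l = S⁻¹ * (R * diagonal l * R⁻¹) * R := by
          rw [mul_assoc S⁻¹ _ R, mul_assoc (R * diagonal l), nonsing_inv_mul R hR, mul_one,
            mul_assoc]
      _ = diagonal m * (S⁻¹ * R) := by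
          rw [hRS, ← mul_assoc, ← mul_assoc, nonsing_inv_mul S hS, one_mul, mul_assoc]
  have h2 := diagonal_intertwine_abs h1
  calc S * diagonal (fun i => |m i|) * S⁻¹
      = S * (diagonal (fun i => |m i|) * (S⁻¹ * R)) * R⁻¹ := by
        rw [mul_assoc S, mul_assoc S, mul_assoc (diagonal _), mul_assoc S⁻¹, mul_nonsing_inv R hR,
          mul_one]
    _ = R * diagonal (fun i => |l i|) * R⁻¹ := by
        rw [← h2, mul_assoc S⁻¹, ← mul_assoc S, mul_nonsing_inv S hS, one_mul]

theorem exists_orthogonal_diagonalization {A : Matrix ι ι ℝ} (hA : A.IsSymm) :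
    ∃ (U : Matrix ι ι ℝ) (l : ι → ℝ), U * Uᵀ = 1 ∧ A = U * diagonal l * Uᵀ := by
  have hH : A.IsHermitian := by rwa [IsHermitian, conjTranspose_eq_transpose_of_trivial]
  refine ⟨hH.eigenvectorUnitary, hH.eigenvalues, ?_, ?_⟩
  · have := Unitary.coe_mul_star_self hH.eigenvectorUnitary
    rwa [Unitary.coe_star, star_eq_conjTranspose, conjTranspose_eq_transpose_of_trivial] at this
  · have := hH.spectral_theorem
    rw [Unitary.conjStarAlgAut_apply, star_eq_conjTranspose,
      conjTranspose_eq_transpose_of_trivial] at this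
    exact this

theorem exists_eq_mul_transpose {P : Matrix ι ι ℝ} (hP : P.PosDef) :
    ∃ B : Matrix ι ι ℝ, IsUnit B.det ∧ P = B * Bᵀ := by
  have hs : P.IsSymm := by
    have := hP.isHermitian
    rwa [IsHermitian, conjTranspose_eq_transpose_of_trivial] at this
  obtain ⟨U, l, hU, hl⟩ := exists_orthogonal_diagonalization hs
  have hU' : Uᵀ * U = 1 := mul_eq_one_comm.1 hU
  have hpos : ∀ i, 0 ≤ l i := fun i => by
    have h1 := hP.posSemidef.dotProduct_mulVec_nonneg (U.mulVec (Pi.single i 1))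
    have h2 : P *ᵥ (U *ᵥ Pi.single i 1) = U *ᵥ (diagonal l *ᵥ Pi.single i 1) := by
      rw [hl, mulVec_mulVec, mulVec_mulVec, mul_assoc, hU', mul_one]
    rw [h2, star_trivial, dotProduct_mulVec, ← mulVec_transpose, mulVec_mulVec, hU', one_mulVec,
      diagonal_mulVec_single] at h1
    simpa using h1
  refine ⟨U * diagonal fun i => √(l i), ?_, ?_⟩
  · have hdet : IsUnit P.det := hP.isUnit.map detMonoidHom
    have e : P = (U * diagonal fun i => √(l i)) * ((diagonal fun i => √(l i)) * Uᵀ) := by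
      rw [hl, mul_assoc U (diagonal fun i => √(l i)), ← mul_assoc (diagonal fun i => √(l i)),
        diagonal_mul_diagonal, mul_assoc]
      simp only [Real.mul_self_sqrt (hpos _)]
    rw [e, det_mul] at hdet
    exact isUnit_of_mul_isUnit_left hdet
  · rw [transpose_mul, diagonal_transpose, hl, mul_assoc U (diagonal fun i => √(l i)),
      ← mul_assoc (diagonal fun i => √(l i)), diagonal_mul_diagonal, mul_assoc]
    simp only [Real.mul_self_sqrt (hpos _)]

/-- A matrix that is symmetrized by a positive definite matrix is diagonalizable, with eigenvectors
that are scaled to factorize the symmetrizer. -/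
theorem exists_symmetrized_diagonalization {A P : Matrix ι ι ℝ} (hP : P.PosDef)
    (hA : (A * P).IsSymm) :
    ∃ (R : Matrix ι ι ℝ) (l : ι → ℝ), IsUnit R.det ∧ P = R * Rᵀ ∧ A = R * diagonal l * R⁻¹ := by
  obtain ⟨B, hB, hPB⟩ := exists_eq_mul_transpose hP
  have hBt : IsUnit Bᵀ.det := by rwa [det_transpose]
  -- With `P = B Bᵀ` this symmetric matrix equals `B⁻¹ A B`. Its orthogonal eigenbasis `U` therefore
  -- diagonalizes `A` through `R = B U`, and `R Rᵀ = B Bᵀ = P`.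
  have hN : (B⁻¹ * (A * P) * (B⁻¹)ᵀ).IsSymm := by
    rw [IsSymm, transpose_mul, transpose_mul, transpose_transpose, hA]
    simp only [mul_assoc]
  obtain ⟨U, l, hU, hl⟩ := exists_orthogonal_diagonalization hN
  have hU' : Uᵀ * U = 1 := mul_eq_one_comm.1 hU
  have hUd : IsUnit U.det := isUnit_det_of_right_inverse hU
  have hR : IsUnit (B * U).det := by rw [det_mul]; exact hB.mul hUd
  refine ⟨B * U, l, hR, ?_, ?_⟩
  · rw [transpose_mul, mul_assoc, ← mul_assoc U, hU, one_mul, hPB]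
  · have hinv : (B * U)⁻¹ = Uᵀ * B⁻¹ := by
      rw [Matrix.mul_inv_rev, inv_eq_left_inv hU']
    have hAB : B⁻¹ * (A * P) * (B⁻¹)ᵀ = B⁻¹ * A * B := by
      rw [hPB, transpose_nonsing_inv, mul_assoc, mul_assoc A, mul_assoc B,
        mul_nonsing_inv _ hBt, mul_one, mul_assoc]
    calc A = B * (B⁻¹ * A * B) * B⁻¹ := by
          rw [mul_assoc B⁻¹, ← mul_assoc B, mul_nonsing_inv _ hB, one_mul, mul_assoc,
            mul_nonsing_inv _ hB, mul_one]
      _ = B * U * diagonal l * (B * U)⁻¹ := by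
          rw [← hAB, hl, hinv]
          simp only [mul_assoc]

theorem mul_diagonal_inv_mul {R : Matrix ι ι ℝ} (hR : IsUnit R.det) (l : ι → ℝ) :
    R * diagonal l * R⁻¹ * (R * Rᵀ) = R * diagonal l * Rᵀ := by
  rw [mul_assoc _ R⁻¹, ← mul_assoc R⁻¹, nonsing_inv_mul R hR, one_mul]

theorem dotProduct_mul_diagonal_mulVec (R : Matrix ι ι ℝ) (l z : ι → ℝ) :
    z ⬝ᵥ (R * diagonal l * Rᵀ) *ᵥ z = ∑ i, l i * (Rᵀ *ᵥ z) i ^ 2 := by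
  rw [← mulVec_mulVec, ← mulVec_mulVec, dotProduct_mulVec, ← mulVec_transpose]
  refine Finset.sum_congr rfl fun i _ => ?_
  rw [mulVec_diagonal]
  ring

theorem aeval_mul_diagonal_inv {R : Matrix ι ι ℝ} (hR : IsUnit R.det) (l : ι → ℝ)
    (p : Polynomial ℝ) :
    Polynomial.aeval (R * diagonal l * R⁻¹) p = R * diagonal (fun i => p.eval (l i)) * R⁻¹ := by
  induction p using Polynomial.induction_on' with
  | add p q hp hq =>
    rw [map_add, hp, hq, ← add_mul, ← mul_add, diagonal_add]
    simp only [Polynomial.eval_add]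
  | monomial n a =>
    rw [Polynomial.aeval_monomial]
    have hpow : (R * diagonal l * R⁻¹) ^ n = R * diagonal (fun i => l i ^ n) * R⁻¹ := by
      induction n with
      | zero => simp [mul_nonsing_inv R hR]
      | succ n ih =>
        rw [pow_succ, ih, mul_assoc _ R⁻¹, ← mul_assoc R⁻¹, ← mul_assoc R⁻¹, nonsing_inv_mul R hR,
          one_mul, ← mul_assoc, mul_assoc R, diagonal_mul_diagonal]
        simp only [pow_succ]
    have hsm : (diagonal fun i => (Polynomial.monomial n a).eval (l i))
        = a • diagonal fun i => l i ^ n := by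
      rw [← diagonal_smul]
      congr 1
      funext i
      simp [Polynomial.eval_monomial]
    rw [hpow, ← Algebra.smul_def, hsm, mul_smul_comm, smul_mul_assoc]

/-- `|A| P` as a pointwise limit of expressions that are continuous in `A` and `P`. -/
theorem exists_seq_tendsto_matAbs_mul : ∃ p : ℕ → Polynomial ℝ, ∀ A P : Matrix ι ι ℝ, P.PosDef →
    (A * P).IsSymm → ∀ i j, Filter.Tendsto (fun n => (Polynomial.aeval A (p n) * P) i j)
      Filter.atTop (nhds ((matAbs A * P) i j)) := by
  -- Weierstrass approximation of `|x|` on `[-n, n]` with error below `1 / (n + 1)`. One sequence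
  -- serves all matrices, since any given finite set of eigenvalues eventually lies in the interval.
  have hex : ∀ n : ℕ, ∃ p : Polynomial ℝ, ∀ x ∈ Set.Icc (-(n : ℝ)) n,
      |p.eval x - abs x| < 1 / ((n : ℝ) + 1) := fun n =>
    exists_polynomial_near_of_continuousOn _ _ _ continuous_abs.continuousOn _ (by positivity)
  choose p hp using hex
  refine ⟨p, fun A P hP hA i j => ?_⟩
  obtain ⟨R, l, hR, rfl, rfl⟩ := exists_symmetrized_diagonalization hP hA
  have hlim : ∀ x : ℝ, Filter.Tendsto (fun n => (p n).eval x) Filter.atTop (nhds |x|) := fun x => by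
    rw [tendsto_iff_norm_sub_tendsto_zero]
    refine squeeze_zero' (Filter.Eventually.of_forall fun n => norm_nonneg _) ?_
      tendsto_one_div_add_atTop_nhds_zero_nat
    obtain ⟨N, hN⟩ := exists_nat_ge |x|
    filter_upwards [Filter.eventually_ge_atTop N] with n hn
    exact (hp n x (abs_le.1 (hN.trans (by exact_mod_cast hn)))).le
  simp only [aeval_mul_diagonal_inv hR, matAbs_eq hR, mul_diagonal_inv_mul hR]
  have hent : ∀ m : ι → ℝ, (R * diagonal m * Rᵀ) i j = ∑ k, R i k * m k * Rᵀ k j := fun m => by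
    rw [mul_apply]
    simp only [mul_diagonal]
  simp only [hent]
  exact tendsto_finsetSum _ fun k _ => ((hlim (l k)).const_mul _).mul_const _

/-- In the coordinates `Rᵀ z` both forms are diagonal, and the claim is the triangle inequality for
`∑ l_i y_i²`. -/
theorem quadratic_le_matAbs {A P : Matrix ι ι ℝ} (hP : P.PosDef) (hA : (A * P).IsSymm)
    (z : ι → ℝ) : |z ⬝ᵥ (A * P) *ᵥ z| ≤ z ⬝ᵥ (matAbs A * P) *ᵥ z := by
  obtain ⟨R, l, hR, rfl, rfl⟩ := exists_symmetrized_diagonalization hP hA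
  rw [matAbs_eq hR, mul_diagonal_inv_mul hR, mul_diagonal_inv_mul hR,
    dotProduct_mul_diagonal_mulVec, dotProduct_mul_diagonal_mulVec]
  refine (Finset.abs_sum_le_sum_abs _ _).trans (Finset.sum_le_sum fun i _ => ?_)
  rw [abs_mul, abs_of_nonneg (sq_nonneg ((Rᵀ *ᵥ z) i))]

/-- From `|λ| ≤ (1 + λ²) / 2` on each eigenvalue. The bound is a polynomial in the entries of `A`
and `P`, so it depends continuously on them with no reference to eigenvectors. -/
theorem matAbs_quadratic_le {A P : Matrix ι ι ℝ} (hP : P.PosDef) (hA : (A * P).IsSymm)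
    (z : ι → ℝ) : z ⬝ᵥ (matAbs A * P) *ᵥ z ≤ (z ⬝ᵥ P *ᵥ z + z ⬝ᵥ (A * (A * P)) *ᵥ z) / 2 := by
  obtain ⟨R, l, hR, rfl, rfl⟩ := exists_symmetrized_diagonalization hP hA
  have e1 : R * Rᵀ = R * diagonal (fun _ => (1 : ℝ)) * Rᵀ := by simp
  have e2 : R * diagonal l * R⁻¹ * (R * diagonal l * R⁻¹ * (R * Rᵀ))
      = R * diagonal (fun i => l i * l i) * Rᵀ := by
    rw [mul_diagonal_inv_mul hR, mul_assoc _ R⁻¹, ← mul_assoc R⁻¹, ← mul_assoc R⁻¹,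
      nonsing_inv_mul R hR, one_mul, mul_assoc R, ← mul_assoc (diagonal l), diagonal_mul_diagonal,
      mul_assoc]
  rw [matAbs_eq hR, mul_diagonal_inv_mul hR, e2, e1, dotProduct_mul_diagonal_mulVec,
    dotProduct_mul_diagonal_mulVec, dotProduct_mul_diagonal_mulVec, ← Finset.sum_add_distrib,
    Finset.sum_div]
  refine Finset.sum_le_sum fun i _ => ?_
  have h1 := sq_nonneg (|l i| - 1)
  have h2 := sq_abs (l i)
  nlinarith [sq_nonneg ((Rᵀ *ᵥ z) i)]

theorem isSymm_matAbs_mul {A P : Matrix ι ι ℝ} (hP : P.PosDef) (hA : (A * P).IsSymm) :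
    (matAbs A * P).IsSymm := by
  obtain ⟨R, l, hR, rfl, rfl⟩ := exists_symmetrized_diagonalization hP hA
  rw [matAbs_eq hR, mul_diagonal_inv_mul hR, IsSymm, transpose_mul, transpose_mul,
    transpose_transpose, diagonal_transpose, mul_assoc]

/-- The entries of `|A| P` are bounded by those of `P` and `A² P`. -/
theorem abs_matAbs_mul_apply_le {A P : Matrix ι ι ℝ} (hP : P.PosDef) (hA : (A * P).IsSymm)
    (i j : ι) : |(matAbs A * P) i j| ≤
      (P i i + (A * (A * P)) i i) / 2 + (P j j + (A * (A * P)) j j) / 2 := by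
  have hnn : ∀ z, 0 ≤ z ⬝ᵥ (matAbs A * P) *ᵥ z := fun z =>
    (abs_nonneg _).trans (quadratic_le_matAbs hP hA z)
  have hdiag : ∀ i, 0 ≤ (matAbs A * P) i i ∧ (matAbs A * P) i i ≤
      (P i i + (A * (A * P)) i i) / 2 := fun i => by
    have h1 := hnn (Pi.single i 1)
    have h2 := matAbs_quadratic_le hP hA (Pi.single i 1)
    simp only [mulVec_single_one, single_one_dotProduct, col_apply] at h1 h2
    exact ⟨h1, h2⟩
  have hs : (matAbs A * P) j i = (matAbs A * P) i j := (isSymm_matAbs_mul hP hA).apply i j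
  -- Nonnegativity of the form on `e_i ± e_j` bounds twice the off-diagonal entry, in absolute
  -- value, by the sum of the two diagonal entries.
  have h1 := hnn (Pi.single i 1 + Pi.single j 1)
  have h2 := hnn (Pi.single i 1 - Pi.single j 1)
  simp only [mulVec_add, mulVec_sub, dotProduct_add, dotProduct_sub, add_dotProduct,
    sub_dotProduct, mulVec_single_one, single_one_dotProduct, col_apply, hs] at h1 h2
  have h3 := hdiag i
  have h4 := hdiag j
  rw [abs_le]
  constructor <;> linarith [h3.1, h3.2, h4.1, h4.2]

end matAbs

/-! ### Entropy stability of the inviscid numerical flux -/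

theorem path_mem_physV (g : Gas) {v1 v2 : State d} (h1 : v1 ∈ physV g d) (h2 : v2 ∈ physV g d)
    {t : ℝ} (ht : t ∈ Set.Icc (0 : ℝ) 1) : path v1 v2 t ∈ physV g d :=
  (convex_physV g d).add_smul_sub_mem h1 h2 ht

theorem continuous_path (v1 v2 : State d) : Continuous (path v1 v2) := by
  unfold path
  fun_prop

theorem path_swap (v1 v2 : State d) (t : ℝ) : path v2 v1 t = path v1 v2 (1 - t) := by
  unfold path
  funext i
  simp
  ring

theorem intervalIntegrable_fun_sum {ι : Type*} [Fintype ι] {f : ι → ℝ → ℝ} {a b : ℝ}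
    (h : ∀ i, IntervalIntegrable (f i) volume a b) :
    IntervalIntegrable (fun t => ∑ i, f i t) volume a b := by
  have h1 := IntervalIntegrable.sum Finset.univ fun i _ => h i
  have e : (fun t => ∑ i, f i t) = ∑ i, f i := by
    funext t
    rw [Finset.sum_apply]
  rw [e]
  exact h1

/-- Continuity of `|Ã_n|` along the path is not required. Measurability comes from the pointwise
polynomial limit, and the entries are dominated by a continuous function on `[0, 1]`. -/
theorem intervalIntegrable_absAn_path (g : Gas) (n : Pt d) {v1 v2 : State d}
    (h1 : v1 ∈ physV g d) (h2 : v2 ∈ physV g d) (i l : Idx d) :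
    IntervalIntegrable (fun t => absAn g n (path v1 v2 t) i l) volume 0 1 := by
  rw [intervalIntegrable_iff_integrableOn_Icc_of_le zero_le_one]
  have hp : ∀ t ∈ Set.Icc (0 : ℝ) 1, path v1 v2 t ∈ physV g d := fun t => path_mem_physV g h1 h2
  have hP : ContinuousOn (fun t => metricA0 g (path v1 v2 t)) (Set.Icc 0 1) :=
    (continuousOn_metricA0 g).comp (continuous_path v1 v2).continuousOn hp
  have hA : ContinuousOn (fun t => jacAn g n (path v1 v2 t)) (Set.Icc 0 1) :=
    (continuousOn_jacAn g n).comp (continuous_path v1 v2).continuousOn hp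
  have hpos : ∀ t ∈ Set.Icc (0 : ℝ) 1, (metricA0 g (path v1 v2 t)).PosDef := fun t ht =>
    posDef_metricA0 g ((mem_physV_iff g).1 (hp t ht))
  have hsymm : ∀ t ∈ Set.Icc (0 : ℝ) 1,
      (jacAn g n (path v1 v2 t) * metricA0 g (path v1 v2 t)).IsSymm := fun t ht =>
    isSymm_jacAn_mul_metricA0 g n ((mem_physV_iff g).1 (hp t ht))
  have hent : ∀ {B : ℝ → Matrix (Idx d) (Idx d) ℝ} (i j : Idx d), ContinuousOn B (Set.Icc 0 1) →
      ContinuousOn (fun t => B t i j) (Set.Icc 0 1) := fun i j hB =>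
    continuousOn_pi.1 (continuousOn_pi.1 hB i) j
  have hQ := hA.mul (hA.mul hP)
  obtain ⟨p, hp⟩ := exists_seq_tendsto_matAbs_mul (ι := Idx d)
  have hmeas : AEStronglyMeasurable (fun t => absAn g n (path v1 v2 t) i l)
      (volume.restrict (Set.Icc 0 1)) := by
    refine aestronglyMeasurable_of_tendsto_ae Filter.atTop (f := fun m t =>
      (Polynomial.aeval (jacAn g n (path v1 v2 t)) (p m) * metricA0 g (path v1 v2 t)) i l)
      (fun m => ?_) ((ae_restrict_iff' measurableSet_Icc).2 (ae_of_all _ fun t ht =>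
        hp _ _ (hpos t ht) (hsymm t ht) i l))
    refine (hent i l (ContinuousOn.mul ?_ hP)).aestronglyMeasurable measurableSet_Icc
    simp only [Polynomial.aeval_eq_sum_range]
    exact continuousOn_finsetSum _ fun k _ => (hA.pow k).const_smul ((p m).coeff k)
  refine Integrable.mono' (g := fun t => (metricA0 g (path v1 v2 t) i i
    + (jacAn g n (path v1 v2 t) * (jacAn g n (path v1 v2 t) * metricA0 g (path v1 v2 t))) i i) / 2
    + (metricA0 g (path v1 v2 t) l l
    + (jacAn g n (path v1 v2 t) * (jacAn g n (path v1 v2 t) * metricA0 g (path v1 v2 t))) l l) / 2)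
    (ContinuousOn.integrableOn_compact isCompact_Icc ?_) hmeas
    ((ae_restrict_iff' measurableSet_Icc).2 (ae_of_all _ fun t ht =>
      abs_matAbs_mul_apply_le (hpos t ht) (hsymm t ht) i l))
  exact (((hent i i hP).add (hent i i hQ)).div_const 2).add
    (((hent l l hP).add (hent l l hQ)).div_const 2)

theorem quadForm_eq_sum (A : Matrix (Idx d) (Idx d) ℝ) (z : State d) :
    quadForm A z = ∑ i, ∑ l, z i * z l * A i l := by
  unfold quadForm Matrix.mulVec dotProduct
  refine Finset.sum_congr rfl fun i _ => ?_
  rw [Finset.mul_sum]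
  exact Finset.sum_congr rfl fun l _ => by ring

theorem intervalIntegrable_quadForm_absAn_path (g : Gas) (n : Pt d) {v1 v2 : State d}
    (h1 : v1 ∈ physV g d) (h2 : v2 ∈ physV g d) (z : State d) :
    IntervalIntegrable (fun t => quadForm (absAn g n (path v1 v2 t)) z) volume 0 1 := by
  simp only [quadForm_eq_sum]
  have h : ∀ i l, IntervalIntegrable (fun t => z i * z l * absAn g n (path v1 v2 t) i l)
      volume 0 1 := fun i l => (intervalIntegrable_absAn_path g n h1 h2 i l).const_mul _
  exact intervalIntegrable_fun_sum fun i => intervalIntegrable_fun_sum fun l => h i l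

/-- Reversing the path by `θ ↦ 1 - θ` turns the weight `1 - θ` of the second term into `θ`, and the
two weights add up to one. -/
theorem quadForm_sigmaMV (g : Gas) (n : Pt d) {v1 v2 : State d}
    (h1 : v1 ∈ physV g d) (h2 : v2 ∈ physV g d) (z : State d) :
    quadForm (sigmaMV g v1 v2 n) z = ∫ t in (0 : ℝ)..1, quadForm (absAn g n (path v1 v2 t)) z := by
  have ha := intervalIntegrable_quadForm_absAn_path g n h1 h2 z
  have hb := intervalIntegrable_quadForm_absAn_path g n h2 h1 z
  have hc : ∀ {f : ℝ → ℝ}, IntervalIntegrable f volume 0 1 →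
      IntervalIntegrable (fun t => (1 - t) * f t) volume 0 1 := fun hf =>
    hf.continuousOn_mul (by fun_prop)
  have hent : ∀ i l, IntervalIntegrable (fun t => z i * z l * ((1 - t) *
      (absAn g n (path v1 v2 t) i l + absAn g n (path v2 v1 t) i l))) volume 0 1 := fun i l =>
    (hc ((intervalIntegrable_absAn_path g n h1 h2 i l).add
      (intervalIntegrable_absAn_path g n h2 h1 i l))).const_mul _
  have e1 : quadForm (sigmaMV g v1 v2 n) z = ∫ t in (0 : ℝ)..1, (1 - t) *
      (quadForm (absAn g n (path v1 v2 t)) z + quadForm (absAn g n (path v2 v1 t)) z) := by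
    simp only [quadForm_eq_sum, sigmaMV, Matrix.of_apply]
    simp only [← intervalIntegral.integral_const_mul]
    have hI : ∀ i, IntervalIntegrable (fun t => ∑ l, z i * z l * ((1 - t) *
        (absAn g n (path v1 v2 t) i l + absAn g n (path v2 v1 t) i l))) volume 0 1 := fun i =>
      intervalIntegrable_fun_sum fun l => hent i l
    rw [Finset.sum_congr rfl fun i _ =>
      (intervalIntegral.integral_finsetSum fun l _ => hent i l).symm,
      ← intervalIntegral.integral_finsetSum fun i _ => hI i]
    refine intervalIntegral.integral_congr fun t _ => ?_
    rw [← Finset.sum_add_distrib, Finset.mul_sum]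
    refine Finset.sum_congr rfl fun i _ => ?_
    rw [← Finset.sum_add_distrib, Finset.mul_sum]
    exact Finset.sum_congr rfl fun l _ => by ring
  have e2 : (∫ t in (0 : ℝ)..1, (1 - t) * quadForm (absAn g n (path v2 v1 t)) z)
      = ∫ t in (0 : ℝ)..1, t * quadForm (absAn g n (path v1 v2 t)) z := by
    simp only [path_swap v1 v2]
    have := intervalIntegral.integral_comp_sub_left (a := 0) (b := 1)
      (fun t => t * quadForm (absAn g n (path v1 v2 t)) z) 1
    simpa using this
  have hd : IntervalIntegrable (fun t => t * quadForm (absAn g n (path v1 v2 t)) z) volume 0 1 :=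
    ha.continuousOn_mul (by fun_prop)
  rw [e1]
  simp only [mul_add]
  rw [intervalIntegral.integral_add (hc ha) (hc hb), e2, ← intervalIntegral.integral_add (hc ha) hd]
  exact intervalIntegral.integral_congr fun t _ => by ring

/-- The `i`-th column of `R` is an eigenvector for `l i`, so `|l i|` belongs to the set whose
supremum is taken. -/
theorem abs_lamMax_le {ι : Type} [Fintype ι] [DecidableEq ι] {R : Matrix ι ι ℝ} {l : ι → ℝ}
    (hR : IsUnit R.det) (i : ι) :
    |l i| ≤ sSup {r | ∃ m : ℝ, Module.End.HasEigenvalue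
      (Matrix.toLin' (R * Matrix.diagonal l * R⁻¹)) m ∧ r = |m|} := by
  set f := Matrix.toLin' (R * Matrix.diagonal l * R⁻¹)
  -- Finiteness of the spectrum makes the real supremum a genuine upper bound; for an unbounded set
  -- `sSup` would be the default `0`.
  have hfin : {r | ∃ m : ℝ, Module.End.HasEigenvalue f m ∧ r = |m|}.Finite := by
    have h1 : {m : ℝ | Module.End.HasEigenvalue f m}.Finite := by
      have := Module.End.finite_hasEigenvalue f
      exact this
    refine (h1.image fun m => |m|).subset ?_
    rintro r ⟨m, hm, rfl⟩
    exact ⟨m, hm, rfl⟩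
  refine le_csSup hfin.bddAbove ⟨l i, ?_, rfl⟩
  refine Module.End.hasEigenvalue_of_hasEigenvector (x := R.mulVec (Pi.single i 1)) ⟨?_, ?_⟩
  · rw [Module.End.mem_eigenspace_iff, Matrix.toLin'_apply, Matrix.mulVec_mulVec, mul_assoc,
      Matrix.nonsing_inv_mul R hR, mul_one, ← Matrix.mulVec_mulVec, Matrix.diagonal_mulVec_single,
      mul_one, ← Matrix.mulVec_smul]
    congr 1
    funext j
    simp [Pi.single_apply]
  · intro h0
    have h1 : (R⁻¹).mulVec (R.mulVec (Pi.single i 1)) = 0 := by rw [h0, Matrix.mulVec_zero]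
    rw [Matrix.mulVec_mulVec, Matrix.nonsing_inv_mul R hR, Matrix.one_mulVec] at h1
    have := congrFun h1 i
    simp at this

/-- The factorization `Ã₀ = R Rᵀ` makes both forms diagonal in the coordinates `Rᵀ z`, where the
inequality is `|l i| ≤ lamMax` term by term. -/
theorem quadForm_absAn_le_lamMax (g : Gas) (n : Pt d) {v : State d} (hv : v ∈ physV g d)
    (z : State d) : quadForm (absAn g n v) z ≤ quadForm (lamMax g n v • metricA0 g v) z := by
  have hv' := (mem_physV_iff g).1 hv
  obtain ⟨R, l, hR, hP, hA⟩ := exists_symmetrized_diagonalization (posDef_metricA0 g hv')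
    (isSymm_jacAn_mul_metricA0 g n hv')
  have hl : ∀ i, |l i| ≤ lamMax g n v := fun i => by
    unfold lamMax
    rw [hA]
    exact abs_lamMax_le hR i
  have e1 : R * R.transpose = R * Matrix.diagonal (fun _ => (1 : ℝ)) * R.transpose := by simp
  unfold quadForm absAn
  rw [hA, hP, matAbs_eq hR, mul_diagonal_inv_mul hR, dotProduct_mul_diagonal_mulVec,
    Matrix.smul_mulVec, dotProduct_smul, e1, dotProduct_mul_diagonal_mulVec, smul_eq_mul,
    Finset.mul_sum]
  refine Finset.sum_le_sum fun i _ => ?_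
  rw [one_mul]
  exact mul_le_mul_of_nonneg_right (hl i) (sq_nonneg _)

/-- The error of the trapezoidal rule for the entropy flux potential is controlled by any bound on
the quadratic forms of `|Ã_n|` along the path. -/
theorem potential_diff_le (g : Gas) (n : Pt d) {v1 v2 : State d}
    (h1 : v1 ∈ physV g d) (h2 : v2 ∈ physV g d) {a : ℝ → ℝ} (ha : IntervalIntegrable a volume 0 1)
    (hle : ∀ t ∈ Set.Icc (0 : ℝ) 1, quadForm (absAn g n (path v1 v2 t)) (v2 - v1) ≤ a t) :
    fluxPotential g n v2 - fluxPotential g n v1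
      ≤ (1 / 2) * ((v2 - v1) ⬝ᵥ (inviscidFluxN g n (consOfEntr g v1)
        + inviscidFluxN g n (consOfEntr g v2))) + (1 / 2) * ∫ t in (0 : ℝ)..1, a t := by
  set z := v2 - v1 with hz
  have hp : ∀ t ∈ Set.Icc (0 : ℝ) 1, path v1 v2 t ∈ physV g d := fun t => path_mem_physV g h1 h2
  have hp' : ∀ t ∈ Set.Icc (0 : ℝ) 1, path v1 v2 t iEn < 0 := fun t ht =>
    (mem_physV_iff g).1 (hp t ht)
  have hl : ∀ t, HasDerivAt (path v1 v2) z t := fun t => by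
    have h := ((hasDerivAt_id t).smul_const z).const_add v1
    rw [one_smul] at h
    exact h
  -- Integration by parts for the trapezoidal rule. In `K'` the derivative of the potential cancels
  -- the derivative of the factor `1/2 - t`, while `K 1 - K 0` is the potential difference minus the
  -- trapezoidal sum.
  set K : ℝ → ℝ := fun t => fluxPotential g n (path v1 v2 t)
    + (1 / 2 - t) * (z ⬝ᵥ inviscidFluxN g n (consOfEntr g (path v1 v2 t))) with hK
  have hK' : ∀ t ∈ Set.uIcc (0 : ℝ) 1,
      HasDerivAt K ((1 / 2 - t) * (z ⬝ᵥ dFlux g n (path v1 v2 t) z)) t := fun t ht => by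
    rw [Set.uIcc_of_le zero_le_one] at ht
    have k1 := hasDerivAt_fluxPotential g n (hl t) (hp' t ht)
    have k2 := hasDerivAt_pi.1 (hasDerivAt_inviscidFluxN g n (hl t) (hp' t ht))
    have k3 : HasDerivAt (fun s => z ⬝ᵥ inviscidFluxN g n (consOfEntr g (path v1 v2 s)))
        (z ⬝ᵥ dFlux g n (path v1 v2 t) z) t := HasDerivAt.fun_sum fun i _ => (k2 i).const_mul _
    refine (k1.add (((hasDerivAt_id t).const_sub (1 / 2)).mul k3)).congr_deriv ?_
    simp only [id]
    ring
  have hquad : ∀ t ∈ Set.Icc (0 : ℝ) 1, z ⬝ᵥ dFlux g n (path v1 v2 t) z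
      = z ⬝ᵥ (jacAn g n (path v1 v2 t) * metricA0 g (path v1 v2 t)).mulVec z := fun t ht => by
    rw [jacAn_mul_metricA0_mulVec g n (hp' t ht)]
  have hcont : ContinuousOn (fun t => z ⬝ᵥ dFlux g n (path v1 v2 t) z) (Set.Icc 0 1) := by
    refine ContinuousOn.congr ?_ hquad
    have hP : ContinuousOn (fun t => metricA0 g (path v1 v2 t)) (Set.Icc 0 1) :=
      (continuousOn_metricA0 g).comp (continuous_path v1 v2).continuousOn hp
    have hA : ContinuousOn (fun t => jacAn g n (path v1 v2 t)) (Set.Icc 0 1) :=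
      (continuousOn_jacAn g n).comp (continuous_path v1 v2).continuousOn hp
    have hB : ContinuousOn (fun t => jacAn g n (path v1 v2 t) * metricA0 g (path v1 v2 t))
      (Set.Icc 0 1) := hA.mul hP
    change ContinuousOn (fun t => quadForm (jacAn g n (path v1 v2 t) * metricA0 g (path v1 v2 t)) z)
      (Set.Icc 0 1)
    simp only [quadForm_eq_sum]
    exact continuousOn_finsetSum _ fun i _ => continuousOn_finsetSum _ fun l _ =>
      continuousOn_const.mul (continuousOn_pi.1 (continuousOn_pi.1 hB i) l)
  have hint : IntervalIntegrable (fun t => (1 / 2 - t) * (z ⬝ᵥ dFlux g n (path v1 v2 t) z))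
      volume 0 1 := by
    refine ContinuousOn.intervalIntegrable ?_
    rw [Set.uIcc_of_le zero_le_one]
    exact (by fun_prop : Continuous fun t : ℝ => 1 / 2 - t).continuousOn.mul hcont
  have hftc := intervalIntegral.integral_eq_sub_of_hasDerivAt hK' hint
  have hmono : ∫ t in (0 : ℝ)..1, (1 / 2 - t) * (z ⬝ᵥ dFlux g n (path v1 v2 t) z)
      ≤ ∫ t in (0 : ℝ)..1, (1 / 2) * a t := by
    refine intervalIntegral.integral_mono_on zero_le_one hint (ha.const_mul _) fun t ht => ?_
    have k1 : |z ⬝ᵥ dFlux g n (path v1 v2 t) z| ≤ a t := by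
      rw [hquad t ht]
      exact (quadratic_le_matAbs (posDef_metricA0 g (hp' t ht))
        (isSymm_jacAn_mul_metricA0 g n (hp' t ht)) z).trans (hle t ht)
    -- This kernel bound is the origin of the factor `1/2` in front of `σ` in the numerical flux.
    have k2 : |1 / 2 - t| ≤ 1 / 2 := abs_le.2 ⟨by linarith [ht.2], by linarith [ht.1]⟩
    calc (1 / 2 - t) * (z ⬝ᵥ dFlux g n (path v1 v2 t) z)
        ≤ |1 / 2 - t| * |z ⬝ᵥ dFlux g n (path v1 v2 t) z| := by
          rw [← abs_mul]; exact le_abs_self _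
      _ ≤ 1 / 2 * a t := mul_le_mul k2 k1 (abs_nonneg _) (by norm_num)
  rw [hftc, intervalIntegral.integral_const_mul] at hmono
  have e0 : path v1 v2 0 = v1 := by simp [path]
  have e1 : path v1 v2 1 = v2 := by simp [path]
  simp only [hK, e0, e1] at hmono
  rw [dotProduct_add]
  linarith

/-- The inviscid numerical flux dissipates entropy on each side of a face. -/
theorem potential_diff_le_numFlux (g : Gas) {sigma : Stab d}
    (hsigma : sigma = sigmaMV g ∨
      ∃ vs : State d → State d → Pt d → State d, IntermediateState g vs ∧
        (sigma = sigmaS g vs ∨ sigma = sigmaSLF g vs))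
    {n : Pt d} (hn : ‖n‖ = 1) {vh v : State d} (hvh : vh ∈ physV g d) (hv : v ∈ physV g d) :
    fluxPotential g n v - fluxPotential g n vh ≤ numFlux g sigma n vh v ⬝ᵥ (v - vh) := by
  -- The three stabilizations differ only in the majorant `a`: the form along the path itself for
  -- the mean-value matrix, and the constant value at the intermediate state for the other two.
  have key : ∃ a : ℝ → ℝ, IntervalIntegrable a volume 0 1 ∧
      (∀ t ∈ Set.Icc (0 : ℝ) 1, quadForm (absAn g n (path vh v t)) (v - vh) ≤ a t) ∧
      ∫ t in (0 : ℝ)..1, a t ≤ quadForm (sigma vh v n) (v - vh) := by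
    rcases hsigma with rfl | ⟨vs, hvs, hs⟩
    · exact ⟨_, intervalIntegrable_quadForm_absAn_path g n hvh hv _, fun t _ => le_rfl,
        (quadForm_sigmaMV g n hvh hv _).ge⟩
    · obtain ⟨hp, hle⟩ := hvs vh hvh v hv n hn
      refine ⟨fun _ => quadForm (absAn g n (vs vh v n)) (v - vh), intervalIntegrable_const, hle, ?_⟩
      rw [intervalIntegral.integral_const, sub_zero, one_smul]
      rcases hs with rfl | rfl
      · exact le_rfl
      · exact quadForm_absAn_le_lamMax g n hp _
  obtain ⟨a, ha, hle, hq⟩ := key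
  refine (potential_diff_le g n hvh hv ha hle).trans ?_
  have e : numFlux g sigma n vh v ⬝ᵥ (v - vh) = (1 / 2) * ((v - vh) ⬝ᵥ (inviscidFluxN g n
      (consOfEntr g vh) + inviscidFluxN g n (consOfEntr g v)))
      + (1 / 2) * quadForm (sigma vh v n) (v - vh) := by
    rw [dotProduct_comm, numFlux, dotProduct_add, dotProduct_smul, dotProduct_smul, quadForm,
      smul_eq_mul, smul_eq_mul]
  rw [e]
  linarith

/-! ### The divergence theorem on a polytope -/

/-- The points on the half-open segments from (not including) `x0` to the points of `A`, where `A`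
lies in the hyperplane `⟪n, x - x0⟫ = h`. -/
def coneSet (x0 n : Pt d) (h : ℝ) (A : Set (Pt d)) : Set (Pt d) :=
  {x | inner ℝ n (x - x0) / h ∈ Set.Ioc (0 : ℝ) 1 ∧
    x0 + (inner ℝ n (x - x0) / h)⁻¹ • (x - x0) ∈ A}

/-- The point at the parameter `p.1` of the segment from `x0` to `p.2`. -/
def conePoint (x0 : Pt d) (p : ℝ × Pt d) : Pt d := x0 + p.1 • (p.2 - x0)

theorem measurable_conePoint (x0 : Pt d) : Measurable (conePoint x0) := by
  unfold conePoint; fun_prop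

theorem measurableSet_coneSet (x0 n : Pt d) (h : ℝ) {A : Set (Pt d)} (hA : MeasurableSet A) :
    MeasurableSet (coneSet x0 n h A) := by
  have h1 : Measurable fun x : Pt d => inner ℝ n (x - x0) / h := by fun_prop
  have h2 : Measurable fun x : Pt d => x0 + (inner ℝ n (x - x0) / h)⁻¹ • (x - x0) :=
    measurable_const.add (h1.inv.smul (by fun_prop))
  exact (h1 measurableSet_Ioc).inter (h2 hA)

/-- The segment parameter is the relative height `⟪n, x - x0⟫ / h`, because every point of `A` has
height `h`. Excluding the parameter `0` removes the apex, where the point of `A` would be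
undetermined. -/
theorem mem_coneSet_iff {x0 n : Pt d} {h : ℝ} (hh : 0 < h) {A : Set (Pt d)}
    (hA : ∀ y ∈ A, inner ℝ n (y - x0) = h) {x : Pt d} :
    x ∈ coneSet x0 n h A ↔ ∃ t ∈ Set.Ioc (0 : ℝ) 1, ∃ y ∈ A, conePoint x0 (t, y) = x := by
  constructor
  · rintro ⟨h1, h2⟩
    refine ⟨_, h1, _, h2, ?_⟩
    simp only [conePoint, add_sub_cancel_left]
    rw [smul_smul, mul_inv_cancel₀ h1.1.ne', one_smul, add_sub_cancel]
  · rintro ⟨t, ht, y, hy, rfl⟩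
    have h1 : inner ℝ n (conePoint x0 (t, y) - x0) / h = t := by
      simp only [conePoint, add_sub_cancel_left]
      rw [inner_smul_right, hA y hy]
      field_simp
    refine ⟨by rw [h1]; exact ht, ?_⟩
    rw [h1]
    simp only [conePoint, add_sub_cancel_left]
    rwa [smul_smul, inv_mul_cancel₀ ht.1.ne', one_smul, add_sub_cancel]

/-- Slicing by hyperplanes orthogonal to `n`: the slice at relative height `t` is a homothetic copy
of part of `A`, whose area scales by `t ^ (d - 1)`. The factor `h` converts relative height into
length. -/
theorem volume_inter_coneSet {x0 n : Pt d} {h : ℝ} (hn : ‖n‖ = 1) (hh : 0 < h) {A : Set (Pt d)}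
    (hAm : MeasurableSet A) (hA : ∀ y ∈ A, inner ℝ n (y - x0) = h) {T : Set (Pt d)}
    (hT : MeasurableSet T) :
    volume (T ∩ coneSet x0 n h A) = ∫⁻ t in Set.Ioc (0 : ℝ) 1,
      ENNReal.ofReal (h * t ^ (d - 1)) * μHE[d - 1] (A ∩ {y | conePoint x0 (t, y) ∈ T}) := by
  have hv : h • n ≠ 0 := by
    intro h0
    have : ‖h • n‖ = 0 := by rw [h0, norm_zero]
    rw [norm_smul, hn, mul_one, Real.norm_of_nonneg hh.le] at this
    exact hh.ne' this
  have key := EuclideanGeometry.euclideanHausdorffMeasure_eq_lintegral (V := Pt d) (P := Pt d) x0 hv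
    (hT.inter (measurableSet_coneSet x0 n h hAm))
  rw [InnerProductSpace.euclideanHausdorffMeasure_eq_volume] at key
  rw [finrank_euclideanSpace_fin] at key
  have hnorm : ‖h • n‖ₑ = ENNReal.ofReal h := by
    rw [← ofReal_norm, norm_smul, hn, mul_one, Real.norm_of_nonneg hh.le]
  have hlev : ∀ (t : ℝ) (x : Pt d),
      x ∈ AffineSubspace.mk' (t • (h • n) +ᵥ x0) (Submodule.span ℝ {h • n})ᗮ ↔
        inner ℝ n (x - x0) / h = t := by
    intro t x
    rw [AffineSubspace.mem_mk', Submodule.mem_orthogonal_singleton_iff_inner_right]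
    have e : x -ᵥ (t • (h • n) +ᵥ x0) = (x - x0) - (t * h) • n := by
      rw [smul_smul, vsub_eq_sub, vadd_eq_add]; abel
    rw [e, inner_smul_left, inner_sub_right, inner_smul_right, real_inner_self_eq_norm_sq, hn,
      mul_eq_zero, div_eq_iff hh.ne']
    simp only [conj_trivial, hh.ne', false_or]
    constructor <;> intro h' <;> linarith
  rw [key, hnorm, ← lintegral_const_mul' _ _ ENNReal.ofReal_ne_top,
    ← lintegral_indicator measurableSet_Ioc]
  refine lintegral_congr fun t => ?_
  by_cases ht : t ∈ Set.Ioc (0 : ℝ) 1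
  · rw [Set.indicator_of_mem ht]
    have hset : T ∩ coneSet x0 n h A ∩
        AffineSubspace.mk' (t • (h • n) +ᵥ x0) (Submodule.span ℝ {h • n})ᗮ
        = AffineMap.homothety x0 t '' (A ∩ {y | conePoint x0 (t, y) ∈ T}) := by
      ext x
      have hhom : ∀ y, AffineMap.homothety x0 t y = conePoint x0 (t, y) := fun y => by
        simp [AffineMap.homothety_apply, conePoint, add_comm]
      simp only [Set.mem_inter_iff, Set.mem_image, hhom, SetLike.mem_coe, hlev]
      constructor
      · rintro ⟨⟨hxT, hx⟩, hxt⟩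
        have h2 := hx.2
        rw [hxt] at h2
        refine ⟨_, ⟨h2, ?_⟩, ?_⟩ 
        · simp only [Set.mem_ofPred_eq, conePoint, add_sub_cancel_left]
          rwa [smul_smul, mul_inv_cancel₀ ht.1.ne', one_smul, add_sub_cancel]
        · simp only [conePoint, add_sub_cancel_left]
          rw [smul_smul, mul_inv_cancel₀ ht.1.ne', one_smul, add_sub_cancel]
      · rintro ⟨y, ⟨hy, hyT⟩, rfl⟩
        refine ⟨⟨hyT, (mem_coneSet_iff hh hA).2 ⟨t, ht, y, hy, rfl⟩⟩, ?_⟩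
        simp only [conePoint, add_sub_cancel_left]
        rw [inner_smul_right, hA y hy]
        field_simp
    rw [hset, euclideanHausdorffMeasure_homothety_image _ _ ht.1.ne', 
      ENNReal.ofReal_mul hh.le, mul_assoc]
    congr 1
    rw [ENNReal.smul_def, smul_eq_mul]
    congr 1
    rw [← ENNReal.ofReal_coe_nnreal]
    congr 1
    simp [abs_of_pos ht.1]
  · rw [Set.indicator_of_notMem ht]
    have : T ∩ coneSet x0 n h A ∩
        AffineSubspace.mk' (t • (h • n) +ᵥ x0) (Submodule.span ℝ {h • n})ᗮ = ∅ := by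
      ext x
      simp only [Set.mem_inter_iff, SetLike.mem_coe, hlev, Set.mem_empty_iff_false, iff_false]
      rintro ⟨⟨-, hx⟩, hxt⟩
      exact ht (hxt ▸ hx.1)
    rw [this, measure_empty, mul_zero]

theorem volume_coneSet {x0 n : Pt d} {h : ℝ} (hn : ‖n‖ = 1) (hh : 0 < h) {A : Set (Pt d)}
    (hAm : MeasurableSet A) (hA : ∀ y ∈ A, inner ℝ n (y - x0) = h) :
    volume (coneSet x0 n h A) =
      (∫⁻ t in Set.Ioc (0 : ℝ) 1, ENNReal.ofReal (h * t ^ (d - 1))) * μHE[d - 1] A := by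
  have := volume_inter_coneSet hn hh hAm hA MeasurableSet.univ
  rw [Set.univ_inter] at this
  rw [this, ← lintegral_mul_const'']
  · simp
  · fun_prop

/-- The slicing formula for all measurable sets, read as a pushforward of measures, is the change of
variables to the segment parameter and the base point. Fubini then applies to functions. -/
theorem map_conePoint {x0 n : Pt d} {h : ℝ} (hn : ‖n‖ = 1) (hh : 0 < h) {A : Set (Pt d)}
    (hAm : MeasurableSet A) (hA : ∀ y ∈ A, inner ℝ n (y - x0) = h) (hfin : μHE[d - 1] A ≠ ⊤) :
    (((volume.restrict (Set.Ioc (0 : ℝ) 1)).withDensity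
      fun t => ENNReal.ofReal (h * t ^ (d - 1))).prod (μHE[d - 1].restrict A)).map (conePoint x0)
      = volume.restrict (coneSet x0 n h A) := by
  have : IsFiniteMeasure (μHE[d - 1].restrict A) := ⟨by simpa [lt_top_iff_ne_top] using hfin⟩
  have hd : Measurable fun t : ℝ => ENNReal.ofReal (h * t ^ (d - 1)) := by fun_prop
  ext T hT
  rw [Measure.map_apply (measurable_conePoint x0) hT, Measure.restrict_apply hT,
    volume_inter_coneSet hn hh hAm hA hT, Measure.prod_apply (measurable_conePoint x0 hT),
    lintegral_withDensity_eq_lintegral_mul _ hd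
      (measurable_measure_prodMk_left (measurable_conePoint x0 hT))]
  refine lintegral_congr fun t => ?_
  simp only [Pi.mul_apply]
  rw [Measure.restrict_apply (measurable_prodMk_left (measurable_conePoint x0 hT)), Set.inter_comm]
  rfl

theorem setIntegral_coneSet {x0 n : Pt d} {h : ℝ} (hn : ‖n‖ = 1) (hh : 0 < h) {A : Set (Pt d)}
    (hAm : MeasurableSet A) (hA : ∀ y ∈ A, inner ℝ n (y - x0) = h) (hfin : μHE[d - 1] A ≠ ⊤)
    {f : Pt d → ℝ} (hf : IntegrableOn f (coneSet x0 n h A)) :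
    ∫ x in coneSet x0 n h A, f x
      = ∫ y in A, (∫ t in (0 : ℝ)..1, h * t ^ (d - 1) * f (conePoint x0 (t, y))) ∂μHE[d - 1] := by
  have : IsFiniteMeasure (μHE[d - 1].restrict A) := ⟨by simpa [lt_top_iff_ne_top] using hfin⟩
  have hd : Measurable fun t : ℝ => ENNReal.ofReal (h * t ^ (d - 1)) := by fun_prop
  have hm := map_conePoint hn hh hAm hA hfin
  have hf' := hf
  unfold IntegrableOn at hf'
  rw [← hm] at hf' ⊢
  rw [integral_map (measurable_conePoint x0).aemeasurable hf'.1,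
    integral_prod_symm (fun p => f (conePoint x0 p))
      (hf'.comp_measurable (measurable_conePoint x0))]
  refine integral_congr_ae (ae_of_all _ fun y => ?_)
  simp only
  rw [integral_withDensity_eq_integral_toReal_smul hd (ae_of_all _ fun t => ENNReal.ofReal_lt_top),
    intervalIntegral.integral_of_le zero_le_one]
  refine setIntegral_congr_fun measurableSet_Ioc fun t ht => ?_
  simp only [smul_eq_mul]
  rw [ENNReal.toReal_ofReal]
  have := ht.1
  positivity

/-- The sets `A i` make up the boundary of the convex body `K`, up to overlaps of measure zero, and
`K` lies on the inner side of the hyperplane through each `A i` with unit normal `n i`. -/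
structure IsFacetFamily {ι : Type*} (K : Set (Pt d)) (A : ι → Set (Pt d)) (n : ι → Pt d) :
    Prop where
  isCompact : IsCompact K
  convex : Convex ℝ K
  measurableSet : ∀ i, MeasurableSet (A i)
  nonempty : ∀ i, (A i).Nonempty
  subset_frontier : ∀ i, A i ⊆ frontier K
  norm_normal : ∀ i, ‖n i‖ = 1
  inner_nonpos : ∀ i, ∀ x ∈ A i, ∀ y ∈ K, inner ℝ (n i) (y - x) ≤ 0
  cover : frontier K ⊆ ⋃ i, A i
  overlap : ∀ i j, i ≠ j → μHE[d - 1] (A i ∩ A j) = 0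

namespace IsFacetFamily

variable {ι : Type*} {K : Set (Pt d)} {A : ι → Set (Pt d)} {n : ι → Pt d}

theorem subset (hK : IsFacetFamily K A n) (i : ι) : A i ⊆ K :=
  (hK.subset_frontier i).trans hK.isCompact.isClosed.frontier_subset

/-- Two points of one facet each lie on the inner side of the hyperplane through the other, so their
heights agree. A ball around `x0` inside `K` allows a step in the direction `n i`, which makes the
height positive. -/
theorem exists_height (hK : IsFacetFamily K A n) {x0 : Pt d} (hx0 : x0 ∈ interior K) :
    ∃ h : ι → ℝ, (∀ i, 0 < h i) ∧ ∀ i, ∀ y ∈ A i, inner ℝ (n i) (y - x0) = h i := by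
  choose p hp using hK.nonempty
  refine ⟨fun i => inner ℝ (n i) (p i - x0), fun i => ?_, fun i y hy => ?_⟩
  · obtain ⟨ε, hε, hb⟩ := Metric.isOpen_iff.1 isOpen_interior x0 hx0
    have h1 : x0 + (ε / 2) • n i ∈ K := by
      refine interior_subset (hb ?_)
      rw [mem_ball_iff_norm, add_sub_cancel_left, norm_smul, hK.norm_normal i,
        Real.norm_of_nonneg (by positivity)]
      linarith
    have h2 := hK.inner_nonpos i _ (hp i) _ h1
    have e : x0 + (ε / 2) • n i - p i = (ε / 2) • n i - (p i - x0) := by abel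
    rw [e, inner_sub_right, inner_smul_right, real_inner_self_eq_norm_sq, hK.norm_normal i] at h2
    linarith
  · have h1 := hK.inner_nonpos i _ (hp i) _ (hK.subset i hy)
    have h2 := hK.inner_nonpos i _ hy _ (hK.subset i (hp i))
    simp only [inner_sub_right] at *
    linarith

theorem coneSet_subset (hK : IsFacetFamily K A n) {x0 : Pt d} (hx0 : x0 ∈ interior K) {h : ι → ℝ}
    (hpos : ∀ i, 0 < h i) (hA : ∀ i, ∀ y ∈ A i, inner ℝ (n i) (y - x0) = h i) (i : ι) :
    coneSet x0 (n i) (h i) (A i) ⊆ K := by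
  intro x hx
  obtain ⟨t, ht, y, hy, rfl⟩ := (mem_coneSet_iff (hpos i) (hA i)).1 hx
  exact hK.convex.add_smul_sub_mem (interior_subset hx0) (hK.subset i hy) ⟨ht.1.le, ht.2⟩

end IsFacetFamily

/-- The Minkowski functional of `K` centred at `x0` is `1` on the frontier, so by homogeneity it
recovers the segment parameter. This gives uniqueness of the radial representation. -/
theorem gauge_conePoint_sub {K : Set (Pt d)} (hKx : Convex ℝ K) {x0 : Pt d}
    (hx0 : x0 ∈ interior K) {y : Pt d} (hy : y ∈ frontier K) {t : ℝ} (ht : 0 ≤ t) :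
    gauge ((fun z => x0 + z) ⁻¹' K) (conePoint x0 (t, y) - x0) = t := by
  have h0 : (fun z => x0 + z) ⁻¹' K ∈ nhds (0 : Pt d) :=
    (continuous_const.add continuous_id).continuousAt.preimage_mem_nhds
      (by simpa using mem_interior_iff_mem_nhds.1 hx0)
  have hc : Convex ℝ ((fun z => x0 + z) ⁻¹' K) := hKx.translate_preimage_right x0
  have hf : y - x0 ∈ frontier ((fun z => x0 + z) ⁻¹' K) := by
    have := (Homeomorph.addLeft x0).preimage_frontier K
    change (fun z => x0 + z) ⁻¹' frontier K = frontier ((fun z => x0 + z) ⁻¹' K) at this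
    rw [← this]
    simpa using hy
  simp only [conePoint, add_sub_cancel_left]
  rw [gauge_smul_of_nonneg ht, (gauge_eq_one_iff_mem_frontier hc h0).2 hf, smul_eq_mul, mul_one]

/-- Take the Minkowski functional of `x - x0` as the parameter. Boundedness of `K` makes it positive
away from `x0`, and dividing by it reaches the frontier. -/
theorem exists_conePoint_eq {K : Set (Pt d)} (hKc : IsCompact K) (hKx : Convex ℝ K) {x0 : Pt d}
    (hx0 : x0 ∈ interior K) {x : Pt d} (hx : x ∈ K) (hne : x ≠ x0) :
    ∃ t ∈ Set.Ioc (0 : ℝ) 1, ∃ y ∈ frontier K, conePoint x0 (t, y) = x := by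
  set K' : Set (Pt d) := (fun z => x0 + z) ⁻¹' K with hK'
  have h0 : K' ∈ nhds (0 : Pt d) :=
    (continuous_const.add continuous_id).continuousAt.preimage_mem_nhds
      (by simpa using mem_interior_iff_mem_nhds.1 hx0)
  have hc : Convex ℝ K' := hKx.translate_preimage_right x0
  have hKc' : IsCompact K' := (Homeomorph.addLeft x0).isClosedEmbedding.isCompact_preimage hKc
  have hb : Bornology.IsVonNBounded ℝ K' := NormedSpace.isVonNBounded_of_isBounded _ hKc'.isBounded
  have hpos : 0 < gauge K' (x - x0) :=
    (gauge_pos (absorbent_nhds_zero h0) hb).2 (sub_ne_zero.2 hne)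
  have hle : gauge K' (x - x0) ≤ 1 := gauge_le_one_of_mem (by simpa [hK'] using hx)
  refine ⟨_, ⟨hpos, hle⟩, x0 + (gauge K' (x - x0))⁻¹ • (x - x0), ?_, ?_⟩
  · have h1 : gauge K' ((gauge K' (x - x0))⁻¹ • (x - x0)) = 1 := by
      rw [gauge_smul_of_nonneg (inv_nonneg.2 hpos.le), smul_eq_mul, inv_mul_cancel₀ hpos.ne']
    have h2 := (gauge_eq_one_iff_mem_frontier hc h0).1 h1
    have := (Homeomorph.addLeft x0).preimage_frontier K
    change (fun z => x0 + z) ⁻¹' frontier K = frontier K' at this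
    rw [← this] at h2
    exact h2
  · simp only [conePoint, add_sub_cancel_left]
    rw [smul_smul, mul_inv_cancel₀ hpos.ne', one_smul, add_sub_cancel]

/-! ### Decomposition of a convex body into cones over its facets, and the divergence theorem. -/

namespace IsFacetFamily

variable {ι : Type*} {K : Set (Pt d)} {A : ι → Set (Pt d)} {n : ι → Pt d}

theorem diff_subset_iUnion_coneSet (hK : IsFacetFamily K A n) {x0 : Pt d} (hx0 : x0 ∈ interior K)
    {h : ι → ℝ} (hpos : ∀ i, 0 < h i) (hA : ∀ i, ∀ y ∈ A i, inner ℝ (n i) (y - x0) = h i) :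
    K \ {x0} ⊆ ⋃ i, coneSet x0 (n i) (h i) (A i) := by
  rintro x ⟨hx, hne⟩
  obtain ⟨t, ht, y, hy, rfl⟩ := exists_conePoint_eq hK.isCompact hK.convex hx0 hx hne
  obtain ⟨i, hi⟩ := Set.mem_iUnion.1 (hK.cover hy)
  exact Set.mem_iUnion.2 ⟨i, (mem_coneSet_iff (hpos i) (hA i)).2 ⟨t, ht, y, hi, rfl⟩⟩

/-- A point common to two cones has the same Minkowski functional in both, hence the same frontier
point. It lies in the cone over `A i ∩ A j`, which is null because its base is null. -/
theorem aedisjoint_coneSet (hK : IsFacetFamily K A n) {x0 : Pt d} (hx0 : x0 ∈ interior K)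
    {h : ι → ℝ} (hpos : ∀ i, 0 < h i) (hA : ∀ i, ∀ y ∈ A i, inner ℝ (n i) (y - x0) = h i) :
    Pairwise (Function.onFun (AEDisjoint volume) fun i => coneSet x0 (n i) (h i) (A i)) := by
  intro i j hij
  have hsub : coneSet x0 (n i) (h i) (A i) ∩ coneSet x0 (n j) (h j) (A j)
      ⊆ coneSet x0 (n i) (h i) (A i ∩ A j) := by
    rintro x ⟨hxi, hxj⟩
    obtain ⟨t, ht, y, hy, rfl⟩ := (mem_coneSet_iff (hpos i) (hA i)).1 hxi
    obtain ⟨s, hs, z, hz, hzy⟩ := (mem_coneSet_iff (hpos j) (hA j)).1 hxj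
    have h1 := gauge_conePoint_sub hK.convex hx0 (hK.subset_frontier i hy) ht.1.le
    have h2 := gauge_conePoint_sub hK.convex hx0 (hK.subset_frontier j hz) hs.1.le
    rw [hzy, h1] at h2
    subst h2
    have hyz : z = y := by
      have h3 : t • (z - x0) = t • (y - x0) := add_left_cancel hzy
      exact sub_left_injective (smul_right_injective _ ht.1.ne' h3)
    subst hyz
    exact (mem_coneSet_iff (hpos i) fun w hw => hA i w hw.1).2 ⟨t, ht, z, ⟨hy, hz⟩, rfl⟩
  refine measure_mono_null hsub ?_
  rw [volume_coneSet (hK.norm_normal i) (hpos i)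
    ((hK.measurableSet i).inter (hK.measurableSet j)) fun w hw => hA i w hw.1,
    hK.overlap i j hij, mul_zero]

/-- Finite area is deduced: the cone over the facet lies in a compact set, and its volume is a
strictly positive multiple of the area. -/
theorem measure_ne_top (hK : IsFacetFamily K A n) (hint : (interior K).Nonempty) (i : ι) :
    μHE[d - 1] (A i) ≠ ⊤ := by
  obtain ⟨x0, hx0⟩ := hint
  obtain ⟨h, hpos, hA⟩ := hK.exists_height hx0
  have h1 := volume_coneSet (hK.norm_normal i) (hpos i) (hK.measurableSet i) (hA i)
  have h2 : volume (coneSet x0 (n i) (h i) (A i)) < ⊤ :=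
    (measure_mono (hK.coneSet_subset hx0 hpos hA i)).trans_lt hK.isCompact.measure_lt_top
  intro h3
  rw [h1, h3, ENNReal.mul_top] at h2
  · exact lt_irrefl _ h2
  · rw [Ne, lintegral_eq_zero_iff (by fun_prop), Filter.EventuallyEq,
      ae_restrict_iff' measurableSet_Ioc]
    intro h4
    have h5 : volume (Set.Ioc (0 : ℝ) 1) = 0 := by
      refine measure_mono_null (fun t ht => ?_) h4
      simp only [Set.mem_compl_iff, Set.mem_ofPred_eq, Classical.not_imp]
      refine ⟨ht, ?_⟩
      have := hpos i
      have := ht.1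
      simp only [Pi.zero_apply, ENNReal.ofReal_eq_zero, not_le]
      positivity
    simp at h5

theorem setIntegral_eq_sum (hd : 1 ≤ d) [Fintype ι] (hK : IsFacetFamily K A n) {x0 : Pt d}
    (hx0 : x0 ∈ interior K) {f : Pt d → ℝ}
    (hf : IntegrableOn f K) {h : ι → ℝ} (hpos : ∀ i, 0 < h i)
    (hA : ∀ i, ∀ y ∈ A i, inner ℝ (n i) (y - x0) = h i) :
    ∫ x in K, f x = ∑ i, ∫ y in A i,
      (∫ t in (0 : ℝ)..1, h i * t ^ (d - 1) * f (conePoint x0 (t, y))) ∂μHE[d - 1] := by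
  have hsub : (⋃ i, coneSet x0 (n i) (h i) (A i)) ⊆ K :=
    Set.iUnion_subset fun i => hK.coneSet_subset hx0 hpos hA i
  -- In positive dimension a single point is null. The apex `x0` is the only point of `K` that the
  -- cones may miss.
  have : Nonempty (Fin d) := ⟨⟨0, hd⟩⟩
  have hae : (⋃ i, coneSet x0 (n i) (h i) (A i)) =ᵐ[volume] K := by
    refine (LE.le.eventuallyLE hsub).antisymm ?_
    have h1 : K ≤ᵐ[volume] (K \ {x0} : Set (Pt d)) :=
      (sdiff_null_ae_eq_self (measure_singleton x0)).symm.le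
    exact h1.trans (LE.le.eventuallyLE (hK.diff_subset_iUnion_coneSet hx0 hpos hA))
  rw [← setIntegral_congr_set hae, integral_iUnion_ae
    (fun i => (measurableSet_coneSet _ _ _ (hK.measurableSet i)).nullMeasurableSet)
    (hK.aedisjoint_coneSet hx0 hpos hA) (hf.mono_set hsub), tsum_fintype]
  exact Finset.sum_congr rfl fun i _ => setIntegral_coneSet (hK.norm_normal i) (hpos i)
    (hK.measurableSet i) (hA i) (hK.measure_ne_top ⟨x0, hx0⟩ i)
    (hf.mono_set (hK.coneSet_subset hx0 hpos hA i))

/-- The divergence theorem for the radial field `x ↦ f x • (x - x0)`. -/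
theorem integral_radial (hd : 1 ≤ d) [Fintype ι] (hK : IsFacetFamily K A n) {x0 : Pt d}
    (hx0 : x0 ∈ interior K) {f : Pt d → ℝ} {f' : Pt d → Pt d →L[ℝ] ℝ}
    (hf : ∀ x ∈ K, HasFDerivAt f (f' x) x) (hf' : ContinuousOn f' K) :
    ∫ x in K, (d * f x + f' x (x - x0))
      = ∑ i, ∫ y in A i, inner ℝ (n i) (y - x0) * f y ∂μHE[d - 1] := by
  obtain ⟨h, hpos, hA⟩ := hK.exists_height hx0
  have hfc : ContinuousOn f K := fun x hx => (hf x hx).continuousAt.continuousWithinAt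
  have hcont : ContinuousOn (fun x => d * f x + f' x (x - x0)) K :=
    (continuousOn_const.mul hfc).add (hf'.clm_apply (by fun_prop))
  rw [hK.setIntegral_eq_sum hd hx0 (hcont.integrableOn_compact hK.isCompact) hpos hA]
  refine Finset.sum_congr rfl fun i _ => setIntegral_congr_fun (hK.measurableSet i) fun y hy => ?_
  rw [hA i y hy]
  have hyK := hK.subset i hy
  have hmem : ∀ t ∈ Set.uIcc (0 : ℝ) 1, conePoint x0 (t, y) ∈ K := fun t ht => by
    rw [Set.uIcc_of_le zero_le_one] at ht
    exact hK.convex.add_smul_sub_mem (interior_subset hx0) hyK ht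
  have hcp : Continuous fun t : ℝ => conePoint x0 (t, y) := by unfold conePoint; fun_prop
  -- The Jacobian factor `t ^ (d - 1)` makes the integrand the exact derivative of `h t ^ d f` along
  -- the ray. The endpoint `t = 1` gives the facet value, and the endpoint `t = 0` vanishes since `d
  -- ≥ 1`.
  have hder : ∀ t ∈ Set.uIcc (0 : ℝ) 1, HasDerivAt (fun t => h i * (t ^ d * f (conePoint x0 (t, y))))
      (h i * t ^ (d - 1) * (d * f (conePoint x0 (t, y))
        + f' (conePoint x0 (t, y)) (conePoint x0 (t, y) - x0))) t := by
    intro t ht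
    have h1 : HasDerivAt (fun t : ℝ => conePoint x0 (t, y)) (y - x0) t := by
      have := ((hasDerivAt_id t).smul_const (y - x0)).const_add x0
      simpa [conePoint] using this
    have h2 := (hf _ (hmem t ht)).comp_hasDerivAt t h1
    have h3 := ((hasDerivAt_pow d t).mul h2).const_mul (h i)
    refine h3.congr_deriv ?_
    have h4 : conePoint x0 (t, y) - x0 = t • (y - x0) := by simp [conePoint]
    rw [h4, map_smul, smul_eq_mul]
    obtain ⟨e, rfl⟩ : ∃ e, d = e + 1 := ⟨d - 1, by omega⟩
    simp only [Nat.add_sub_cancel, Function.comp]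
    ring
  have hci : ContinuousOn (fun t => h i * t ^ (d - 1) * (d * f (conePoint x0 (t, y))
        + f' (conePoint x0 (t, y)) (conePoint x0 (t, y) - x0))) (Set.uIcc (0 : ℝ) 1) :=
    (by fun_prop : Continuous fun t : ℝ => h i * t ^ (d - 1)).continuousOn.mul
      (hcont.comp hcp.continuousOn hmem)
  rw [intervalIntegral.integral_eq_sub_of_hasDerivAt hder hci.intervalIntegrable]
  have h0 : (0 : ℝ) ^ d = 0 := zero_pow (by omega)
  simp [h0, conePoint]

theorem integrableOn_facet (hK : IsFacetFamily K A n) (hint : (interior K).Nonempty) (i : ι)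
    {f : Pt d → ℝ} (hf : ContinuousOn f K) : IntegrableOn f (A i) μHE[d - 1] := by
  obtain ⟨C, hC⟩ := hK.isCompact.exists_bound_of_continuousOn hf
  exact IntegrableOn.of_bound (hK.measure_ne_top hint i).lt_top
    ((hf.mono (hK.subset i)).aestronglyMeasurable (hK.measurableSet i)) C
    ((ae_restrict_iff' (hK.measurableSet i)).2 (ae_of_all _ fun x hx => hC x (hK.subset i hx)))

/-- The divergence theorem for a convex body whose boundary consists of flat pieces. -/
theorem integral_fderiv (hd : 1 ≤ d) [Fintype ι] (hK : IsFacetFamily K A n)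
    (hint : (interior K).Nonempty) {f : Pt d → ℝ} {f' : Pt d → Pt d →L[ℝ] ℝ}
    (hf : ∀ x ∈ K, HasFDerivAt f (f' x) x) (hf' : ContinuousOn f' K) (e : Pt d) :
    ∫ x in K, f' x e = ∑ i, ∫ y in A i, inner ℝ (n i) e * f y ∂μHE[d - 1] := by
  obtain ⟨x0, hx0⟩ := hint
  have hfc : ContinuousOn f K := fun x hx => (hf x hx).continuousAt.continuousWithinAt
  -- The radial fields centred at `x0` and at `x0 + c • e` differ by a constant multiple of `e`.
  -- Subtracting the two radial identities isolates the derivative in the direction `e`; both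
  -- centres must be interior.
  obtain ⟨c, hc, hc0⟩ : ∃ c : ℝ, x0 + c • e ∈ interior K ∧ c ≠ 0 := by
    have h1 : Filter.Tendsto (fun c : ℝ => x0 + c • e) (nhdsWithin 0 {0}ᶜ) (nhds x0) := by
      have : Continuous fun c : ℝ => x0 + c • e := by fun_prop
      have := this.tendsto 0
      simp only [zero_smul, add_zero] at this
      exact this.mono_left nhdsWithin_le_nhds
    have h2 := h1.eventually (isOpen_interior.mem_nhds hx0)
    exact (h2.and self_mem_nhdsWithin).exists
  have hint : ∀ z, IntegrableOn (fun x => d * f x + f' x (x - z)) K := fun z =>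
    ((continuousOn_const.mul hfc).add (hf'.clm_apply (by fun_prop))).integrableOn_compact
      hK.isCompact
  have e1 := hK.integral_radial hd hx0 hf hf'
  have e2 := hK.integral_radial hd hc hf hf'
  have e3 : c * ∫ x in K, f' x e
      = (∫ x in K, (d * f x + f' x (x - x0))) - ∫ x in K, (d * f x + f' x (x - (x0 + c • e))) := by
    rw [← integral_sub (hint _) (hint _), ← integral_const_mul]
    refine integral_congr_ae (ae_of_all _ fun x => ?_)
    simp only [map_sub, map_add, map_smul, smul_eq_mul]
    ring
  have e4 : ∀ z i, IntegrableOn (fun y => inner ℝ (n i) (y - z) * f y) (A i) μHE[d - 1] :=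
    fun z i => hK.integrableOn_facet ⟨x0, hx0⟩ i
      ((by fun_prop : Continuous fun y => inner ℝ (n i) (y - z)).continuousOn.mul hfc)
  refine mul_left_cancel₀ hc0 ?_
  rw [e3, e1, e2, ← Finset.sum_sub_distrib, Finset.mul_sum]
  refine Finset.sum_congr rfl fun i _ => ?_
  rw [← integral_sub (e4 _ i) (e4 _ i), ← integral_const_mul]
  refine integral_congr_ae (ae_of_all _ fun x => ?_)
  simp only [inner_sub_right, inner_add_right, inner_smul_right]
  ring

end IsFacetFamily

/-! ### Polynomial functions -/

/-- The bound `k` is enough, because gradients are tested in a space of the same degree as the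
functions themselves. -/
theorem pderiv_mem_restrictTotalDegree {n k : ℕ} (l : Fin n) {P : MvPolynomial (Fin n) ℝ}
    (hP : P.totalDegree ≤ k) : (MvPolynomial.pderiv l P).totalDegree ≤ k := by
  rw [← MvPolynomial.mem_restrictTotalDegree, P.as_sum, map_sum]
  refine Submodule.sum_mem _ fun s hs => ?_
  rw [MvPolynomial.pderiv_monomial, MvPolynomial.mem_restrictTotalDegree]
  refine (MvPolynomial.totalDegree_monomial_le _ _).trans
    (le_trans ?_ ((MvPolynomial.le_totalDegree hs).trans hP))
  rw [Finsupp.sum_fintype _ _ (fun _ => rfl), Finsupp.sum_fintype _ _ (fun _ => rfl)]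
  exact Finset.sum_le_sum fun i _ => by simp

theorem hasFDerivAt_eval {n : ℕ} (P : MvPolynomial (Fin n) ℝ) (x : Pt n) :
    HasFDerivAt (fun x : Pt n => MvPolynomial.eval (fun i => x i) P)
      (∑ l, MvPolynomial.eval (fun i => x i) (MvPolynomial.pderiv l P) •
        (EuclideanSpace.proj l : Pt n →L[ℝ] ℝ)) x := by
  induction P using MvPolynomial.induction_on with
  | C a => simpa using hasFDerivAt_const a x
  | add p q hp hq =>
    have := hp.add hq
    simp only [map_add]
    refine this.congr_fderiv ?_
    simp only [add_smul, Finset.sum_add_distrib]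
  | mul_X p j hp =>
    have hj : HasFDerivAt (fun x : Pt n => x j) (EuclideanSpace.proj j : Pt n →L[ℝ] ℝ) x :=
      (EuclideanSpace.proj j : Pt n →L[ℝ] ℝ).hasFDerivAt
    simp only [map_mul, MvPolynomial.eval_X]
    refine (hp.mul hj).congr_fderiv ?_
    ext e
    simp only [Derivation.leibniz, smul_eq_mul, map_add, map_mul, MvPolynomial.eval_X,
      MvPolynomial.pderiv_X, add_apply, smul_apply,
      sum_apply, add_mul, Finset.sum_add_distrib, Finset.mul_sum]
    congr 1
    · rw [Finset.sum_eq_single j]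
      · simp
      · intro l _ hl
        simp [hl]
      · simp
    · exact Finset.sum_congr rfl fun l _ => by ring

theorem contDiff_eval {n : ℕ} (P : MvPolynomial (Fin n) ℝ) :
    ContDiff ℝ 1 (fun x : Pt n => MvPolynomial.eval (fun i => x i) P) := by
  induction P using MvPolynomial.induction_on with
  | C a => simpa using contDiff_const
  | add p q hp hq => simpa using hp.add hq
  | mul_X p j hp =>
    have hj : ContDiff ℝ 1 (fun x : Pt n => x j) :=
      (EuclideanSpace.proj j : Pt n →L[ℝ] ℝ).contDiff
    simpa using hp.mul hj

namespace IsPoly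

theorem contDiff {n k : ℕ} {f : Pt n → ℝ} (hf : IsPoly k f) : ContDiff ℝ 1 f := by
  obtain ⟨P, -, hP⟩ := hf
  rw [funext hP]
  exact contDiff_eval P

theorem const {n k : ℕ} (c : ℝ) : IsPoly k fun _ : Pt n => c :=
  ⟨MvPolynomial.C c, by simp, fun x => by simp⟩

theorem fderiv_apply {n k : ℕ} {f : Pt n → ℝ} (hf : IsPoly k f) (e : Pt n) :
    IsPoly k fun x => fderiv ℝ f x e := by
  obtain ⟨P, hk, hP⟩ := hf
  refine ⟨∑ l, MvPolynomial.C (e l) * MvPolynomial.pderiv l P, ?_, fun x => ?_⟩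
  · rw [← MvPolynomial.mem_restrictTotalDegree]
    refine Submodule.sum_mem _ fun l _ => ?_
    rw [← MvPolynomial.smul_eq_C_mul]
    exact Submodule.smul_mem _ _ ((MvPolynomial.mem_restrictTotalDegree _ _ _).2
      (pderiv_mem_restrictTotalDegree l hk))
  · simp only [funext hP]
    rw [(hasFDerivAt_eval P x).fderiv]
    simp only [sum_apply, smul_apply,
      PiLp.proj_apply, smul_eq_mul, map_sum, map_mul, MvPolynomial.eval_C]
    exact Finset.sum_congr rfl fun l _ => mul_comm _ _

end IsPoly

/-- The interior contains a box of infinite coordinate sets, and a polynomial vanishing on such a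
box is zero. -/
theorem eq_zero_of_eval_eq_zero {n : ℕ} {S : Set (Pt n)} (hS : (interior S).Nonempty)
    {P : MvPolynomial (Fin n) ℝ} (hP : ∀ x ∈ S, MvPolynomial.eval (fun i => x i) P = 0) :
    P = 0 := by
  obtain ⟨x0, hx0⟩ := hS
  have hopen : IsOpen ((WithLp.toLp 2 : (Fin n → ℝ) → Pt n) ⁻¹' interior S) :=
    isOpen_interior.preimage (PiLp.continuous_toLp 2 _)
  obtain ⟨u, hu, hsub⟩ := isOpen_pi_iff'.1 hopen (fun i => x0 i) hx0
  refine MvPolynomial.funext_set u (fun i => infinite_of_mem_nhds _ ((hu i).1.mem_nhds (hu i).2))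
    fun x hx => ?_
  rw [map_zero]
  exact hP _ (interior_subset (hsub hx))

/-- Interpolation of polynomial functions from finitely many points of a set with interior. -/
theorem exists_interpolation {n : ℕ} (k : ℕ) {S : Set (Pt n)} (hS : (interior S).Nonempty) :
    ∃ (ι : Type) (_ : Fintype ι) (p : ι → Pt n) (L : ι → Pt n → ℝ), (∀ a, p a ∈ S) ∧
      (∀ a, IsPoly k (L a)) ∧ ∀ f, IsPoly k f → ∀ x, f x = ∑ a, f (p a) * L a x := by
  classical
  let W := MvPolynomial.restrictTotalDegree (Fin n) ℝ k
  let ev : Pt n → Module.Dual ℝ W := fun x =>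
    (MvPolynomial.aeval (R := ℝ) (fun i => x i)).toLinearMap ∘ₗ W.subtype
  have hev : ∀ x w, ev x w = MvPolynomial.eval (fun i => x i) w.1 := fun x w => by
    simp [ev]
  -- A polynomial killed by all evaluations at points of `S` vanishes on `S`, hence is zero. In
  -- finite dimension the evaluations therefore span the dual space, and a basis can be selected
  -- among them.
  have hspan : Submodule.span ℝ (ev '' S) = ⊤ := by
    have h1 : (Submodule.span ℝ (ev '' S)).dualCoannihilator = ⊥ := by
      rw [eq_bot_iff]
      intro w hw
      rw [Submodule.mem_dualCoannihilator] at hw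
      have : w.1 = 0 := eq_zero_of_eval_eq_zero hS fun x hx => by
        rw [← hev]
        exact hw _ (Submodule.subset_span ⟨x, hx, rfl⟩)
      exact Subtype.ext this
    rw [← Subspace.dualCoannihilator_dualAnnihilator_eq (W := Submodule.span ℝ (ev '' S)), h1,
      Submodule.dualAnnihilator_bot]
  obtain ⟨b, hbS, hbspan, hbli⟩ := exists_linearIndependent ℝ (ev '' S)
  rw [hspan] at hbspan
  have hbfin : b.Finite := hbli.setFinite
  have hchoose : ∀ β : b, ∃ x ∈ S, ev x = β := fun β => hbS β.2
  choose p hpS hp using hchoose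
  -- Sampling at the selected points is injective. A left inverse `G`, applied to the unit vectors,
  -- yields the interpolation functions.
  let Ψ : W →ₗ[ℝ] (b → ℝ) := LinearMap.pi fun β => (β : Module.Dual ℝ W)
  have hker : LinearMap.ker Ψ = ⊥ := by
    rw [LinearMap.ker_eq_bot']
    intro w hw
    rw [← Module.forall_dual_apply_eq_zero_iff ℝ]
    intro φ
    have hφ : φ ∈ Submodule.span ℝ b := by rw [hbspan]; trivial
    induction hφ using Submodule.span_induction with
    | mem x hx => exact congrFun hw ⟨x, hx⟩
    | zero => rfl
    | add x y _ _ hx hy => rw [LinearMap.add_apply, hx, hy, add_zero]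
    | smul c x _ hx => rw [LinearMap.smul_apply, hx, smul_zero]
  obtain ⟨G, hG⟩ := Ψ.exists_leftInverse_of_injective hker
  have : Fintype b := hbfin.fintype
  have hbig : ∃ (ι : Type) (_ : Fintype ι), Nonempty (ι ≃ b) :=
    ⟨Fin (Fintype.card b), inferInstance, ⟨(Fintype.equivFin b).symm⟩⟩
  obtain ⟨ι, _, ⟨eqv⟩⟩ := hbig
  refine ⟨ι, inferInstance, fun a => p (eqv a), fun a x => MvPolynomial.eval (fun i => x i)
    (G (Pi.single (eqv a) 1)).1, fun a => hpS _, fun a => ⟨_,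
      (MvPolynomial.mem_restrictTotalDegree _ _ _).1 (G (Pi.single (eqv a) 1)).2, fun _ => rfl⟩, ?_⟩
  rintro f ⟨P, hk, hP⟩ x
  let w : W := ⟨P, (MvPolynomial.mem_restrictTotalDegree _ _ _).2 hk⟩
  have h1 : w = ∑ β : b, (β : Module.Dual ℝ W) w • G (Pi.single β 1) := by
    have h2 : Ψ w = ∑ β : b, (β : Module.Dual ℝ W) w • (Pi.single β 1 : b → ℝ) := by
      funext β
      simp [Ψ, Finset.sum_apply, Pi.single_apply]
    calc w = G (Ψ w) := (LinearMap.congr_fun hG w).symm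
      _ = _ := by rw [h2, map_sum]; simp only [map_smul]
  have h3 : P = ∑ β : b, (β : Module.Dual ℝ W) w • (G (Pi.single β 1)).1 := by
    have := congrArg Subtype.val h1
    simpa using this
  have h4 : f x = MvPolynomial.eval (fun i => x i)
      (∑ β : b, (β : Module.Dual ℝ W) w • (G (Pi.single β 1)).1) := by rw [hP, ← h3]
  rw [h4, map_sum, ← eqv.sum_comp]
  refine Finset.sum_congr rfl fun a _ => ?_
  rw [MvPolynomial.smul_eval, ← hp (eqv a), hev, hP]

/-! ### Elements, faces and the divergence theorem on the mesh -/

namespace PeriodicMesh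

variable (M : PeriodicMesh d)

/-- The inverse of the parametric mapping of an element, as a continuous affine map. -/
def psiInv (K : M.Elem) : Pt d →ᴬ[ℝ] Pt d :=
  ⟨(M.psi K).symm.toAffineMap, AffineMap.continuous_of_finiteDimensional _⟩

theorem psiInv_psi (K : M.Elem) (x : Pt d) : M.psiInv K (M.psi K x) = x :=
  (M.psi K).symm_apply_apply x

theorem psi_psiInv (K : M.Elem) (x : Pt d) : M.psi K (M.psiInv K x) = x :=
  (M.psi K).apply_symm_apply x

theorem continuous_psi (K : M.Elem) : Continuous (M.psi K) :=
  AffineMap.continuous_of_finiteDimensional (M.psi K).toAffineMap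

theorem isCompact_elemSet (K : M.Elem) : IsCompact (M.elemSet K) := by
  obtain ⟨s, hs⟩ := M.refElem_polytope
  refine IsCompact.image ?_ (M.continuous_psi K)
  rw [hs]
  exact s.finite_toSet.isCompact_convexHull (𝕜 := ℝ)

theorem convex_elemSet (K : M.Elem) : Convex ℝ (M.elemSet K) := by
  obtain ⟨s, hs⟩ := M.refElem_polytope
  refine Convex.affine_image (M.psi K).toAffineMap ?_
  rw [hs]
  exact convex_convexHull ℝ _

/-- The parametric mapping of an element as a homeomorphism. -/
def psiHomeo (K : M.Elem) : Pt d ≃ₜ Pt d where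
  toEquiv := (M.psi K).toEquiv
  continuous_toFun := M.continuous_psi K
  continuous_invFun := (M.psiInv K).continuous

theorem interior_elemSet_nonempty (K : M.Elem) : (interior (M.elemSet K)).Nonempty := by
  have h : interior (M.elemSet K) = M.psiHomeo K '' interior M.refElem :=
    ((M.psiHomeo K).image_interior M.refElem).symm
  rw [h]
  exact M.refElem_interior.image _

theorem measurableSet_elemSet (K : M.Elem) : MeasurableSet (M.elemSet K) :=
  (M.isCompact_elemSet K).measurableSet

theorem isCompact_faceSet (F : M.Face) : IsCompact (M.faceSet F) := by
  obtain ⟨s, hs⟩ := M.refFace_polytope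
  refine IsCompact.image ?_ (AffineMap.continuous_of_finiteDimensional (M.phi F))
  rw [hs]
  exact s.finite_toSet.isCompact_convexHull (𝕜 := ℝ)

theorem measurableSet_faceSet (F : M.Face) : MeasurableSet (M.faceSet F) :=
  (M.isCompact_faceSet F).measurableSet

theorem faceSet_nonempty (F : M.Face) : (M.faceSet F).Nonempty :=
  (M.refFace_interior.mono interior_subset).image _

theorem norm_outNormal (F : M.Face) (s : Bool) : ‖M.outNormal F s‖ = 1 := by
  cases s <;> simp [outNormal, M.normal_norm F]

theorem add_offset_mem_frontier {F : M.Face} {x : Pt d} (hx : x ∈ M.faceSet F) (s : Bool) :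
    x + M.offset F s ∈ frontier (M.elemSet (M.side F s)) := by
  have h := hx
  rw [faceSet, M.face_eq F] at h
  cases s
  · exact h.2
  · simp only [offset, if_true, add_zero]
    exact h.1

theorem add_offset_mem_elemSet {F : M.Face} {x : Pt d} (hx : x ∈ M.faceSet F) (s : Bool) :
    x + M.offset F s ∈ M.elemSet (M.side F s) :=
  (M.isCompact_elemSet _).isClosed.frontier_subset (M.add_offset_mem_frontier hx s)

/-- The position of a face in the boundary of the element on the side `s`. -/
def shiftedFace (F : M.Face) (s : Bool) : Set (Pt d) :=
  (fun x => x - M.offset F s) ⁻¹' M.faceSet F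

/-- The facets of `K` are indexed by the face sides attached to it; a periodic face seen from the
side `false` is first translated by its shift. -/
theorem isFacetFamily (K : M.Elem) :
    IsFacetFamily (M.elemSet K)
      (fun p : {p : M.Face × Bool // M.side p.1 p.2 = K} => M.shiftedFace p.1.1 p.1.2)
      (fun p => M.outNormal p.1.1 p.1.2) where
  isCompact := M.isCompact_elemSet K
  convex := M.convex_elemSet K
  measurableSet p := (by fun_prop : Measurable fun x : Pt d => x - M.offset p.1.1 p.1.2)
    (M.measurableSet_faceSet _)
  nonempty p := by
    obtain ⟨x, hx⟩ := M.faceSet_nonempty p.1.1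
    exact ⟨x + M.offset p.1.1 p.1.2, by simpa [shiftedFace] using hx⟩
  subset_frontier := by
    rintro ⟨⟨F, s⟩, rfl⟩ x hx
    have := M.add_offset_mem_frontier hx s
    simpa using this
  norm_normal p := M.norm_outNormal _ _
  inner_nonpos := by
    rintro ⟨⟨F, s⟩, rfl⟩ x hx y hy
    cases s
    · have h := M.normal_false F _ hx y hy
      simp only [offset, Bool.false_eq_true, if_false, sub_add_cancel] at h
      simpa [outNormal] using h
    · have h := M.normal_true F _ hx y hy
      simpa [outNormal, offset] using h
  cover x hx := by
    obtain ⟨F, s, hs, hmem⟩ := M.frontier_cover K x hx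
    exact Set.mem_iUnion.2 ⟨⟨(F, s), hs⟩, hmem⟩
  overlap := by
    rintro ⟨⟨F, s⟩, hK⟩ ⟨⟨F', s'⟩, hK'⟩ hne
    refine M.face_overlap F s F' s' (hK.trans hK'.symm) fun h => hne ?_
    exact Subtype.ext h

theorem setIntegral_shiftedFace (F : M.Face) (s : Bool) (f : Pt d → ℝ) :
    ∫ x in M.shiftedFace F s, f x ∂μHE[d - 1]
      = ∫ x in M.faceSet F, f (x + M.offset F s) ∂μHE[d - 1] := by
  have h := (IsometryEquiv.subRight (M.offset F s)).measurePreserving_euclideanHausdorffMeasure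
    (d - 1)
  have h2 := h.setIntegral_preimage_emb
    (IsometryEquiv.subRight (M.offset F s)).toHomeomorph.measurableEmbedding
    (fun x => f (x + M.offset F s)) (M.faceSet F)
  rw [← h2]
  simp only [IsometryEquiv.subRight_apply, sub_add_cancel]
  rfl

theorem measure_faceSet_ne_top (F : M.Face) : μHE[d - 1] (M.faceSet F) ≠ ⊤ := by
  have h := (M.isFacetFamily (M.side F true)).measure_ne_top
    (M.interior_elemSet_nonempty _) ⟨(F, true), rfl⟩
  simpa [shiftedFace, offset] using h

theorem integrableOn_faceSet (F : M.Face) {f : Pt d → ℝ} (hf : ContinuousOn f (M.faceSet F)) :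
    IntegrableOn f (M.faceSet F) μHE[d - 1] := by
  obtain ⟨C, hC⟩ := (M.isCompact_faceSet F).exists_bound_of_continuousOn hf
  exact IntegrableOn.of_bound (M.measure_faceSet_ne_top F).lt_top
    (hf.aestronglyMeasurable (M.measurableSet_faceSet F)) C
    ((ae_restrict_iff' (M.measurableSet_faceSet F)).2 (ae_of_all _ hC))

theorem integrableOn_elemSet (K : M.Elem) {f : Pt d → ℝ} (hf : ContinuousOn f (M.elemSet K)) :
    IntegrableOn f (M.elemSet K) :=
  hf.integrableOn_compact (M.isCompact_elemSet K)

theorem continuousOn_trace {α : Type} [TopologicalSpace α] {w : M.Elem → Pt d → α}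
    (hw : ∀ K, ContinuousOn (w K) (M.elemSet K)) (F : M.Face) (s : Bool) :
    ContinuousOn (M.trace w F s) (M.faceSet F) :=
  (hw _).comp (by fun_prop) fun _ hx => M.add_offset_mem_elemSet hx s

/-! #### Linearity of the integrals -/

theorem intElem_congr {f g : M.Elem → Pt d → ℝ} (h : ∀ K, ∀ x ∈ M.elemSet K, f K x = g K x) :
    M.intElem f = M.intElem g :=
  Finset.sum_congr rfl fun K _ => setIntegral_congr_fun (M.measurableSet_elemSet K) (h K)

theorem intElem_add {f g : M.Elem → Pt d → ℝ} (hf : ∀ K, IntegrableOn (f K) (M.elemSet K))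
    (hg : ∀ K, IntegrableOn (g K) (M.elemSet K)) :
    M.intElem (fun K x => f K x + g K x) = M.intElem f + M.intElem g := by
  unfold intElem
  rw [← Finset.sum_add_distrib]
  exact Finset.sum_congr rfl fun K _ => integral_add (hf K) (hg K)

theorem intElem_sub {f g : M.Elem → Pt d → ℝ} (hf : ∀ K, IntegrableOn (f K) (M.elemSet K))
    (hg : ∀ K, IntegrableOn (g K) (M.elemSet K)) :
    M.intElem (fun K x => f K x - g K x) = M.intElem f - M.intElem g := by
  unfold intElem
  rw [← Finset.sum_sub_distrib]
  exact Finset.sum_congr rfl fun K _ => integral_sub (hf K) (hg K)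

theorem intElem_mono {f g : M.Elem → Pt d → ℝ} (hf : ∀ K, IntegrableOn (f K) (M.elemSet K))
    (hg : ∀ K, IntegrableOn (g K) (M.elemSet K)) (h : ∀ K, ∀ x ∈ M.elemSet K, f K x ≤ g K x) :
    M.intElem f ≤ M.intElem g :=
  Finset.sum_le_sum fun K _ => setIntegral_mono_on (hf K) (hg K) (M.measurableSet_elemSet K) (h K)

theorem intElem_const_mul (c : ℝ) (f : M.Elem → Pt d → ℝ) :
    M.intElem (fun K x => c * f K x) = c * M.intElem f := by
  unfold intElem
  rw [Finset.mul_sum]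
  exact Finset.sum_congr rfl fun K _ => integral_const_mul _ _

theorem intElem_sum {ι : Type*} (s : Finset ι) {f : ι → M.Elem → Pt d → ℝ}
    (hf : ∀ i ∈ s, ∀ K, IntegrableOn (f i K) (M.elemSet K)) :
    M.intElem (fun K x => ∑ i ∈ s, f i K x) = ∑ i ∈ s, M.intElem (f i) := by
  unfold intElem
  rw [Finset.sum_comm]
  exact Finset.sum_congr rfl fun K _ => integral_finsetSum _ fun i hi => hf i hi K

theorem intBdry_congr {f g : M.Face → Bool → Pt d → ℝ}
    (h : ∀ F s, ∀ x ∈ M.faceSet F, f F s x = g F s x) : M.intBdry f = M.intBdry g :=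
  Finset.sum_congr rfl fun F _ => Finset.sum_congr rfl fun s _ =>
    setIntegral_congr_fun (M.measurableSet_faceSet F) (h F s)

theorem intBdry_sub {f g : M.Face → Bool → Pt d → ℝ}
    (hf : ∀ F s, IntegrableOn (f F s) (M.faceSet F) μHE[d - 1])
    (hg : ∀ F s, IntegrableOn (g F s) (M.faceSet F) μHE[d - 1]) :
    M.intBdry (fun F s x => f F s x - g F s x) = M.intBdry f - M.intBdry g := by
  unfold intBdry
  simp only [← Finset.sum_sub_distrib]
  exact Finset.sum_congr rfl fun F _ => Finset.sum_congr rfl fun s _ =>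
    integral_sub (hf F s) (hg F s)

theorem intBdry_mono {f g : M.Face → Bool → Pt d → ℝ}
    (hf : ∀ F s, IntegrableOn (f F s) (M.faceSet F) μHE[d - 1])
    (hg : ∀ F s, IntegrableOn (g F s) (M.faceSet F) μHE[d - 1])
    (h : ∀ F s, ∀ x ∈ M.faceSet F, f F s x ≤ g F s x) : M.intBdry f ≤ M.intBdry g :=
  Finset.sum_le_sum fun F _ => Finset.sum_le_sum fun s _ =>
    setIntegral_mono_on (hf F s) (hg F s) (M.measurableSet_faceSet F) (h F s)

theorem intBdry_sum {ι : Type*} (t : Finset ι) {f : ι → M.Face → Bool → Pt d → ℝ}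
    (hf : ∀ i ∈ t, ∀ F s, IntegrableOn (f i F s) (M.faceSet F) μHE[d - 1]) :
    M.intBdry (fun F s x => ∑ i ∈ t, f i F s x) = ∑ i ∈ t, M.intBdry (f i) := by
  unfold intBdry
  rw [Finset.sum_comm (s := t)]
  refine Finset.sum_congr rfl fun F _ => ?_
  rw [Finset.sum_comm (s := t)]
  exact Finset.sum_congr rfl fun s _ => integral_finsetSum _ fun i hi => hf i hi F s

/-- A quantity on the faces that changes sign with the normal has no net boundary integral. -/
theorem intBdry_eq_zero_of_odd {f : M.Face → Bool → Pt d → ℝ}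
    (h : ∀ F, ∀ x ∈ M.faceSet F, f F false x = -f F true x) : M.intBdry f = 0 := by
  unfold intBdry
  refine Finset.sum_eq_zero fun F _ => ?_
  have e : ∫ x in M.faceSet F, f F false x ∂μHE[d - 1]
      = -∫ x in M.faceSet F, f F true x ∂μHE[d - 1] := by
    rw [← integral_neg]
    exact setIntegral_congr_fun (M.measurableSet_faceSet F) (h F)
  rw [Fintype.sum_bool, e, add_neg_cancel]

/-- The divergence theorem, summed over all elements. -/
theorem intElem_fderiv (hd : 1 ≤ d) {f : M.Elem → Pt d → ℝ}
    (hf : ∀ K, ∀ x ∈ M.elemSet K, ContDiffAt ℝ 1 (f K) x) (j : Fin d) :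
    M.intElem (fun K x => pderiv j (f K) x)
      = M.intBdry (fun F s x => M.trace f F s x * M.outNormal F s j) := by
  classical
  have h1 : ∀ K, ∫ x in M.elemSet K, pderiv j (f K) x
      = ∑ p : {p : M.Face × Bool // M.side p.1 p.2 = K},
        ∫ x in M.faceSet p.1.1, M.trace f p.1.1 p.1.2 x * M.outNormal p.1.1 p.1.2 j ∂μHE[d - 1] := by
    intro K
    have := (M.isFacetFamily K).integral_fderiv hd (M.interior_elemSet_nonempty K)
      (f' := fderiv ℝ (f K))
      (fun x hx => ((hf K x hx).differentiableAt one_ne_zero).hasFDerivAt)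
      (fun x hx => ((hf K x hx).fderiv_right (m := 0) le_rfl).continuousAt.continuousWithinAt)
      (EuclideanSpace.single j 1)
    unfold pderiv
    rw [this]
    refine Finset.sum_congr rfl ?_
    rintro ⟨⟨F, s⟩, rfl⟩ -
    simp only
    rw [setIntegral_shiftedFace]
    refine setIntegral_congr_fun (M.measurableSet_faceSet F) fun x _ => ?_
    simp [trace, EuclideanSpace.inner_single_right, mul_comm]
  unfold intElem intBdry
  -- Each pair of a face and a side belongs to exactly one element, so summing over elements and
  -- then over their facets is a sum over the fibres of `side`.
  rw [Finset.sum_congr rfl fun K _ => h1 K, ← Fintype.sum_prod_type'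
    (f := fun F s => ∫ x in M.faceSet F, M.trace f F s x * M.outNormal F s j ∂μHE[d - 1])]
  rw [← Fintype.sum_fiberwise (fun p : M.Face × Bool => M.side p.1 p.2)]

/-- Frontiers of convex sets are null, so the closed elements may be replaced by their disjoint
interiors, whose union lies between the null-set corrections of the domain. -/
theorem volume_domain : volume M.domain = ∑ K, volume (M.elemSet K) := by
  have hdisj : Pairwise (Function.onFun Disjoint fun K => interior (M.elemSet K)) :=
    fun K K' h => M.elem_disjoint K K' h
  have hint : ∀ K, volume (interior (M.elemSet K)) = volume (M.elemSet K) := fun K =>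
    measure_congr (interior_ae_eq_of_null_frontier ((M.convex_elemSet K).addHaar_frontier _))
  have h1 : ∑ K, volume (M.elemSet K) = volume (⋃ K, interior (M.elemSet K)) := by
    rw [measure_iUnion hdisj fun K => isOpen_interior.measurableSet, tsum_fintype]
    exact Finset.sum_congr rfl fun K _ => (hint K).symm
  refine le_antisymm ?_ ?_
  · calc volume M.domain ≤ volume (⋃ K, M.elemSet K) := measure_mono interior_subset
      _ ≤ ∑ K, volume (M.elemSet K) := measure_iUnion_fintype_le _ _
  · rw [h1]
    exact measure_mono (Set.iUnion_subset fun K => interior_mono (Set.subset_iUnion _ K))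

theorem toReal_volume_domain : (volume M.domain).toReal = M.intElem fun _ _ => 1 := by
  rw [volume_domain, ENNReal.toReal_sum fun K _ => (M.isCompact_elemSet K).measure_lt_top.ne]
  refine Finset.sum_congr rfl fun K _ => ?_
  rw [setIntegral_const, smul_eq_mul, mul_one]
  rfl

end PeriodicMesh

/-! ### The discrete spaces -/

section spaces

variable {M : PeriodicMesh d} {k : ℕ}

theorem contDiff_of_mem_spaceV {w : VField M} (hw : w ∈ spaceV M k) (K : M.Elem) (i : Idx d) :
    ContDiff ℝ 1 fun x => w K x i := by
  have h := (hw K i).contDiff.comp (M.psiInv K).contDiff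
  simpa only [Function.comp_def, M.psi_psiInv] using h

theorem contDiff_of_mem_spaceQ {r : QField M} (hr : r ∈ spaceQ M k) (K : M.Elem) (i : Idx d)
    (j : Fin d) : ContDiff ℝ 1 fun x => r K x i j := by
  have h := (hr K i j).contDiff.comp (M.psiInv K).contDiff
  simpa only [Function.comp_def, M.psi_psiInv] using h

theorem continuous_of_mem_spaceV {w : VField M} (hw : w ∈ spaceV M k) (K : M.Elem) :
    Continuous (w K) :=
  continuous_pi fun i => (contDiff_of_mem_spaceV hw K i).continuous

theorem const_mem_spaceV (c : State d) : (fun _ _ => c : VField M) ∈ spaceV M k :=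
  fun _ _ => IsPoly.const _

theorem const_mem_spaceMtilde (c : State d) : (fun _ _ => c : TraceField M) ∈ spaceMtilde M k :=
  ⟨fun _ _ => IsPoly.const _, fun _ _ _ _ _ _ _ => rfl⟩

/-- The element maps are affine, so a partial derivative becomes, in reference coordinates, a
derivative in a constant direction. This keeps polynomials of degree at most `k`. -/
theorem gradient_mem_spaceQ {w : VField M} (hw : w ∈ spaceV M k) :
    (fun K x i j => pderiv j (fun y => w K y i) x : QField M) ∈ spaceQ M k := by
  intro K i j
  have h1 := (hw K i).fderiv_apply ((M.psiInv K).contLinear (EuclideanSpace.single j 1))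
  have h2 : ∀ ξ, pderiv j (fun y => w K y i) (M.psi K ξ) = fderiv ℝ (fun ξ => w K (M.psi K ξ) i) ξ
      ((M.psiInv K).contLinear (EuclideanSpace.single j 1)) := by
    intro ξ
    have h3 : (fun y => w K y i) = (fun ξ => w K (M.psi K ξ) i) ∘ M.psiInv K := by
      funext y
      simp only [Function.comp_def, M.psi_psiInv]
    have h4 : HasFDerivAt (fun ξ => w K (M.psi K ξ) i)
        (fderiv ℝ (fun ξ => w K (M.psi K ξ) i) ξ) (M.psiInv K (M.psi K ξ)) := by
      rw [M.psiInv_psi]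
      exact ((hw K i).contDiff.differentiable one_ne_zero ξ).hasFDerivAt
    unfold pderiv
    rw [h3, (h4.comp _ (M.psiInv K).hasFDerivAt).fderiv]
    simp
  simp only [h2]
  exact h1

/-- The linear part of the face map is injective; a left inverse recovers the reference coordinates
continuously, and on the face the trace is a polynomial in them. -/
theorem continuousOn_of_mem_spaceMhat {m : TraceField M} (hm : m ∈ spaceMhat M k) (F : M.Face) :
    ContinuousOn (m F) (M.faceSet F) := by
  have hinj : LinearMap.ker (M.phi F).linear = ⊥ :=
    LinearMap.ker_eq_bot.2 ((M.phi F).linear_injective_iff.2 (M.phi_injective F))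
  obtain ⟨G, hG⟩ := (M.phi F).linear.exists_leftInverse_of_injective hinj
  have hGc : Continuous fun x : Pt d => G (x - M.phi F 0) :=
    G.continuous_of_finiteDimensional.comp (by fun_prop)
  have hinv : ∀ ξ, G (M.phi F ξ - M.phi F 0) = ξ := fun ξ => by
    have h1 : M.phi F ξ - M.phi F 0 = (M.phi F).linear ξ := by
      have := (M.phi F).linearMap_vsub ξ 0
      simpa using this.symm
    rw [h1]
    exact LinearMap.congr_fun hG ξ
  refine continuousOn_pi.2 fun i => ?_
  have h2 : Continuous fun x => m F (M.phi F (G (x - M.phi F 0))) i :=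
    (hm F i).contDiff.continuous.comp hGc
  refine h2.continuousOn.congr ?_
  rintro _ ⟨ξ, -, rfl⟩
  simp only [hinv]

/-- Interpolation on an element. -/
theorem exists_elem_interpolation (M : PeriodicMesh d) (k : ℕ) (K : M.Elem) :
    ∃ (ι : Type) (_ : Fintype ι) (p : ι → Pt d) (L : ι → Pt d → ℝ), (∀ a, p a ∈ M.elemSet K) ∧
      (∀ a, Continuous (L a)) ∧
      ∀ w ∈ spaceV M k, ∀ x, w K x = ∑ a, L a x • w K (p a) := by
  obtain ⟨ι, hι, p, L, hp, hL, hint⟩ := exists_interpolation k M.refElem_interior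
  refine ⟨ι, hι, fun a => M.psi K (p a), fun a x => L a (M.psiInv K x),
    fun a => ⟨_, hp a, rfl⟩, fun a => (hL a).contDiff.continuous.comp (M.psiInv K).continuous, ?_⟩
  intro w hw x
  funext i
  have := hint _ (hw K i) (M.psiInv K x)
  simp only [M.psi_psiInv] at this
  rw [this]
  simp only [Finset.sum_apply, Pi.smul_apply, smul_eq_mul]
  exact Finset.sum_congr rfl fun a _ => mul_comm _ _

end spaces

/-! ### Regularity in time of integrals of the solution -/

/-- A time-dependent discrete field on `[0, tf]` with physical values. -/
structure IsRegularField (g : Gas) (M : PeriodicMesh d) (k : ℕ) (tf : ℝ) (v : ℝ → VField M) :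
    Prop where
  mem : ∀ t ∈ Set.Icc 0 tf, v t ∈ spaceV M k
  continuous : ∀ K, ∀ x ∈ M.elemSet K, ContinuousOn (fun t => v t K x) (Set.Icc 0 tf)
  differentiable : ∀ K, ∀ x ∈ M.elemSet K, ∀ t ∈ Set.Ioo 0 tf,
    DifferentiableAt ℝ (fun t => v t K x) t
  physical : ∀ t ∈ Set.Icc 0 tf, ∀ K, ∀ x ∈ M.elemSet K, v t K x ∈ physV g d

namespace IsRegularField

variable {g : Gas} {M : PeriodicMesh d} {k : ℕ} {tf : ℝ} {v : ℝ → VField M}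

/-- Interpolation writes the field as a finite sum of fixed functions of `x` times point values
depending on `t`. Pointwise continuity in time thus upgrades to joint continuity. -/
theorem continuousOn_uncurry (hv : IsRegularField g M k tf v) (K : M.Elem) :
    ContinuousOn (fun p : ℝ × Pt d => v p.1 K p.2) (Set.Icc 0 tf ×ˢ M.elemSet K) := by
  obtain ⟨ι, _, p, L, hp, hL, hint⟩ := exists_elem_interpolation M k K
  have h : ContinuousOn (fun q : ℝ × Pt d => ∑ a, L a q.2 • v q.1 K (p a))
      (Set.Icc 0 tf ×ˢ M.elemSet K) := by
    refine continuousOn_finsetSum _ fun a _ => ?_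
    have h1 : ContinuousOn (fun q : ℝ × Pt d => L a q.2) (Set.Icc 0 tf ×ˢ M.elemSet K) :=
      ((hL a).comp continuous_snd).continuousOn
    have h2 : ContinuousOn (fun q : ℝ × Pt d => v q.1 K (p a)) (Set.Icc 0 tf ×ˢ M.elemSet K) :=
      (hv.continuous K (p a) (hp a)).comp continuous_fst.continuousOn fun q hq => hq.1
    exact h1.smul h2
  exact h.congr fun q hq => hint _ (hv.mem _ hq.1) _

theorem continuousOn_elem (hv : IsRegularField g M k tf v) {t : ℝ} (ht : t ∈ Set.Icc 0 tf)
    (K : M.Elem) : ContinuousOn (v t K) (M.elemSet K) :=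
  (continuous_of_mem_spaceV (hv.mem t ht) K).continuousOn

/-- The values on an element lie in a compact convex set of physical states. -/
theorem exists_compact_convex (hv : IsRegularField g M k tf v) (K : M.Elem) :
    ∃ C : Set (State d), IsCompact C ∧ Convex ℝ C ∧ C ⊆ physV g d ∧
      ∀ t ∈ Set.Icc 0 tf, ∀ x ∈ M.elemSet K, v t K x ∈ C := by
  have hcont := hv.continuousOn_uncurry K
  set S := Set.Icc 0 tf ×ˢ M.elemSet K
  have hS : IsCompact S := isCompact_Icc.prod (M.isCompact_elemSet K)
  obtain ⟨B, hB⟩ := hS.exists_bound_of_continuousOn hcont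
  have hneg : ∀ q ∈ S, v q.1 K q.2 iEn < 0 := fun q hq =>
    (mem_physV_iff g).1 (hv.physical _ hq.1 K _ hq.2)
  -- By compactness the energy component has a negative maximum, which keeps all values away from
  -- the boundary of the half-space. The value `-1` only serves the empty case.
  obtain ⟨e, he, hle⟩ : ∃ e < 0, ∀ q ∈ S, v q.1 K q.2 iEn ≤ e := by
    rcases S.eq_empty_or_nonempty with hS0 | hS0
    · exact ⟨-1, by norm_num, by simp [hS0]⟩
    · obtain ⟨q, hq, hmax⟩ := hS.exists_isMaxOn hS0 (continuousOn_pi.1 hcont iEn)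
      exact ⟨_, hneg q hq, fun p hp => hmax hp⟩
  refine ⟨Metric.closedBall 0 B ∩ {z | z iEn ≤ e}, ?_, ?_, ?_, ?_⟩
  · exact (isCompact_closedBall _ _).inter_right
      (isClosed_le (continuous_apply _) continuous_const)
  · exact (convex_closedBall _ _).inter (convex_halfSpace_le (IsLinearMap.mk (fun _ _ => rfl)
      fun _ _ => rfl) e)
  · exact fun z hz => (mem_physV_iff g).2 (lt_of_le_of_lt hz.2 he)
  · exact fun t ht x hx => ⟨mem_closedBall_zero_iff.2 (hB (t, x) ⟨ht, hx⟩), hle (t, x) ⟨ht, hx⟩⟩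

theorem continuousOn_deriv (hv : IsRegularField g M k tf v) {t : ℝ} (ht : t ∈ Set.Ioo 0 tf)
    (K : M.Elem) : ContinuousOn (fun x => deriv (fun t' => v t' K x) t) (M.elemSet K) := by
  obtain ⟨ι, _, p, L, hp, hL, hint⟩ := exists_elem_interpolation M k K
  have h : ∀ x ∈ M.elemSet K, deriv (fun t' => v t' K x) t
      = ∑ a, L a x • deriv (fun t' => v t' K (p a)) t := by
    intro x _
    have h1 : HasDerivAt (fun t' => ∑ a, L a x • v t' K (p a))
        (∑ a, L a x • deriv (fun t' => v t' K (p a)) t) t :=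
      HasDerivAt.fun_sum fun a _ =>
        ((hv.differentiable K (p a) (hp a) t ht).hasDerivAt).fun_const_smul _
    have h2 : (fun t' => v t' K x) =ᶠ[nhds t] fun t' => ∑ a, L a x • v t' K (p a) := by
      filter_upwards [isOpen_Ioo.mem_nhds ht] with t' ht'
      exact hint _ (hv.mem t' (Set.Ioo_subset_Icc_self ht')) x
    exact (h1.congr_of_eventuallyEq h2).deriv
  refine ContinuousOn.congr ?_ h
  refine continuousOn_finsetSum _ fun a _ => ?_
  have h1 : ContinuousOn (L a) (M.elemSet K) := (hL a).continuousOn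
  exact h1.smul continuousOn_const

/-- The field is Lipschitz continuous at each time, uniformly on an element. -/
theorem exists_lipschitz (hv : IsRegularField g M k tf v) {t : ℝ} (ht : t ∈ Set.Ioo 0 tf)
    (K : M.Elem) : ∃ C : ℝ, ∀ᶠ t' in nhds t, ∀ x ∈ M.elemSet K,
      ‖v t' K x - v t K x‖ ≤ C * ‖t' - t‖ := by
  obtain ⟨ι, _, p, L, hp, hL, hint⟩ := exists_elem_interpolation M k K
  have h1 : ∀ a, ∃ C : ℝ, ∀ᶠ t' in nhds t, ‖v t' K (p a) - v t K (p a)‖ ≤ C * ‖t' - t‖ := fun a =>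
    (hv.differentiable K (p a) (hp a) t ht).hasDerivAt.isBigO_sub.bound
  choose C hC using h1
  have h2 : ∀ a, ∃ B : ℝ, ∀ x ∈ M.elemSet K, ‖L a x‖ ≤ B := fun a =>
    (M.isCompact_elemSet K).exists_bound_of_continuousOn (hL a).continuousOn
  choose B hB using h2
  refine ⟨∑ a, B a * C a, ?_⟩
  filter_upwards [isOpen_Ioo.mem_nhds ht, Filter.eventually_all.2 hC] with t' ht' hC' x hx
  rw [hint _ (hv.mem t' (Set.Ioo_subset_Icc_self ht')) x,
    hint _ (hv.mem t (Set.Ioo_subset_Icc_self ht)) x, ← Finset.sum_sub_distrib, Finset.sum_mul]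
  refine (norm_sum_le _ _).trans (Finset.sum_le_sum fun a _ => ?_)
  rw [← smul_sub, norm_smul, mul_assoc]
  exact mul_le_mul (hB a x hx) (hC' a) (norm_nonneg _) ((norm_nonneg _).trans (hB a x hx))

/-- Differentiation under the integral sign. -/
theorem hasDerivAt_intElem (hv : IsRegularField g M k tf v) {Φ : State d → ℝ}
    (hΦ : ∀ z ∈ physV g d, ContDiffAt ℝ 1 Φ z) {t : ℝ} (ht : t ∈ Set.Ioo 0 tf) :
    HasDerivAt (fun t' => M.intElem fun K x => Φ (v t' K x))
      (M.intElem fun K x => fderiv ℝ Φ (v t K x) (deriv (fun t' => v t' K x) t)) t := by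
  refine HasDerivAt.fun_sum fun K _ => ?_
  have htc := Set.Ioo_subset_Icc_self ht
  have hΦc : ContinuousOn Φ (physV g d) := fun z hz => (hΦ z hz).continuousAt.continuousWithinAt
  have hΦd : ContinuousOn (fderiv ℝ Φ) (physV g d) := fun z hz =>
    ((hΦ z hz).fderiv_right (m := 0) le_rfl).continuousAt.continuousWithinAt
  obtain ⟨C, hCc, hCx, hCp, hC⟩ := hv.exists_compact_convex K
  obtain ⟨B, hB⟩ := hCc.exists_bound_of_continuousOn (hΦd.mono hCp)
  obtain ⟨A, hA⟩ := hv.exists_lipschitz ht K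
  have hcont : ∀ t' ∈ Set.Icc 0 tf, ContinuousOn (fun x => Φ (v t' K x)) (M.elemSet K) :=
    fun t' ht' => hΦc.comp (hv.continuousOn_elem ht' K) fun x hx => hv.physical t' ht' K x hx
  have hD : ContinuousOn (fun x => fderiv ℝ Φ (v t K x) (deriv (fun t' => v t' K x) t))
      (M.elemSet K) :=
    (hΦd.comp (hv.continuousOn_elem htc K) fun x hx => hv.physical t htc K x hx).clm_apply
      (hv.continuousOn_deriv ht K)
  have hms := M.measurableSet_elemSet K
  have hfin : volume (M.elemSet K) < ⊤ := (M.isCompact_elemSet K).measure_lt_top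
  -- Domination is needed only relative to the base time `t`, so differentiability in time suffices
  -- and continuity of the time derivative is not used. The bound is the product of a bound `B` for
  -- the derivative of `Φ` on a compact convex set and the Lipschitz constant `A` of the field at
  -- `t`.
  have key := hasFDerivAt_integral_of_dominated_loc_of_lip' (μ := volume.restrict (M.elemSet K))
    (F := fun t' x => Φ (v t' K x))
    (F' := fun x => fderiv ℝ Φ (v t K x) (deriv (fun t' => v t' K x) t) • (1 : ℝ →L[ℝ] ℝ))
    (bound := fun _ => B * A) (x₀ := t)
    (s := {t' | t' ∈ Set.Ioo 0 tf ∧ ∀ x ∈ M.elemSet K, ‖v t' K x - v t K x‖ ≤ A * ‖t' - t‖})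
    (Filter.inter_mem (isOpen_Ioo.mem_nhds ht) hA)
    (fun t' ht' => (hcont t' (Set.Ioo_subset_Icc_self ht'.1)).aestronglyMeasurable hms)
    ((hcont t htc).integrableOn_compact (M.isCompact_elemSet K))
    ((hD.aestronglyMeasurable hms).smul_const _)
    ((ae_restrict_iff' hms).2 (ae_of_all _ fun x hx t' ht' => ?_))
    (integrableOn_const hfin.ne)
    ((ae_restrict_iff' hms).2 (ae_of_all _ fun x hx => ?_))
  · refine key.2.hasDerivAt.congr_deriv ?_
    rw [ContinuousLinearMap.integral_apply key.1]
    simp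
  · have h1 := hCx.norm_image_sub_le_of_norm_fderiv_le
      (fun z hz => (hΦ z (hCp hz)).differentiableAt one_ne_zero) hB
      (hC t htc x hx) (hC t' (Set.Ioo_subset_Icc_self ht'.1) x hx)
    have hB0 : 0 ≤ B := (norm_nonneg _).trans (hB _ (hC t htc x hx))
    rw [mul_assoc]
    exact h1.trans (mul_le_mul_of_nonneg_left (ht'.2 x hx) hB0)
  · have h1 := ((hΦ _ (hv.physical t htc K x hx)).differentiableAt one_ne_zero).hasFDerivAt
    have h2 := h1.comp_hasDerivAt t (hv.differentiable K x hx t ht).hasDerivAt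
    refine h2.hasFDerivAt.congr_fderiv ?_
    ext
    simp

theorem continuousOn_intElem (hv : IsRegularField g M k tf v) {Φ : State d → ℝ}
    (hΦ : ContinuousOn Φ (physV g d)) :
    ContinuousOn (fun t => M.intElem fun K x => Φ (v t K x)) (Set.Icc 0 tf) := by
  refine continuousOn_finsetSum _ fun K _ => fun t ht => ?_
  obtain ⟨C, hCc, -, hCp, hC⟩ := hv.exists_compact_convex K
  obtain ⟨B, hB⟩ := hCc.exists_bound_of_continuousOn (hΦ.mono hCp)
  have hms := M.measurableSet_elemSet K
  have hfin : volume (M.elemSet K) < ⊤ := (M.isCompact_elemSet K).measure_lt_top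
  refine continuousWithinAt_of_dominated (bound := fun _ => B) ?_ ?_ (integrableOn_const hfin.ne) ?_
  · filter_upwards [self_mem_nhdsWithin] with t' ht'
    exact (hΦ.comp (hv.continuousOn_elem ht' K)
      fun x hx => hv.physical t' ht' K x hx).aestronglyMeasurable hms
  · filter_upwards [self_mem_nhdsWithin] with t' ht'
    exact (ae_restrict_iff' hms).2 (ae_of_all _ fun x hx => hB _ (hC t' ht' x hx))
  · refine (ae_restrict_iff' hms).2 (ae_of_all _ fun x hx => ?_)
    exact (hΦ.comp (hv.continuous K x hx) fun t' ht' => hv.physical t' ht' K x hx) t ht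

end IsRegularField

theorem IsSolution.isRegularField {g : Gas} {mu beta : State d → ℝ} {M : PeriodicMesh d} {k : ℕ}
    {Mh : Set (TraceField M)} {sigma : Stab d} {tf : ℝ} {u0 : Pt d → State d}
    {q : ℝ → QField M} {v : ℝ → VField M} {vhat : ℝ → TraceField M}
    {ghat : ℝ → M.Face → Bool → Pt d → State d}
    (hsol : IsSolution g mu beta M k Mh sigma tf u0 q v vhat ghat)
    (hphys : IsPhysical g M tf v vhat) : IsRegularField g M k tf v :=
  ⟨hsol.v_mem, hsol.v_continuous, hsol.v_differentiable, hphys.1⟩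

/-! ### Derivatives of the conserved variables and of the entropy -/

theorem contDiffAt_entropyH_consOfEntr (g : Gas) {z : State d} (hz : z ∈ physV g d) :
    ContDiffAt ℝ 1 (fun z : State d => entropyH g (consOfEntr g z)) z := by
  have hz' := (mem_physV_iff g).1 hz
  have h : ContDiffAt ℝ 1 (fun z : State d => z ⬝ᵥ consOfEntr g z - (g.gam - 1) * rhoOfEntr g z)
      z := by
    refine ContDiffAt.sub ?_ (contDiffAt_const.mul (contDiffAt_rhoOfEntr g hz'))
    exact ContDiffAt.sum fun i _ => (contDiff_apply _ _ _).contDiffAt.mul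
      (contDiffAt_pi.1 (contDiffAt_consOfEntr g hz') i)
  refine h.congr_of_eventuallyEq ?_
  filter_upwards [(isOpen_physV g d).mem_nhds hz] with y hy
  exact entropyH_consOfEntr g ((mem_physV_iff g).1 hy)

/-- `∂H/∂u = v`: the chain rule for the generalized entropy. -/
theorem fderiv_entropyH_consOfEntr (g : Gas) {z : State d} (hz : z ∈ physV g d) (y : State d) :
    fderiv ℝ (fun z : State d => entropyH g (consOfEntr g z)) z y = z ⬝ᵥ dCons g z y := by
  have hz' := (mem_physV_iff g).1 hz
  have h0 : z + (0 : ℝ) • y = z := by simp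
  have hl := hasDerivAt_line z y
  have h1 : HasDerivAt (fun t : ℝ => entropyH g (consOfEntr g (z + t • y)))
      (fderiv ℝ (fun z : State d => entropyH g (consOfEntr g z)) z y) 0 := by
    refine HasFDerivAt.comp_hasDerivAt (l := fun z : State d => entropyH g (consOfEntr g z))
      (0 : ℝ) ?_ hl
    rw [h0]
    exact ((contDiffAt_entropyH_consOfEntr g hz).differentiableAt one_ne_zero).hasFDerivAt
  have hv0 : (z + (0 : ℝ) • y) iEn < 0 := by rw [h0]; exact hz'
  have h2 := hasDerivAt_pi.1 hl
  have h3 := hasDerivAt_pi.1 (hasDerivAt_consOfEntr g hl hv0)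
  have h4 : HasDerivAt (fun t : ℝ => (z + t • y) ⬝ᵥ consOfEntr g (z + t • y)
      - (g.gam - 1) * rhoOfEntr g (z + t • y)) (z ⬝ᵥ dCons g z y) 0 := by
    have h5 : HasDerivAt (fun t : ℝ => (z + t • y) ⬝ᵥ consOfEntr g (z + t • y))
        (∑ i, (y i * consOfEntr g (z + (0 : ℝ) • y) i
          + (z + (0 : ℝ) • y) i * dCons g (z + (0 : ℝ) • y) y i)) 0 :=
      HasDerivAt.fun_sum fun i _ => (h2 i).mul (h3 i)
    -- The product rule term `y · u` cancels the derivative of `(γ - 1) ρ`, as always for a Legendre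
    -- transform, and leaves `z · du`.
    refine (h5.sub ((hasDerivAt_rhoOfEntr g hl hv0).const_mul (g.gam - 1))).congr_deriv ?_
    have h6 := g.gam_sub_one_pos.ne'
    rw [h0, Finset.sum_add_distrib]
    change y ⬝ᵥ consOfEntr g z + z ⬝ᵥ dCons g z y - _ = _
    rw [dotProduct_consOfEntr]
    field_simp
    ring
  refine h1.unique (h4.congr_of_eventuallyEq ?_)
  have hev : ∀ᶠ t in nhds (0 : ℝ), (z + t • y) iEn < 0 :=
    (h2 iEn).continuousAt.eventually_lt continuousAt_const hv0
  exact hev.mono fun t ht => entropyH_consOfEntr g ht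

theorem fderiv_consOfEntr_apply (g : Gas) {z : State d} (hz : z ∈ physV g d) (y : State d)
    (i : Idx d) : fderiv ℝ (fun z : State d => consOfEntr g z i) z y = dCons g z y i := by
  have hz' := (mem_physV_iff g).1 hz
  rw [← fderiv_consOfEntr g hz']
  have h := ((contDiffAt_consOfEntr g hz').differentiableAt one_ne_zero).hasFDerivAt
  rw [(hasFDerivAt_pi'.1 h i).fderiv]
  rfl

/-! ### The entropy identity -/

theorem continuous_pderiv {f : Pt d → ℝ} (hf : ContDiff ℝ 1 f) (j : Fin d) :
    Continuous (pderiv j f) :=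
  (hf.continuous_fderiv one_ne_zero).clm_apply continuous_const

theorem pderiv_mul {f h : Pt d → ℝ} (hf : ContDiff ℝ 1 f) (hh : ContDiff ℝ 1 h) (j : Fin d)
    (x : Pt d) : pderiv j (fun y => f y * h y) x = f x * pderiv j h x + pderiv j f x * h x := by
  unfold pderiv
  rw [fderiv_fun_mul (hf.differentiable one_ne_zero x) (hh.differentiable one_ne_zero x)]
  simp [mul_comm]

/-- Chain rule along the coordinate direction, with `∂ψ_n/∂v = F · n`. Summed over `j`, it writes `F
: ∇w` as the divergence of the flux potential. -/
theorem sum_inviscidFlux_pderiv (g : Gas) {w : Pt d → State d} {x : Pt d}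
    (hw : ∀ i, DifferentiableAt ℝ (fun y => w y i) x) (hx : w x ∈ physV g d) (j : Fin d) :
    pderiv j (fun y => fluxPotential g (EuclideanSpace.single j 1) (w y)) x
      = ∑ i, inviscidFlux g (consOfEntr g (w x)) j i * pderiv j (fun y => w y i) x := by
  have hx' := (mem_physV_iff g).1 hx
  set e : Pt d := EuclideanSpace.single j 1
  have h0 : x + (0 : ℝ) • e = x := by simp
  have hl : HasDerivAt (fun t : ℝ => x + t • e) e 0 := by
    simpa using ((hasDerivAt_id (0 : ℝ)).smul_const e).const_add x
  have hw' : HasDerivAt (fun t : ℝ => w (x + t • e)) (fun i => pderiv j (fun y => w y i) x) 0 := by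
    refine hasDerivAt_pi.2 fun i => ?_
    refine HasFDerivAt.comp_hasDerivAt (l := fun y => w y i) (0 : ℝ) ?_ hl
    rw [h0]
    exact (hw i).hasFDerivAt
  have h1 := hasDerivAt_fluxPotential g e hw' (by rw [h0]; exact hx')
  have hwd : DifferentiableAt ℝ w x := differentiableAt_pi.2 hw
  have hd : DifferentiableAt ℝ (fun y => fluxPotential g e (w y)) x :=
    DifferentiableAt.comp (g := fluxPotential g e) x
      ((contDiffAt_fluxPotential g e hx').differentiableAt one_ne_zero) hwd
  have h2 : HasDerivAt (fun t : ℝ => fluxPotential g e (w (x + t • e)))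
      (pderiv j (fun y => fluxPotential g e (w y)) x) 0 := by
    refine HasFDerivAt.comp_hasDerivAt (l := fun y => fluxPotential g e (w y)) (0 : ℝ) ?_ hl
    rw [h0]
    exact hd.hasFDerivAt
  rw [h2.unique h1, h0, dotProduct_comm]
  refine Finset.sum_congr rfl fun i _ => ?_
  simp [inviscidFluxN, e]

section identity

variable {M : PeriodicMesh d} {k : ℕ}

/-- Integration by parts in the discrete spaces. -/
theorem integration_by_parts (hd : 1 ≤ d) {w : VField M} (hw : w ∈ spaceV M k) {r : QField M}
    (hr : r ∈ spaceQ M k) :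
    M.intElem (fun K x => ∑ i, w K x i * ∑ j, pderiv j (fun y => r K y i j) x)
      + M.intElem (fun K x => ∑ i, ∑ j, pderiv j (fun y => w K y i) x * r K x i j)
      = M.intBdry (fun F s x =>
          ∑ i, M.trace w F s x i * ∑ j, M.trace r F s x i j * M.outNormal F s j) := by
  have hwC := fun K i => contDiff_of_mem_spaceV hw K i
  have hrC := fun K i j => contDiff_of_mem_spaceQ hr K i j
  have hcw : ∀ F s i, ContinuousOn (fun x => M.trace w F s x i) (M.faceSet F) := fun F s i =>
    M.continuousOn_trace (w := fun K x => w K x i) (fun K => (hwC K i).continuous.continuousOn) F s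
  have hcr : ∀ F s i j, ContinuousOn (fun x => M.trace r F s x i j) (M.faceSet F) :=
    fun F s i j => M.continuousOn_trace (w := fun K x => r K x i j)
      (fun K => (hrC K i j).continuous.continuousOn) F s
  have hadd := M.intElem_add (f := fun K x => ∑ i, w K x i * ∑ j, pderiv j (fun y => r K y i j) x)
    (g := fun K x => ∑ i, ∑ j, pderiv j (fun y => w K y i) x * r K x i j)
    (fun K => M.integrableOn_elemSet K (continuous_finsetSum _ fun i _ => (hwC K i).continuous.mul
      (continuous_finsetSum _ fun j _ => continuous_pderiv (hrC K i j) j)).continuousOn)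
    (fun K => M.integrableOn_elemSet K (continuous_finsetSum _ fun i _ => continuous_finsetSum _
      fun j _ => (continuous_pderiv (hwC K i) j).mul (hrC K i j).continuous).continuousOn)
  have h1 : M.intElem (fun K x => (∑ i, w K x i * ∑ j, pderiv j (fun y => r K y i j) x)
        + ∑ i, ∑ j, pderiv j (fun y => w K y i) x * r K x i j)
      = M.intElem (fun K x => ∑ i, ∑ j, pderiv j (fun y => w K y i * r K y i j) x) := by
    refine M.intElem_congr fun K x _ => ?_
    rw [← Finset.sum_add_distrib]
    refine Finset.sum_congr rfl fun i _ => ?_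
    rw [Finset.mul_sum, ← Finset.sum_add_distrib]
    exact Finset.sum_congr rfl fun j _ => (pderiv_mul (hwC K i) (hrC K i j) j x).symm
  have h2 : M.intBdry (fun F s x =>
        ∑ i, M.trace w F s x i * ∑ j, M.trace r F s x i j * M.outNormal F s j)
      = M.intBdry (fun F s x =>
        ∑ i, ∑ j, M.trace w F s x i * M.trace r F s x i j * M.outNormal F s j) := by
    refine M.intBdry_congr fun F s x _ => Finset.sum_congr rfl fun i _ => ?_
    rw [Finset.mul_sum]
    exact Finset.sum_congr rfl fun j _ => (mul_assoc _ _ _).symm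
  rw [← hadd, h1, h2, M.intElem_sum, M.intBdry_sum]
  · refine Finset.sum_congr rfl fun i _ => ?_
    rw [M.intElem_sum, M.intBdry_sum]
    · exact Finset.sum_congr rfl fun j _ =>
        M.intElem_fderiv hd (fun K x _ => ((hwC K i).mul (hrC K i j)).contDiffAt) j
    · exact fun j _ F s => M.integrableOn_faceSet F
        (((hcw F s i).mul (hcr F s i j)).mul continuousOn_const)
    · exact fun j _ K => M.integrableOn_elemSet K
        (continuous_pderiv ((hwC K i).mul (hrC K i j)) j).continuousOn
  · exact fun i _ F s => M.integrableOn_faceSet F (continuousOn_finsetSum _ fun j _ =>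
      ((hcw F s i).mul (hcr F s i j)).mul continuousOn_const)
  · exact fun i _ K => M.integrableOn_elemSet K (continuous_finsetSum _ fun j _ =>
      continuous_pderiv ((hwC K i).mul (hrC K i j)) j).continuousOn

/-- Continuity of `G` makes the two integrals exist separately, so orthogonality of `G - P` can be
split into an equality. -/
theorem intElem_projection {G P r : QField M} (hGP : IsProjQ M k G P)
    (hG : ∀ K i j, ContinuousOn (fun x => G K x i j) (M.elemSet K)) (hr : r ∈ spaceQ M k) :
    M.intElem (fun K x => ∑ i, ∑ j, G K x i j * r K x i j)
      = M.intElem (fun K x => ∑ i, ∑ j, P K x i j * r K x i j) := by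
  have hrc := fun K i j =>
    (contDiff_of_mem_spaceQ hr K i j).continuous.continuousOn (s := M.elemSet K)
  have hPc := fun K i j =>
    (contDiff_of_mem_spaceQ hGP.1 K i j).continuous.continuousOn (s := M.elemSet K)
  have h := hGP.2 r hr
  rw [← sub_eq_zero, ← M.intElem_sub, ← h]
  · refine M.intElem_congr fun K x _ => ?_
    simp only [← Finset.sum_sub_distrib, sub_mul]
  · exact fun K => M.integrableOn_elemSet K (continuousOn_finsetSum _ fun i _ =>
      continuousOn_finsetSum _ fun j _ => (hG K i j).mul (hrc K i j))
  · exact fun K => M.integrableOn_elemSet K (continuousOn_finsetSum _ fun i _ =>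
      continuousOn_finsetSum _ fun j _ => (hPc K i j).mul (hrc K i j))

/-- The viscous terms of the scheme add up to the viscous dissipation. -/
theorem viscous_identity (hd : 1 ≤ d) {w : VField M} (hw : w ∈ spaceV M k) {q G P : QField M}
    (hq : q ∈ spaceQ M k) (hG : ∀ K i j, ContinuousOn (fun x => G K x i j) (M.elemSet K))
    (hGP : IsProjQ M k G P) {what : TraceField M}
    (hgrad : ∀ r ∈ spaceQ M k, M.intElem (fun K x => ∑ i, ∑ j, q K x i j * r K x i j)
      + M.intElem (fun K x => ∑ i, w K x i * ∑ j, pderiv j (fun y => r K y i j) x)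
      - M.intBdry (fun F s x =>
          ∑ i, what F x i * ∑ j, M.trace r F s x i j * M.outNormal F s j) = 0) :
    M.intElem (fun K x => ∑ i, ∑ j, G K x i j * pderiv j (fun y => w K y i) x)
      - M.intBdry (fun F s x =>
          ∑ i, M.trace w F s x i * ∑ j, M.trace P F s x i j * M.outNormal F s j)
      + M.intBdry (fun F s x =>
          ∑ i, what F x i * ∑ j, M.trace P F s x i j * M.outNormal F s j)
      = M.intElem (fun K x => ∑ i, ∑ j, q K x i j * G K x i j) := by
  -- Both `∇w` and `q` lie in the projection space, so `G` may be exchanged for `P` against either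
  -- of them. The projection `P` is itself an admissible test function in the gradient equation,
  -- whose boundary terms then match the projected viscous flux.
  have h1 := intElem_projection hGP hG (gradient_mem_spaceQ hw)
  have h2 := intElem_projection hGP hG hq
  have h3 := hgrad P hGP.1
  have h4 := integration_by_parts hd hw hGP.1
  simp only [mul_comm (q _ _ _ _)] at h3 ⊢
  simp only [mul_comm (pderiv _ _ _)] at h4
  linarith

/-- The inviscid volume terms of the scheme reduce to boundary terms. -/
theorem inviscid_identity (hd : 1 ≤ d) (g : Gas) {w : VField M} (hw : w ∈ spaceV M k)
    (hphys : ∀ K, ∀ x ∈ M.elemSet K, w K x ∈ physV g d) :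
    M.intElem (fun K x => ∑ i, ∑ j,
        inviscidFlux g (consOfEntr g (w K x)) j i * pderiv j (fun y => w K y i) x)
      = M.intBdry (fun F s x => fluxPotential g (M.outNormal F s) (M.trace w F s x)) := by
  have hwC := fun K i => contDiff_of_mem_spaceV hw K i
  have hwc : ∀ K, ContinuousOn (w K) (M.elemSet K) := fun K =>
    (continuous_of_mem_spaceV hw K).continuousOn
  -- The potential is linear in the normal, so it is the normal component of a vector field to which
  -- the divergence theorem applies componentwise.
  have h1 : ∀ F s x, fluxPotential g (M.outNormal F s) (M.trace w F s x)
      = ∑ j, M.trace (fun K x => fluxPotential g (EuclideanSpace.single j 1) (w K x)) F s x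
        * M.outNormal F s j := by
    intro F s x
    unfold fluxPotential PeriodicMesh.trace
    rw [Finset.mul_sum]
    refine Finset.sum_congr rfl fun j _ => ?_
    simp [mul_assoc]
  have hpc : ∀ n : Pt d, ∀ K, ContinuousOn (fun x => fluxPotential g n (w K x)) (M.elemSet K) :=
    fun n K => (continuousOn_fluxPotential g n).comp (hwc K) (hphys K)
  simp only [h1]
  rw [M.intBdry_sum]
  · have h2 : M.intElem (fun K x => ∑ i, ∑ j,
          inviscidFlux g (consOfEntr g (w K x)) j i * pderiv j (fun y => w K y i) x)
        = M.intElem (fun K x => ∑ j,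
          pderiv j (fun y => fluxPotential g (EuclideanSpace.single j 1) (w K y)) x) := by
      refine M.intElem_congr fun K x hx => ?_
      rw [Finset.sum_comm]
      exact Finset.sum_congr rfl fun j _ => (sum_inviscidFlux_pderiv g
        (fun i => (hwC K i).differentiable one_ne_zero x) (hphys K x hx) j).symm
    have hC : ∀ n : Pt d, ∀ K, ∀ x ∈ M.elemSet K,
        ContDiffAt ℝ 1 (fun x => fluxPotential g n (w K x)) x := fun n K x hx =>
      ContDiffAt.comp (g := fluxPotential g n) x
        (contDiffAt_fluxPotential g n ((mem_physV_iff g).1 (hphys K x hx)))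
        (contDiff_pi.2 (hwC K)).contDiffAt
    rw [h2, M.intElem_sum]
    · exact Finset.sum_congr rfl fun j _ => M.intElem_fderiv hd (hC _) j
    · refine fun j _ K => M.integrableOn_elemSet K fun x hx => ?_
      exact (((hC _ K x hx).fderiv_right (m := 0) le_rfl).continuousAt.clm_apply
        continuousAt_const).continuousWithinAt
  · exact fun j _ F s => M.integrableOn_faceSet F
      ((M.continuousOn_trace (hpc _) F s).mul continuousOn_const)

/-- The potential of a single-valued trace has no net boundary integral. -/
theorem intBdry_fluxPotential_eq_zero (g : Gas) (what : TraceField M) :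
    M.intBdry (fun F s x => fluxPotential g (M.outNormal F s) (what F x)) = 0 := by
  refine M.intBdry_eq_zero_of_odd fun F x _ => ?_
  simp [fluxPotential, PeriodicMesh.outNormal]

theorem integrableOn_dotProduct (F : M.Face) {f h : Pt d → State d}
    (hf : IntegrableOn f (M.faceSet F) μHE[d - 1]) (hh : ContinuousOn h (M.faceSet F)) :
    IntegrableOn (fun x => f x ⬝ᵥ h x) (M.faceSet F) μHE[d - 1] := by
  refine integrable_finsetSum _ fun i _ => ?_
  have h1 : IntegrableOn (fun x => f x i) (M.faceSet F) μHE[d - 1] :=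
    (ContinuousLinearMap.proj (R := ℝ) (φ := fun _ : Idx d => ℝ) i).integrable_comp hf
  exact h1.mul_continuousOn (continuousOn_pi.1 hh i) (M.isCompact_faceSet F)

end identity

/-! ### Entropy decay, conservation and the entropy bounds -/

section stability

variable {g : Gas} {mu beta : State d → ℝ} {M : PeriodicMesh d} {k : ℕ} {Mh : Set (TraceField M)}
  {sigma : Stab d} {tf : ℝ} {u0 : Pt d → State d} {q : ℝ → QField M} {v : ℝ → VField M}
  {vhat : ℝ → TraceField M} {ghat : ℝ → M.Face → Bool → Pt d → State d}

theorem deriv_consOfEntr (hv : IsRegularField g M k tf v) {t : ℝ} (ht : t ∈ Set.Ioo 0 tf)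
    {K : M.Elem} {x : Pt d} (hx : x ∈ M.elemSet K) :
    deriv (fun t' => consOfEntr g (v t' K x)) t
      = dCons g (v t K x) (deriv (fun t' => v t' K x) t) :=
  (hasDerivAt_consOfEntr g (hv.differentiable K x hx t ht).hasDerivAt
    ((mem_physV_iff g).1 (hv.physical t (Set.Ioo_subset_Icc_self ht) K x hx))).deriv

theorem hasDerivAt_totalEntropy (hv : IsRegularField g M k tf v) {t : ℝ} (ht : t ∈ Set.Ioo 0 tf) :
    HasDerivAt (fun t' => totalEntropy g M (v t'))
      (M.intElem fun K x => deriv (fun t' => consOfEntr g (v t' K x)) t ⬝ᵥ v t K x) t := by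
  refine (hv.hasDerivAt_intElem (fun z hz => contDiffAt_entropyH_consOfEntr g hz) ht).congr_deriv ?_
  refine M.intElem_congr fun K x hx => ?_
  rw [fderiv_entropyH_consOfEntr g (hv.physical t (Set.Ioo_subset_Icc_self ht) K x hx),
    deriv_consOfEntr hv ht hx, dotProduct_comm]

theorem hasDerivAt_intElem_consOfEntr (hv : IsRegularField g M k tf v) {t : ℝ}
    (ht : t ∈ Set.Ioo 0 tf) (i : Idx d) :
    HasDerivAt (fun t' => M.intElem fun K x => consOfEntr g (v t' K x) i)
      (M.intElem fun K x => deriv (fun t' => consOfEntr g (v t' K x)) t ⬝ᵥ Pi.single i 1) t := by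
  refine (hv.hasDerivAt_intElem (Φ := fun z => consOfEntr g z i) (fun z hz =>
    contDiffAt_pi.1 (contDiffAt_consOfEntr g ((mem_physV_iff g).1 hz)) i) ht).congr_deriv ?_
  refine M.intElem_congr fun K x hx => ?_
  rw [fderiv_consOfEntr_apply g (hv.physical t (Set.Ioo_subset_Icc_self ht) K x hx),
    deriv_consOfEntr hv ht hx, dotProduct_single, mul_one]

/-- The production of entropy by the scheme has a sign. -/
theorem entropy_production_nonpos (hd : 1 ≤ d) (hd3 : d ≤ 3)
    (hmu : ContinuousOn mu (physU g d)) (hbeta : ContinuousOn beta (physU g d))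
    (hmu0 : ∀ u ∈ physU g d, 0 ≤ mu u) (hbeta0 : ∀ u ∈ physU g d, 0 ≤ beta u)
    (hMhat : Mh ⊆ spaceMhat M k)
    (hsigma : sigma = sigmaMV g ∨
      ∃ vs : State d → State d → Pt d → State d, IntermediateState g vs ∧
        (sigma = sigmaS g vs ∨ sigma = sigmaSLF g vs))
    (hsol : IsSolution g mu beta M k Mh sigma tf u0 q v vhat ghat)
    (hghat : ∀ t ∈ Set.Ioo 0 tf, IsProjFlux g mu beta M k (v t) (q t) (ghat t))
    (hphys : IsPhysical g M tf v vhat) {t : ℝ} (ht : t ∈ Set.Ioo 0 tf) :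
    M.intElem (fun K x => deriv (fun t' => consOfEntr g (v t' K x)) t ⬝ᵥ v t K x) ≤ 0 := by
  have htc := Set.Ioo_subset_Icc_self ht
  have hvV := hsol.v_mem t htc
  have hqQ := hsol.q_mem t ht
  have hvp := hphys.1 t htc
  have hvhp := hphys.2 t ht
  have hvhM := hsol.vhat_mem t ht
  obtain ⟨P, hP, hgP⟩ := hghat t ht
  have hvc : ∀ K, ContinuousOn (v t K) (M.elemSet K) := fun K =>
    (continuous_of_mem_spaceV hvV K).continuousOn
  have hqc : ∀ K i j, ContinuousOn (fun x => q t K x i j) (M.elemSet K) := fun K i j =>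
    (contDiff_of_mem_spaceQ hqQ K i j).continuous.continuousOn
  have hdv : ∀ K i j, ContinuousOn (pderiv j fun y => v t K y i) (M.elemSet K) := fun K i j =>
    (continuous_pderiv (contDiff_of_mem_spaceV hvV K i) j).continuousOn
  have hGc : ∀ K i j, ContinuousOn (fun x => viscousFlux g mu beta (v t K x) (q t K x) i j)
      (M.elemSet K) := fun K i j =>
    continuousOn_viscousFlux g mu beta hmu hbeta (hvc K) (hvp K) (hqc K) i j
  have hFc : ∀ K i j, ContinuousOn (fun x => inviscidFlux g (consOfEntr g (v t K x)) j i)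
      (M.elemSet K) := fun K i j =>
    (continuousOn_inviscidFlux g j i).comp (hvc K) (hvp K)
  have htr : ∀ F s, ContinuousOn (M.trace (v t) F s) (M.faceSet F) := M.continuousOn_trace hvc
  have hvh : ∀ F, ContinuousOn (vhat t F) (M.faceSet F) :=
    continuousOn_of_mem_spaceMhat (hMhat hvhM)
  have hgc : ∀ F s, ContinuousOn (ghat t F s) (M.faceSet F) := fun F s => by
    have h : ContinuousOn (fun x i => ∑ j, M.trace P F s x i j * M.outNormal F s j)
        (M.faceSet F) :=
      continuousOn_pi.2 fun i => continuousOn_finsetSum _ fun j _ =>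
        (M.continuousOn_trace (w := fun K x => P K x i j)
          (fun K => (contDiff_of_mem_spaceQ hP.1 K i j).continuous.continuousOn) F s).mul
          continuousOn_const
    exact h.congr fun x hx => funext fun i => hgP F s x hx i
  have hgi := fun F s => M.integrableOn_faceSet F
    ((Continuous.dotProduct continuous_fst continuous_snd).comp_continuousOn
      ((hgc F s).prodMk ((htr F s).sub (hvh F))))
  have hfi := hsol.flux_integrable t ht
  have hfiv := fun F s => integrableOn_dotProduct F (hfi F s) (htr F s)
  have hfivh := fun F s => integrableOn_dotProduct F (hfi F s) (hvh F)
  have hfid := fun F s => integrableOn_dotProduct F (hfi F s) ((htr F s).sub (hvh F))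
  -- The solution is its own test function: `v_h` in the conservation equation and `v̂_h` in the
  -- transmission equation.
  have hcons := hsol.conservation_eq t ht _ hvV
  have htrans := hsol.transmission_eq t ht _ hvhM
  have hvisc := viscous_identity hd hvV hqQ hGc hP (hsol.gradient_eq t ht)
  have hinv := inviscid_identity hd g hvV hvp
  have hpot := intBdry_fluxPotential_eq_zero g (vhat t)
  have hvolF := fun K => M.integrableOn_elemSet K (continuousOn_finsetSum Finset.univ fun i _ =>
    continuousOn_finsetSum Finset.univ fun j _ => (hFc K i j).mul (hdv K i j))
  have hvolG := fun K => M.integrableOn_elemSet K (continuousOn_finsetSum Finset.univ fun i _ =>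
    continuousOn_finsetSum Finset.univ fun j _ => (hGc K i j).mul (hdv K i j))
  simp only [Pi.mul_apply] at hvolF hvolG
  have hsplit : M.intElem (fun K x => ∑ i, ∑ j, (inviscidFlux g (consOfEntr g (v t K x)) j i
        + viscousFlux g mu beta (v t K x) (q t K x) i j) * pderiv j (fun y => v t K y i) x)
      = _ + _ := (M.intElem_congr fun K x _ => by
        simp only [add_mul, Finset.sum_add_distrib]).trans (M.intElem_add hvolF hvolG)
  have hvq : M.intElem (fun K x => ∑ i, ∑ j,
      q t K x i j * viscousFlux g mu beta (v t K x) (q t K x) i j) ≤ 0 := by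
    have h := M.intElem_mono (f := fun K x => ∑ i, ∑ j,
      q t K x i j * viscousFlux g mu beta (v t K x) (q t K x) i j) (g := fun _ _ => 0)
      (fun K => M.integrableOn_elemSet K (continuousOn_finsetSum _ fun i _ =>
        continuousOn_finsetSum _ fun j _ => (hqc K i j).mul (hGc K i j)))
      (fun K => integrableOn_zero) (fun K x hx => viscous_dissipation hd3 g mu beta hmu0 hbeta0
        ((mem_physV_iff g).1 (hvp K x hx)) _)
    simpa [PeriodicMesh.intElem] using h
  have hpv := fun F s => M.integrableOn_faceSet F ((continuousOn_fluxPotential g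
    (M.outNormal F s)).comp (htr F s) fun x hx => hvp _ _ (M.add_offset_mem_elemSet hx s))
  have hpvh := fun F s => M.integrableOn_faceSet F ((continuousOn_fluxPotential g
    (M.outNormal F s)).comp (hvh F) fun x hx => hvhp F x hx)
  have hb1 := M.intBdry_sub hfiv hfivh
  have hb2 : M.intBdry _ = _ := M.intBdry_sub hpv hpvh
  have hb3 : M.intBdry _ = _ := M.intBdry_sub hfid hgi
  have hgv : ∀ F s, ContinuousOn (fun x => ∑ i, M.trace (v t) F s x i
      * ∑ j, M.trace P F s x i j * M.outNormal F s j) (M.faceSet F) := fun F s =>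
    ((Continuous.dotProduct continuous_fst continuous_snd).comp_continuousOn
      ((htr F s).prodMk (hgc F s))).congr fun x hx => Finset.sum_congr rfl fun i _ => by
        rw [← hgP F s x hx i]
  have hgvh : ∀ F s, ContinuousOn (fun x => ∑ i, vhat t F x i
      * ∑ j, M.trace P F s x i j * M.outNormal F s j) (M.faceSet F) := fun F s =>
    ((Continuous.dotProduct continuous_fst continuous_snd).comp_continuousOn
      ((hvh F).prodMk (hgc F s))).congr fun x hx => Finset.sum_congr rfl fun i _ => by
        rw [← hgP F s x hx i]
  have hb4 : M.intBdry (fun F s x => ghat t F s x ⬝ᵥ (M.trace (v t) F s x - vhat t F x)) = _ :=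
    (M.intBdry_congr fun F s x hx => by
      rw [dotProduct_comm, sub_dotProduct]
      simp only [dotProduct, hgP F s x hx]).trans
    (M.intBdry_sub (fun F s => M.integrableOn_faceSet F (hgv F s))
      fun F s => M.integrableOn_faceSet F (hgvh F s))
  -- Only the sum `f̂ + ĝ` is assumed integrable. The inviscid part is obtained by subtracting the
  -- viscous part, which is continuous on each face.
  have hbd := M.intBdry_mono (fun F s => (hpv F s).sub (hpvh F s))
    (fun F s => (hfid F s).sub (hgi F s)) fun F s x hx => by
      have h := potential_diff_le_numFlux g hsigma (M.norm_outNormal F s) (hvhp F x hx)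
        (hvp _ _ (M.add_offset_mem_elemSet hx s))
      simp only [Pi.sub_apply, Function.comp_apply, add_dotProduct, add_sub_cancel_right]
      exact h
  simp only [← dotProduct_sub] at hb1
  simp only [Pi.sub_def, Function.comp_def] at hb1 hb2 hb3 hb4 hbd
  rw [hsplit] at hcons
  -- The entropy rate equals the `(G, q)` term plus the boundary integral of the potential
  -- difference minus `f̂ · (v - v̂)`; both contributions are nonpositive.
  linarith

/-- The integrals of the conserved variables do not change in time. -/
theorem intElem_consOfEntr_eq (hMtilde : spaceMtilde M k ⊆ Mh)
    (hsol : IsSolution g mu beta M k Mh sigma tf u0 q v vhat ghat)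
    (hphys : IsPhysical g M tf v vhat) (i : Idx d) {t : ℝ} (ht : t ∈ Set.Icc 0 tf) :
    M.intElem (fun K x => consOfEntr g (v t K x) i)
      = M.intElem (fun K x => consOfEntr g (v 0 K x) i) := by
  have hv := hsol.isRegularField hphys
  have hcont := hv.continuousOn_intElem (Φ := fun z => consOfEntr g z i)
    (continuousOn_pi.1 (continuousOn_consOfEntr g) i)
  have hder : ∀ t ∈ interior (Set.Icc 0 tf),
      HasDerivAt (fun t' => M.intElem fun K x => consOfEntr g (v t' K x) i) 0 t := by
    intro t ht
    rw [interior_Icc] at ht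
    -- Unit vectors are admissible in both test spaces, since `Mh` contains the continuous traces.
    -- Their gradients vanish, and the transmission equation removes the boundary term.
    have h1 := hsol.conservation_eq t ht _ (const_mem_spaceV (Pi.single i 1))
    have h2 := hsol.transmission_eq t ht _ (hMtilde (const_mem_spaceMtilde (Pi.single i 1)))
    have h3 : ∀ x (l : Idx d) (j : Fin d),
        pderiv j (fun _ : Pt d => (Pi.single i 1 : State d) l) x = 0 := fun x l j => by
      simp [pderiv]
    refine (hasDerivAt_intElem_consOfEntr hv ht i).congr_deriv ?_
    simp only [h3, mul_zero, Finset.sum_const_zero] at h1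
    have h4 : M.intElem (fun _ _ => 0) = 0 := by simp [PeriodicMesh.intElem]
    rw [h4, sub_zero] at h1
    unfold PeriodicMesh.trace at h1 h2
    linarith
  have hdiff : DifferentiableOn ℝ (fun t' => M.intElem fun K x => consOfEntr g (v t' K x) i)
      (interior (Set.Icc 0 tf)) := fun t ht =>
    (hder t ht).differentiableAt.differentiableWithinAt
  have h0 : (0 : ℝ) ∈ Set.Icc 0 tf := ⟨le_rfl, ht.1.trans ht.2⟩
  exact le_antisymm
    (antitoneOn_of_deriv_nonpos (convex_Icc 0 tf) hcont hdiff (fun t ht => (hder t ht).deriv.le)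
      h0 ht ht.1)
    (monotoneOn_of_deriv_nonneg (convex_Icc 0 tf) hcont hdiff (fun t ht => (hder t ht).deriv.ge)
      h0 ht ht.1)

/-! ### The mean state and the lower entropy bound. -/

theorem intElem_pos [Nonempty M.Elem] {f : M.Elem → Pt d → ℝ}
    (hf : ∀ K, ContinuousOn (f K) (M.elemSet K)) (hpos : ∀ K, ∀ x ∈ M.elemSet K, 0 < f K x) :
    0 < M.intElem f := by
  refine Finset.sum_pos (fun K _ => ?_) Finset.univ_nonempty
  rw [setIntegral_pos_iff_support_of_nonneg_ae
    ((ae_restrict_iff' (M.measurableSet_elemSet K)).2 (ae_of_all _ fun x hx => (hpos K x hx).le))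
    (M.integrableOn_elemSet K (hf K)),
    Set.inter_eq_right.2 fun x hx => Function.mem_support.2 (hpos K x hx).ne']
  exact Measure.measure_pos_of_nonempty_interior _ (M.interior_elemSet_nonempty K)

theorem intElem_dotProduct {f : M.Elem → Pt d → State d}
    (hf : ∀ K, ContinuousOn (f K) (M.elemSet K)) (a : State d) :
    M.intElem (fun K x => a ⬝ᵥ f K x) = a ⬝ᵥ fun i => M.intElem fun K x => f K x i := by
  unfold dotProduct
  rw [M.intElem_sum]
  · exact Finset.sum_congr rfl fun i _ => M.intElem_const_mul _ _
  · exact fun i _ K => M.integrableOn_elemSet K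
      (continuousOn_const.mul (continuousOn_pi.1 (hf K) i))

/-- The mean of a physical field is a physical state. -/
theorem minEntropyState_mem_physU [Nonempty M.Elem] {w : VField M}
    (hw : ∀ K, ContinuousOn (w K) (M.elemSet K))
    (hphys : ∀ K, ∀ x ∈ M.elemSet K, w K x ∈ physV g d) : minEntropyState g M w ∈ physU g d := by
  have huc : ∀ K, ContinuousOn (fun x => consOfEntr g (w K x)) (M.elemSet K) := fun K =>
    (continuousOn_consOfEntr g).comp (hw K) (hphys K)
  have hu : ∀ K, ∀ x ∈ M.elemSet K, consOfEntr g (w K x) ∈ physU g d := fun K x hx =>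
    consOfEntr_mem_physU g ((mem_physV_iff g).1 (hphys K x hx))
  have hvol : 0 < (volume M.domain).toReal := by
    rw [M.toReal_volume_domain]
    exact intElem_pos (fun _ => continuousOn_const) fun _ _ _ => one_pos
  -- A linear functional that is positive on `X_u` has a positive integral over the field, hence is
  -- positive at the mean. Applied to the functionals that cut out `X_u`, this makes the mean
  -- physical.
  have hpos : ∀ a : State d, (∀ u ∈ physU g d, 0 < a ⬝ᵥ u) → 0 < a ⬝ᵥ minEntropyState g M w := by
    intro a ha
    have h1 : minEntropyState g M w = (volume M.domain).toReal⁻¹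
        • fun i => M.intElem fun K x => consOfEntr g (w K x) i := rfl
    rw [h1, dotProduct_smul, ← intElem_dotProduct huc a]
    exact mul_pos (inv_pos.2 hvol) (intElem_pos (fun K =>
      (Continuous.dotProduct continuous_const continuous_id).comp_continuousOn (huc K))
      fun K x hx => ha _ (hu K x hx))
  have hfun : ∀ (c : Fin d → ℝ) (u : State d),
      mkState ((∑ j, c j ^ 2) / 2) (fun j => -c j) 1 ⬝ᵥ u
        = u iEn - ∑ j, c j * u (iMom j) + (∑ j, c j ^ 2) / 2 * u iRho := fun c u => by
    simp [mkState, dotProduct, Fintype.sum_sum_type]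
    ring
  refine mem_physU_of_functional_pos g ?_ fun c => ?_
  · have h := hpos (Pi.single iRho 1) fun u hu => by simpa using hu.1
    simpa using h
  · rw [← hfun]
    exact hpos _ fun u hu => by
      rw [hfun]
      exact physU_functional_pos g hu c

/-- Jensen's inequality for the generalized entropy. -/
theorem intElem_entropyH_le_totalEntropy {w w0 : VField M}
    (hw : ∀ K, ContinuousOn (w K) (M.elemSet K))
    (hphys : ∀ K, ∀ x ∈ M.elemSet K, w K x ∈ physV g d)
    (hmean : ∀ i, M.intElem (fun K x => consOfEntr g (w K x) i)
      = M.intElem (fun K x => consOfEntr g (w0 K x) i)) :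
    M.intElem (fun _ _ => entropyH g (minEntropyState g M w0)) ≤ totalEntropy g M w := by
  have hmin : minEntropyState g M w0 = minEntropyState g M w :=
    funext fun i => by unfold minEntropyState; rw [hmean]
  rw [hmin]
  -- Without elements both sides are empty sums; otherwise the volume is positive and the mean is
  -- meaningful.
  rcases isEmpty_or_nonempty M.Elem with h | h
  · simp [totalEntropy, PeriodicMesh.intElem]
  have hvol : 0 < (volume M.domain).toReal := by
    rw [M.toReal_volume_domain]
    exact intElem_pos (fun _ => continuousOn_const) fun _ _ _ => one_pos
  have hmem := minEntropyState_mem_physU hw hphys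
  have huc : ∀ K, ContinuousOn (fun x => consOfEntr g (w K x)) (M.elemSet K) := fun K =>
    (continuousOn_consOfEntr g).comp (hw K) (hphys K)
  set U := minEntropyState g M w with hU
  -- The slope of the supporting hyperplane at the mean is its entropy variable. The linear term has
  -- zero integral because `U` is the mean, so integrating the tangent inequality gives the bound.
  set y := entrOfCons g U with hy
  have hyE : y iEn < 0 := (mem_physV_iff g).1 ⟨U, hmem, rfl⟩
  have hyU : consOfEntr g y = U := consOfEntr_entrOfCons g U hmem
  have hi1 : ∀ K, IntegrableOn (fun x => y ⬝ᵥ (consOfEntr g (w K x) - U)) (M.elemSet K) :=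
    fun K => M.integrableOn_elemSet K ((Continuous.dotProduct continuous_const
      (continuous_id.sub continuous_const)).comp_continuousOn (huc K))
  have hzero : M.intElem (fun K x => y ⬝ᵥ (consOfEntr g (w K x) - U)) = 0 := by
    refine (intElem_dotProduct (f := fun K x => consOfEntr g (w K x) - U)
      (fun K => (huc K).sub continuousOn_const) y).trans ?_
    have h1 : ∀ i, M.intElem (fun K x => (consOfEntr g (w K x) - U) i) = 0 := fun i => by
      have h2 : M.intElem (fun _ _ => U i) = U i * (volume M.domain).toReal := by
        rw [M.toReal_volume_domain, ← M.intElem_const_mul]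
        simp
      have h3 := M.intElem_sub (f := fun K x => consOfEntr g (w K x) i) (g := fun _ _ => U i)
        (fun K => M.integrableOn_elemSet K (continuousOn_pi.1 (huc K) i))
        (fun K => M.integrableOn_elemSet K continuousOn_const)
      refine h3.trans ?_
      rw [h2, hU, minEntropyState]
      field_simp
      simp
    simp only [h1]
    exact dotProduct_zero y
  have hle := M.intElem_mono
    (f := fun K x => entropyH g U + y ⬝ᵥ (consOfEntr g (w K x) - U))
    (g := fun K x => entropyH g (consOfEntr g (w K x)))
    (fun K => (M.integrableOn_elemSet K continuousOn_const).add (hi1 K))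
    (fun K => M.integrableOn_elemSet K ((continuousOn_entropyH g).comp (hw K) (hphys K)))
    fun K x hx => by
      have h1 := entropyH_tangent g ((mem_physV_iff g).1 (hphys K x hx)) hyE
      rwa [hyU] at h1
  rwa [M.intElem_add (fun K => M.integrableOn_elemSet K continuousOn_const) hi1, hzero,
    add_zero] at hle

end stability

end HDGNS

end

/-! ### The entropy stability theorem. -/

open HDGNS in
theorem mainTheorem6 {d : ℕ} (hd : 1 ≤ d) (hd3 : d ≤ 3)
    (g : Gas) (mu beta : State d → ℝ)
    (hmu : ContinuousOn mu (physU g d)) (hbeta : ContinuousOn beta (physU g d))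
    (hmu0 : ∀ u ∈ physU g d, 0 ≤ mu u) (hbeta0 : ∀ u ∈ physU g d, 0 ≤ beta u)
    (M : PeriodicMesh d) (k : ℕ)
    (Mh : Submodule ℝ (TraceField M))
    (hMtilde : spaceMtilde M k ⊆ Mh) (hMhat : (Mh : Set (TraceField M)) ⊆ spaceMhat M k)
    (tf : ℝ) (htf : 0 < tf) (u0 : Pt d → State d)
    (q : ℝ → QField M) (v : ℝ → VField M) (vhat : ℝ → TraceField M)
    (ghat : ℝ → M.Face → Bool → Pt d → State d)
    (sigma : Stab d)
    (hsigma : sigma = sigmaMV g ∨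
      ∃ vs : State d → State d → Pt d → State d, IntermediateState g vs ∧
        (sigma = sigmaS g vs ∨ sigma = sigmaSLF g vs))
    (hsol : IsSolution g mu beta M k Mh sigma tf u0 q v vhat ghat)
    (hghat : ∀ t ∈ Set.Ioo 0 tf, IsProjFlux g mu beta M k (v t) (q t) (ghat t))
    (hphys : IsPhysical g M tf v vhat) :
    EntropyStable g M tf v := by
  have hv := hsol.isRegularField hphys
  have hdecay : ∀ t ∈ Set.Ioo 0 tf,
      ∃ D ≤ 0, HasDerivAt (fun t' => totalEntropy g M (v t')) D t := fun t ht =>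
    ⟨_, entropy_production_nonpos hd hd3 hmu hbeta hmu0 hbeta0 hMhat hsigma hsol hghat hphys ht,
      hasDerivAt_totalEntropy hv ht⟩
  have hanti : AntitoneOn (fun t => totalEntropy g M (v t)) (Set.Icc 0 tf) := by
    -- The derivative is available only on the open interval; continuity up to the endpoints carries
    -- monotonicity to the closed one.
    refine antitoneOn_of_deriv_nonpos (convex_Icc 0 tf)
      (hv.continuousOn_intElem (continuousOn_entropyH g)) ?_ ?_
    · rw [interior_Icc]
      intro t ht
      obtain ⟨D, -, h⟩ := hdecay t ht
      exact h.differentiableAt.differentiableWithinAt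
    · rw [interior_Icc]
      intro t ht
      obtain ⟨D, hD, h⟩ := hdecay t ht
      rwa [h.deriv]
  exact
    { decay := hdecay
      antitone := hanti
      lower := fun t ht => intElem_entropyH_le_totalEntropy (hv.continuousOn_elem ht)
        (hphys.1 t ht) fun i => intElem_consOfEntr_eq hMtilde hsol hphys i ht
      upper := fun t ht => hanti ⟨le_rfl, htf.le⟩ ht ht.1 }
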